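/- Let $n\ge 3$ and let $\Omega\subset\mathbb{R}^n$ be a bounded domain (connected open set) with $C^1$ boundary. For $A\in C(\overline{\Omega},\mathbb{C}^n)$ and $q\in L^\infty(\Omega,\mathbb{C})$ let $$L_{A,q}=\sum_{j=1}^n(D_j+A_j)^2+q,\qquad D=i^{-1}\nabla .$$ Write $a\cdot b=\sum_j a_jb_j$ (no conjugation), $A^2=A\cdot A$, and for $u,g\in H^1(\Omega)$ put $$B_{A,q}(u,g)=\int_\Omega\big(\nabla u\cdot\nabla g+iA\cdot(u\nabla g-g\nabla u)+(A^2+q)ug\big)\,dx .$$ A function $u\in H^1(\Omega)$ solves $L_{A,q}u=0$ in $\Omega$ in the sense of distributions if $B_{A,q}(u,\varphi)=0$ for all $\varphi\in C_0^\infty(\Omega)$. Let $u|_{\partial\Omega}$ denote the trace of $u\in H^1(\Omega)$ in $H^{1/2}(\partial\Omega)=H^1(\Omega)/H^1_0(\Omega)$, where $H^1_0(\Omega)$ is the closure of $C_0^\infty(\Omega)$ in $H^1(\Omega)$. For a solution $u$, the element $(\partial_\nu u+i(A\cdot\nu)u)|_{\partial\Omega}$ of the dual space $H^{-1/2}(\partial\Omega)$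 is defined by $$\langle\partial_\nu u+i(A\cdot\nu)u,\,g|_{\partial\Omega}\rangle_{\partial\Omega}=B_{A,q}(u,g)\quad\text{for all } g\in H^1(\Omega).$$ Let $$C_{A,q}=\{(u|_{\partial\Omega},(\partial_\nu u+i(A\cdot\nu)u)|_{\partial\Omega}) : u\in H^1(\Omega),\ L_{A,q}u=0\text{ in }\Omega\}$$ be the set of Cauchy data. Let $A_1,A_2\in C(\overline{\Omega},\mathbb{C}^n)$ and $q_1,q_2\in L^\infty(\Omega,\mathbb{C})$ satisfy $C_{A_1,q_1}=C_{A_2,q_2}$. Then $$\tau\cdot(A_1-A_2)(x_0)=0$$ for every $x_0\in\partial\Omega$ and every unit tangent vector $\tau\in T_{x_0}(\partial\Omega)$. (It is not assumed that the Dirichlet problem for $L_{A_j,q_j}$ in $\Omega$ is well posed.) -/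

import Mathlib

open MeasureTheory TopologicalSpace
open scoped Distributions ContDiff ENNReal

noncomputable section

namespace MagneticSchrodinger

variable {n : ℕ}

/-! ### Domains with `C¹` boundary and tangent vectors -/

/-- `ρ` is a `C¹` defining function of `Ω` near the point `x`: in an open neighbourhood `U` of `x`,
`Ω = {ρ > 0}` and `∂Ω = {ρ = 0}`, and the differential of `ρ` does not vanish at `x`. -/
def IsLocalDefiningFunction (Ω : Set (EuclideanSpace ℝ (Fin n))) (x : EuclideanSpace ℝ (Fin n))
    (ρ : EuclideanSpace ℝ (Fin n) → ℝ) : Prop :=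
  ∃ U : Set (EuclideanSpace ℝ (Fin n)), IsOpen U ∧ x ∈ U ∧ ContDiffOn ℝ 1 ρ U ∧
    (∀ y ∈ U, y ∈ Ω ↔ 0 < ρ y) ∧ (∀ y ∈ U, y ∈ frontier Ω ↔ ρ y = 0) ∧ fderiv ℝ ρ x ≠ 0

/-- `Ω` has `C¹` boundary. -/
def HasC1Boundary (Ω : Set (EuclideanSpace ℝ (Fin n))) : Prop :=
  ∀ x ∈ frontier Ω, ∃ ρ, IsLocalDefiningFunction Ω x ρ

/-- `τ ∈ T_x(∂Ω)`: the tangent space at `x` is the kernel of the differential of a defining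
function (any two defining functions near `x` have proportional differentials at `x`). -/
def IsTangentVector (Ω : Set (EuclideanSpace ℝ (Fin n))) (x τ : EuclideanSpace ℝ (Fin n)) : Prop :=
  ∃ ρ, IsLocalDefiningFunction Ω x ρ ∧ fderiv ℝ ρ x τ = 0

/-! ### The Sobolev spaces `H¹(Ω)`, `H¹₀(Ω)` and the trace space `H^{1/2}(∂Ω)` -/

/-- Lebesgue measure on `Ω`. -/
abbrev vol (Ω : Opens (EuclideanSpace ℝ (Fin n))) : Measure (EuclideanSpace ℝ (Fin n)) :=
  volume.restrict (Ω : Set (EuclideanSpace ℝ (Fin n)))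

/-- The partial derivative `∂_j φ`. -/
def partialDeriv (j : Fin n) (φ : EuclideanSpace ℝ (Fin n) → ℂ) (x : EuclideanSpace ℝ (Fin n)) : ℂ :=
  fderiv ℝ φ x (EuclideanSpace.single j 1)

/-- The gradient `∇φ`, with values in `ℂⁿ`. -/
def gradient (φ : EuclideanSpace ℝ (Fin n) → ℂ) (x : EuclideanSpace ℝ (Fin n)) :
    EuclideanSpace ℂ (Fin n) :=
  WithLp.toLp 2 fun j => partialDeriv j φ x

/-- The bilinear (not sesquilinear) product `a · b = ∑ a_j b_j` on `ℂⁿ`. -/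
def dot (a b : EuclideanSpace ℂ (Fin n)) : ℂ := ∑ j, a j * b j

/-- The Hilbert space `L²(Ω, ℂ) × L²(Ω, ℂⁿ)`. -/
abbrev L2Pair (Ω : Opens (EuclideanSpace ℝ (Fin n))) : Type :=
  WithLp 2 (Lp ℂ 2 (vol Ω) × Lp (EuclideanSpace ℂ (Fin n)) 2 (vol Ω))

/-- `G ∈ L²(Ω, ℂⁿ)` is the weak gradient of `u ∈ L²(Ω)`. -/
def IsWeakGradient (Ω : Opens (EuclideanSpace ℝ (Fin n)))
    (u : Lp ℂ 2 (vol Ω)) (G : Lp (EuclideanSpace ℂ (Fin n)) 2 (vol Ω)) : Prop :=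
  ∀ (φ : 𝓓(Ω, ℂ)) (j : Fin n),
    ∫ x in Ω, u x * partialDeriv j φ x = - ∫ x in Ω, G x j * φ x

theorem continuous_partialDeriv {Ω : Opens (EuclideanSpace ℝ (Fin n))} (φ : 𝓓(Ω, ℂ)) (j : Fin n) :
    Continuous (partialDeriv j φ) :=
  (φ.contDiff.continuous_fderiv (by simp)).clm_apply continuous_const

theorem hasCompactSupport_partialDeriv {Ω : Opens (EuclideanSpace ℝ (Fin n))} (φ : 𝓓(Ω, ℂ))
    (j : Fin n) : HasCompactSupport (partialDeriv j φ) :=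
  φ.hasCompactSupport.fderiv_apply ℝ _

theorem memLp_test {Ω : Opens (EuclideanSpace ℝ (Fin n))} (φ : 𝓓(Ω, ℂ)) : MemLp φ 2 (vol Ω) :=
  (φ.continuous.memLp_of_hasCompactSupport φ.hasCompactSupport).restrict _

theorem memLp_partialDeriv {Ω : Opens (EuclideanSpace ℝ (Fin n))} (φ : 𝓓(Ω, ℂ)) (j : Fin n) :
    MemLp (partialDeriv j φ) 2 (vol Ω) :=
  ((continuous_partialDeriv φ j).memLp_of_hasCompactSupport
    (hasCompactSupport_partialDeriv φ j)).restrict _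

theorem memLp_gradient {Ω : Opens (EuclideanSpace ℝ (Fin n))} (φ : 𝓓(Ω, ℂ)) :
    MemLp (gradient φ) 2 (vol Ω) :=
  MemLp.of_eval_piLp fun j => memLp_partialDeriv φ j

theorem memLp_coord {Ω : Opens (EuclideanSpace ℝ (Fin n))}
    (G : Lp (EuclideanSpace ℂ (Fin n)) 2 (vol Ω)) (j : Fin n) :
    MemLp (fun x => G x j) 2 (vol Ω) :=
  (Lp.memLp G).eval_piLp j

/-- `H¹(Ω)`, realised as the space of pairs `(u, ∇u)` with `u ∈ L²(Ω)` and weak gradient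
`∇u ∈ L²(Ω, ℂⁿ)`, with the norm `(‖u‖² + ‖∇u‖²)^{1/2}`. -/
def H1 (Ω : Opens (EuclideanSpace ℝ (Fin n))) : Submodule ℂ (L2Pair Ω) where
  carrier := {w | IsWeakGradient Ω w.fst w.snd}
  zero_mem' := by
    intro φ j
    have h1 : ∫ x in Ω, (0 : Lp ℂ 2 (vol Ω)) x * partialDeriv j φ x = 0 := by
      refine integral_eq_zero_of_ae ?_
      filter_upwards [Lp.coeFn_zero ℂ 2 (vol Ω)] with x hx
      rw [hx, Pi.zero_apply, zero_mul]
    have h2 : ∫ x in Ω, (0 : Lp (EuclideanSpace ℂ (Fin n)) 2 (vol Ω)) x j * φ x = 0 := by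
      refine integral_eq_zero_of_ae ?_
      filter_upwards [Lp.coeFn_zero (EuclideanSpace ℂ (Fin n)) 2 (vol Ω)] with x hx
      rw [hx, Pi.zero_apply, PiLp.zero_apply, zero_mul]
      rfl
    simp only [WithLp.zero_fst, WithLp.zero_snd]
    rw [h1, h2, neg_zero]
  add_mem' := by
    intro v w hv hw φ j
    have h1 : ∫ x in Ω, (v.fst + w.fst) x * partialDeriv j φ x
        = (∫ x in Ω, v.fst x * partialDeriv j φ x) + ∫ x in Ω, w.fst x * partialDeriv j φ x := by
      refine Eq.trans (integral_congr_ae ?_)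
        (integral_add ((Lp.memLp v.fst).integrable_mul (memLp_partialDeriv φ j))
          ((Lp.memLp w.fst).integrable_mul (memLp_partialDeriv φ j)))
      filter_upwards [Lp.coeFn_add v.fst w.fst] with x hx
      rw [hx, Pi.add_apply, add_mul]
    have h2 : ∫ x in Ω, (v.snd + w.snd) x j * φ x
        = (∫ x in Ω, v.snd x j * φ x) + ∫ x in Ω, w.snd x j * φ x := by
      refine Eq.trans (integral_congr_ae ?_)
        (integral_add ((memLp_coord v.snd j).integrable_mul (memLp_test φ))
          ((memLp_coord w.snd j).integrable_mul (memLp_test φ)))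
      filter_upwards [Lp.coeFn_add v.snd w.snd] with x hx
      rw [hx, Pi.add_apply, PiLp.add_apply, add_mul]
    simp only [WithLp.add_fst, WithLp.add_snd]
    rw [h1, h2, hv φ j, hw φ j, neg_add]
  smul_mem' := by
    intro c w hw φ j
    have h1 : ∫ x in Ω, (c • w.fst) x * partialDeriv j φ x
        = c * ∫ x in Ω, w.fst x * partialDeriv j φ x := by
      rw [← integral_const_mul]
      refine integral_congr_ae ?_
      filter_upwards [Lp.coeFn_smul c w.fst] with x hx
      rw [hx, Pi.smul_apply, smul_eq_mul, mul_assoc]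
    have h2 : ∫ x in Ω, (c • w.snd) x j * φ x = c * ∫ x in Ω, w.snd x j * φ x := by
      rw [← integral_const_mul]
      refine integral_congr_ae ?_
      filter_upwards [Lp.coeFn_smul c w.snd] with x hx
      rw [hx, Pi.smul_apply, PiLp.smul_apply, smul_eq_mul, mul_assoc]
    simp only [WithLp.smul_fst, WithLp.smul_snd]
    rw [h1, h2, hw φ j, mul_neg]

/-- The function underlying an element of `H¹(Ω)`. -/
def fn {Ω : Opens (EuclideanSpace ℝ (Fin n))} (u : H1 Ω) : Lp ℂ 2 (vol Ω) :=
  (u : L2Pair Ω).fst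

/-- The weak gradient of an element of `H¹(Ω)`. -/
def grad {Ω : Opens (EuclideanSpace ℝ (Fin n))} (u : H1 Ω) :
    Lp (EuclideanSpace ℂ (Fin n)) 2 (vol Ω) :=
  (u : L2Pair Ω).snd

theorem isWeakGradient_test {Ω : Opens (EuclideanSpace ℝ (Fin n))} (φ : 𝓓(Ω, ℂ)) :
    IsWeakGradient Ω ((memLp_test φ).toLp φ) ((memLp_gradient φ).toLp (gradient φ)) := by
  intro ψ j
  have hdφ : Differentiable ℝ φ := φ.contDiff.differentiable (by simp)
  have hdψ : Differentiable ℝ ψ := ψ.contDiff.differentiable (by simp)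
  have e1 : ∫ x in Ω, ((memLp_test φ).toLp φ) x * partialDeriv j ψ x
      = ∫ x, φ x * partialDeriv j ψ x := by
    rw [← setIntegral_eq_integral_of_forall_compl_eq_zero (s := (Ω : Set _))
      (f := fun x => φ x * partialDeriv j ψ x)]
    · refine integral_congr_ae ?_
      filter_upwards [(memLp_test φ).coeFn_toLp] with x hx
      rw [hx]
    · intro x hx
      rw [image_eq_zero_of_notMem_tsupport fun h => hx (φ.tsupport_subset h), zero_mul]
  have e2 : ∫ x in Ω, ((memLp_gradient φ).toLp (gradient φ)) x j * ψ x
      = ∫ x, partialDeriv j φ x * ψ x := by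
    rw [← setIntegral_eq_integral_of_forall_compl_eq_zero (s := (Ω : Set _))
      (f := fun x => partialDeriv j φ x * ψ x)]
    · refine integral_congr_ae ?_
      filter_upwards [(memLp_gradient φ).coeFn_toLp] with x hx
      rw [hx]
      rfl
    · intro x hx
      rw [image_eq_zero_of_notMem_tsupport fun h => hx (ψ.tsupport_subset h), mul_zero]
  rw [e1, e2]
  refine integral_mul_fderiv_eq_neg_fderiv_mul_of_integrable
    (v := EuclideanSpace.single j (1 : ℝ)) ?_ ?_ ?_ (fun x _ => hdφ x) (fun x _ => hdψ x)
  · exact ((continuous_partialDeriv φ j).mul ψ.continuous).integrable_of_hasCompactSupport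
      ψ.hasCompactSupport.mul_left
  · exact (φ.continuous.mul (continuous_partialDeriv ψ j)).integrable_of_hasCompactSupport
      φ.hasCompactSupport.mul_right
  · exact (φ.continuous.mul ψ.continuous).integrable_of_hasCompactSupport
      φ.hasCompactSupport.mul_right

theorem gradient_add_test {Ω : Opens (EuclideanSpace ℝ (Fin n))} (φ ψ : 𝓓(Ω, ℂ)) :
    gradient (φ + ψ : 𝓓(Ω, ℂ)) = gradient φ + gradient ψ := by
  ext x j
  have hφ : DifferentiableAt ℝ φ x := φ.contDiff.differentiable (by simp) x
  have hψ : DifferentiableAt ℝ ψ x := ψ.contDiff.differentiable (by simp) x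
  simp [gradient, partialDeriv, fderiv_add hφ hψ]

theorem gradient_smul_test {Ω : Opens (EuclideanSpace ℝ (Fin n))} (c : ℂ) (φ : 𝓓(Ω, ℂ)) :
    gradient (c • φ : 𝓓(Ω, ℂ)) = c • gradient φ := by
  ext x j
  have hφ : DifferentiableAt ℝ φ x := φ.contDiff.differentiable (by simp) x
  simp [gradient, partialDeriv, fderiv_const_smul hφ c]

/-- The inclusion `C₀^∞(Ω) → H¹(Ω)`, `φ ↦ (φ, ∇φ)`. -/
def ofTest (Ω : Opens (EuclideanSpace ℝ (Fin n))) : 𝓓(Ω, ℂ) →ₗ[ℂ] H1 Ω where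
  toFun φ := ⟨WithLp.toLp 2 ((memLp_test φ).toLp φ, (memLp_gradient φ).toLp (gradient φ)),
    isWeakGradient_test φ⟩
  map_add' φ ψ := by
    refine Subtype.ext ?_
    change WithLp.toLp 2 (_, _) = WithLp.toLp 2 (_, _) + WithLp.toLp 2 (_, _)
    rw [← WithLp.toLp_add, Prod.mk_add_mk, ← MemLp.toLp_add, ← MemLp.toLp_add]
    congr 3
    exact gradient_add_test φ ψ
  map_smul' c φ := by
    refine Subtype.ext ?_
    change WithLp.toLp 2 (_, _) = c • WithLp.toLp 2 (_, _)
    rw [← WithLp.toLp_smul, Prod.smul_mk, ← MemLp.toLp_const_smul, ← MemLp.toLp_const_smul]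
    congr 3
    exact gradient_smul_test c φ

/-- `H¹₀(Ω)`, the closure of `C₀^∞(Ω)` in `H¹(Ω)`. -/
def H10 (Ω : Opens (EuclideanSpace ℝ (Fin n))) : Submodule ℂ (H1 Ω) :=
  (LinearMap.range (ofTest Ω)).topologicalClosure

/-- The trace space `H^{1/2}(∂Ω) = H¹(Ω) / H¹₀(Ω)`, with the quotient topology. -/
abbrev TraceSpace (Ω : Opens (EuclideanSpace ℝ (Fin n))) : Type := H1 Ω ⧸ H10 Ω

/-- The trace `u ↦ u|_{∂Ω}` from `H¹(Ω)` onto `H^{1/2}(∂Ω)`. -/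
def trace (Ω : Opens (EuclideanSpace ℝ (Fin n))) : H1 Ω →ₗ[ℂ] TraceSpace Ω := (H10 Ω).mkQ

/-- `H^{-1/2}(∂Ω)`, the dual of `H^{1/2}(∂Ω)` (bilinear pairing). -/
abbrev DualTraceSpace (Ω : Opens (EuclideanSpace ℝ (Fin n))) : Type := TraceSpace Ω →L[ℂ] ℂ

/-! ### The magnetic Schrödinger operator and its Cauchy data -/

/-- The form
`∫_Ω (∇u · ∇g + i A · (u ∇g - g ∇u) + (A² + q) u g) dx`.
For `g = φ ∈ C₀^∞(Ω)` it is the distributional pairing `⟨L_{A,q} u, φ⟩`, where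
`L_{A,q} = ∑ (D_j + A_j)² + q` and `D = i⁻¹ ∇`. -/
def magneticForm (Ω : Opens (EuclideanSpace ℝ (Fin n)))
    (A : EuclideanSpace ℝ (Fin n) → EuclideanSpace ℂ (Fin n)) (q : EuclideanSpace ℝ (Fin n) → ℂ)
    (u g : H1 Ω) : ℂ :=
  ∫ x in Ω, (dot (grad u x) (grad g x)
    + Complex.I * dot (A x) (fn u x • grad g x - fn g x • grad u x)
    + (dot (A x) (A x) + q x) * fn u x * fn g x)

/-- `L_{A,q} u = 0` in `Ω` in the sense of distributions. -/
def IsSolution (Ω : Opens (EuclideanSpace ℝ (Fin n)))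
    (A : EuclideanSpace ℝ (Fin n) → EuclideanSpace ℂ (Fin n)) (q : EuclideanSpace ℝ (Fin n) → ℂ)
    (u : H1 Ω) : Prop :=
  ∀ φ : 𝓓(Ω, ℂ), magneticForm Ω A q u (ofTest Ω φ) = 0

/-- `ℓ ∈ H^{-1/2}(∂Ω)` is the trace of `∂_ν u + i (A · ν) u` on `∂Ω`, i.e. its pairing with the
boundary values of any `g ∈ H¹(Ω)` is given by `magneticForm`. -/
def IsNormalTrace (Ω : Opens (EuclideanSpace ℝ (Fin n)))
    (A : EuclideanSpace ℝ (Fin n) → EuclideanSpace ℂ (Fin n)) (q : EuclideanSpace ℝ (Fin n) → ℂ)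
    (u : H1 Ω) (ℓ : DualTraceSpace Ω) : Prop :=
  ∀ g : H1 Ω, ℓ (trace Ω g) = magneticForm Ω A q u g

/-- The set `C_{A,q}` of Cauchy data `(u|_{∂Ω}, (∂_ν u + i (A · ν) u)|_{∂Ω})` of the solutions
`u ∈ H¹(Ω)` of `L_{A,q} u = 0` in `Ω`. -/
def cauchyData (Ω : Opens (EuclideanSpace ℝ (Fin n)))
    (A : EuclideanSpace ℝ (Fin n) → EuclideanSpace ℂ (Fin n)) (q : EuclideanSpace ℝ (Fin n) → ℂ) :
    Set (TraceSpace Ω × DualTraceSpace Ω) :=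
  {p | ∃ u : H1 Ω, IsSolution Ω A q u ∧ p.1 = trace Ω u ∧ IsNormalTrace Ω A q u p.2}

end MagneticSchrodinger

end

/-!
Place a pole `y = x₀ - ε ν` outside `Ω`, at distance `ε` from `x₀` along the normal, and take the
harmonic functions `U = |x - y|^{2 - n}` and `V = ⟪x - y, τ⟫ |x - y|^{-n}`. By Hardy's inequality
the first order terms of `B_{A₁,q₁}(U, ·)` and `B_{-A₂,q₂}(V, ·)` are functionals on `H¹₀(Ω)` whose
norms are controlled by weights that are one order less singular than `∇U` and `∇V`. The forms are
coercive on `H¹₀(Ω)` up to finitely many functionals, so `U` and `V` can be corrected to solutions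
`u` and `v` by an `H¹₀(Ω)` term of comparable norm and an element of a fixed finite dimensional
space of bounded functions; this takes the place of the well-posedness of the Dirichlet problem.

Equality of the Cauchy data gives `B_{A₁,q₁}(u, v) = B_{A₂,q₂}(u, v)`, so that
`∫ (A₁ - A₂) · (U ∇V - V ∇U)` is bounded by the product of the weighted norms of `U` and `V`.
Multiplied by `ε^{n - 2}`, this bound tends to zero with `ε`, whereas the integral tends to
`τ · (A₁ - A₂)(x₀)` times a positive integral over a half space.
-/

namespace MagneticSchrodinger

open scoped InnerProductSpace

variable {n : ℕ} {Ω : Opens (EuclideanSpace ℝ (Fin n))}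

/-! ### Equations that are coercive up to finitely many functionals -/

section Coercive

variable {𝕜 H X V : Type*} [RCLike 𝕜] [NormedAddCommGroup H] [InnerProductSpace 𝕜 H]
  [NormedAddCommGroup X] [NormedSpace 𝕜 X] [NormedAddCommGroup V] [NormedSpace 𝕜 V]

theorem norm_le_of_coercive {c : ℝ} (hc : 0 < c) {w v : H}
    (h : c * ‖w‖ ^ 2 ≤ RCLike.re ⟪w, v⟫_𝕜) : ‖w‖ ≤ c⁻¹ * ‖v‖ := by
  have hle : RCLike.re ⟪w, v⟫_𝕜 ≤ ‖w‖ * ‖v‖ := (RCLike.re_le_norm _).trans (norm_inner_le_norm _ _)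
  rw [le_inv_mul_iff₀ hc]
  rcases (norm_nonneg w).eq_or_lt with h0 | h0
  · simp [← h0]
  · nlinarith

theorem isClosed_map_of_coercive [CompleteSpace H] (S : H →L[𝕜] H) {W : Submodule 𝕜 H}
    (hW : IsClosed (W : Set H)) {c : ℝ} (hc : 0 < c)
    (hco : ∀ w ∈ W, c * ‖w‖ ^ 2 ≤ RCLike.re ⟪w, S w⟫_𝕜) :
    IsClosed (W.map S.toLinearMap : Set H) := by
  have : CompleteSpace W := hW.completeSpace_coe
  have hanti : AntilipschitzWith (Real.toNNReal c⁻¹) (S.comp W.subtypeL) :=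
    AddMonoidHomClass.antilipschitz_of_bound _ fun w => by
      rw [Real.coe_toNNReal _ (by positivity)]
      exact norm_le_of_coercive hc (hco w w.2)
  convert hanti.isClosed_range (S.comp W.subtypeL).uniformContinuous using 1
  ext x
  simp

theorem map_orthogonal_sup_eq_top_of_coercive [CompleteSpace H] (S : H →L[𝕜] H)
    (F : Submodule 𝕜 H) [FiniteDimensional 𝕜 F] {c : ℝ} (hc : 0 < c)
    (hco : ∀ w ∈ Fᗮ, c * ‖w‖ ^ 2 ≤ RCLike.re ⟪w, S w⟫_𝕜) :
    Fᗮ.map S.toLinearMap ⊔ F = ⊤ := by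
  have hcl : IsClosed ((Fᗮ.map S.toLinearMap ⊔ F : Submodule 𝕜 H) : Set H) :=
    Submodule.isClosed_sup_finiteDimensional _ _
      (isClosed_map_of_coercive S F.isClosed_orthogonal hc hco)
  rw [← hcl.submodule_topologicalClosure_eq, Submodule.topologicalClosure_eq_top_iff,
    ← Submodule.inf_orthogonal, Submodule.eq_bot_iff]
  rintro h ⟨hS, hF⟩
  have h0 : ⟪h, S h⟫_𝕜 = 0 :=
    Submodule.inner_left_of_mem_orthogonal (Submodule.mem_map_of_mem hF) hS
  simpa using norm_le_of_coercive hc ((hco h hF).trans_eq (by rw [h0, inner_zero_right]) :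
    c * ‖h‖ ^ 2 ≤ RCLike.re ⟪h, (0 : H)⟫_𝕜)

theorem exists_finiteDimensional_map_le_sup {K X V : Type*} [Field K] [AddCommGroup X] [Module K X]
    [AddCommGroup V] [Module K V] (T : X →ₗ[K] V) {M : Submodule K V} (hM : M.CoFG)
    (Y : Submodule K X) :
    ∃ E ≤ Y, FiniteDimensional K E ∧ Y.map T ≤ M ⊔ E.map T := by
  let f : Y →ₗ[K] V ⧸ M := M.mkQ ∘ₗ T ∘ₗ Y.subtype
  have : FiniteDimensional K (V ⧸ M) := hM
  obtain ⟨g, hg⟩ := f.rangeRestrict.exists_rightInverse_of_surjective f.range_rangeRestrict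
  refine ⟨(LinearMap.range g).map Y.subtype, Submodule.map_subtype_le _ _, inferInstance, ?_⟩
  rintro _ ⟨u, hu, rfl⟩
  let e : Y := g (f.rangeRestrict ⟨u, hu⟩)
  have hfe : f e = f ⟨u, hu⟩ :=
    congrArg Subtype.val (LinearMap.congr_fun hg (f.rangeRestrict ⟨u, hu⟩))
  have hsub : T u - T e ∈ M := (Submodule.Quotient.eq M).1 hfe.symm
  rw [← sub_add_cancel (T u) (T e)]
  exact Submodule.add_mem_sup hsub ⟨e, ⟨e, ⟨_, rfl⟩, rfl⟩, rfl⟩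

theorem exists_norm_le_of_mem_map_sup [CompleteSpace V] [CompleteSpace H] (S : H →L[𝕜] V)
    (T : X →L[𝕜] V) {W : Submodule 𝕜 H} (hW : IsClosed (W : Set H))
    (hSW : IsClosed (W.map S.toLinearMap : Set V)) (E : Submodule 𝕜 X) [FiniteDimensional 𝕜 E] :
    ∃ C : ℝ, 0 ≤ C ∧ ∀ r ∈ W.map S.toLinearMap ⊔ E.map T.toLinearMap,
      ∃ w : H, ∃ e ∈ E, S w + T e = r ∧ ‖w‖ ≤ C * ‖r‖ ∧ ‖e‖ ≤ C * ‖r‖ := by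
  set R : Submodule 𝕜 V := W.map S.toLinearMap ⊔ E.map T.toLinearMap
  have hR : IsClosed (R : Set V) := Submodule.isClosed_sup_finiteDimensional _ _ hSW
  have : CompleteSpace R := hR.completeSpace_coe
  have : CompleteSpace W := hW.completeSpace_coe
  have : CompleteSpace E := FiniteDimensional.complete 𝕜 E
  let G : (W × E) →L[𝕜] R := ((S.comp W.subtypeL).coprod (T.comp E.subtypeL)).codRestrict R
    fun p => Submodule.add_mem_sup ⟨p.1, p.1.2, rfl⟩ ⟨p.2, p.2.2, rfl⟩
  have hG : Function.Surjective G := by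
    rintro ⟨r, hr⟩
    obtain ⟨_, ⟨w, hw, rfl⟩, _, ⟨e, he, rfl⟩, rfl⟩ := Submodule.mem_sup.1 hr
    exact ⟨(⟨w, hw⟩, ⟨e, he⟩), rfl⟩
  obtain ⟨C, hC, h⟩ := G.exists_preimage_norm_le hG
  refine ⟨C, hC.le, fun r hr => ?_⟩
  obtain ⟨p, hp, hpr⟩ := h ⟨r, hr⟩
  exact ⟨p.1, p.2, p.2.2, congrArg Subtype.val hp, (norm_fst_le p).trans hpr,
    (norm_snd_le p).trans hpr⟩

theorem exists_finiteDimensional_coercive_on_orthogonal [CompleteSpace H] (S : H →L[𝕜] H)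
    (s : Finset (StrongDual 𝕜 H)) {c : ℝ}
    (hco : ∀ w, (∀ L ∈ s, L w = 0) → c * ‖w‖ ^ 2 ≤ RCLike.re ⟪w, S w⟫_𝕜) :
    ∃ F : Submodule 𝕜 H, FiniteDimensional 𝕜 F ∧
      ∀ w ∈ Fᗮ, c * ‖w‖ ^ 2 ≤ RCLike.re ⟪w, S w⟫_𝕜 := by
  classical
  let r : StrongDual 𝕜 H → H := (InnerProductSpace.toDual 𝕜 H).symm
  refine ⟨Submodule.span 𝕜 (s.image r : Finset H), inferInstance, fun w hw => hco w fun L hL => ?_⟩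
  rw [← InnerProductSpace.toDual_symm_apply]
  exact (Submodule.mem_orthogonal _ _).1 hw (r L)
    (Submodule.subset_span (Finset.mem_coe.2 (Finset.mem_image_of_mem r hL)))

/-- Fredholm alternative without uniqueness: the finite-dimensional cokernel of `T ∘ j` is filled
by corrections taken from the prescribed subspace `Y`. -/
theorem exists_finiteDimensional_solve [CompleteSpace H] (j : H →L[𝕜] X) (T : X →L[𝕜] H)
    (s : Finset (StrongDual 𝕜 H)) {c : ℝ} (hc : 0 < c)
    (hco : ∀ w, (∀ L ∈ s, L w = 0) → c * ‖w‖ ^ 2 ≤ RCLike.re ⟪w, T (j w)⟫_𝕜)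
    (Y : Submodule 𝕜 X) :
    ∃ E ≤ Y, FiniteDimensional 𝕜 E ∧ ∃ C : ℝ, 0 ≤ C ∧ ∀ u ∈ Y, ∃ w : H, ∃ e ∈ E,
      T (j w) + T e = T u ∧ ‖w‖ ≤ C * ‖T u‖ ∧ ‖e‖ ≤ C * ‖T u‖ := by
  obtain ⟨F, hF, hcoF⟩ := exists_finiteDimensional_coercive_on_orthogonal (T.comp j) s hco
  have hcofg : (Fᗮ.map (T.comp j).toLinearMap).CoFG :=
    Submodule.FG.cofg_of_codisjoint
      (codisjoint_iff.2 (sup_comm F _ ▸ map_orthogonal_sup_eq_top_of_coercive _ F hc hcoF))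
      (Module.Finite.iff_fg.1 hF)
  obtain ⟨E, hEY, hE, hYE⟩ := exists_finiteDimensional_map_le_sup T.toLinearMap hcofg Y
  obtain ⟨C, hC, h⟩ := exists_norm_le_of_mem_map_sup (T.comp j) T F.isClosed_orthogonal
    (isClosed_map_of_coercive _ F.isClosed_orthogonal hc hcoF) E
  exact ⟨E, hEY, hE, C, hC, fun u hu => h _ (hYE (Submodule.mem_map_of_mem hu))⟩

end Coercive

/-! ### The Sobolev space `H¹(Ω)` -/

section Lp

variable {α F G : Type*} [MeasurableSpace α] {μ : Measure α} [NormedAddCommGroup F]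
  [NormedAddCommGroup G]

theorem sq_norm_Lp_two (f : Lp F 2 μ) : ‖f‖ ^ 2 = ∫ x, ‖f x‖ ^ 2 ∂μ := by
  have h := (Lp.memLp f).eLpNorm_eq_integral_rpow_norm (by norm_num) (by norm_num)
  have h0 : 0 ≤ ∫ x, ‖f x‖ ^ 2 ∂μ := integral_nonneg fun _ => by positivity
  rw [Lp.norm_def, h, ENNReal.toReal_ofReal (by positivity)]
  simp only [ENNReal.toReal_ofNat, Real.rpow_ofNat]
  rw [← Real.rpow_natCast, ← Real.rpow_mul h0]
  norm_num

theorem integral_norm_mul_norm_le {f : α → F} {g : α → G} {a b : ℝ} (hf : MemLp f 2 μ)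
    (hg : MemLp g 2 μ) (ha : 0 ≤ a) (hb : 0 ≤ b) (hfa : ∫ x, ‖f x‖ ^ 2 ∂μ ≤ a ^ 2)
    (hgb : ∫ x, ‖g x‖ ^ 2 ∂μ ≤ b ^ 2) : ∫ x, ‖f x‖ * ‖g x‖ ∂μ ≤ a * b := by
  have h := integral_mul_norm_le_Lp_mul_Lq (μ := μ) (f := fun x => ‖f x‖) (g := fun x => ‖g x‖)
    (Real.HolderConjugate.two_two) (by simpa using hf.norm) (by simpa using hg.norm)
  simp only [Real.rpow_ofNat, norm_norm] at h
  refine h.trans ?_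
  rw [← Real.sqrt_eq_rpow, ← Real.sqrt_eq_rpow]
  gcongr
  · exact Real.sqrt_le_iff.2 ⟨ha, hfa⟩
  · exact Real.sqrt_le_iff.2 ⟨hb, hgb⟩

theorem exists_ae_norm_le {f : α → F} (hf : MemLp f ⊤ μ) : ∃ K : ℝ, 0 ≤ K ∧ ∀ᵐ x ∂μ, ‖f x‖ ≤ K := by
  refine ⟨(eLpNorm f ⊤ μ).toReal, ENNReal.toReal_nonneg, ?_⟩
  filter_upwards [ae_le_eLpNormEssSup (f := f) (μ := μ)] with x hx
  rw [← eLpNorm_exponent_top] at hx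
  simpa using ENNReal.toReal_mono hf.2.ne hx

end Lp

/-- The bilinear product `dot` on `ℂⁿ` as a continuous bilinear map. -/
noncomputable def dotL (n : ℕ) :
    EuclideanSpace ℂ (Fin n) →L[ℂ] EuclideanSpace ℂ (Fin n) →L[ℂ] ℂ :=
  (LinearMap.mk₂ ℂ dot (fun _ _ _ => by simp [dot, add_mul, Finset.sum_add_distrib])
    (fun _ _ _ => by simp [dot, mul_assoc, Finset.mul_sum])
    (fun _ _ _ => by simp [dot, mul_add, Finset.sum_add_distrib])
    (fun _ _ _ => by simp [dot, mul_left_comm, Finset.mul_sum])).toContinuousBilinearMap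

theorem dotL_apply (a b : EuclideanSpace ℂ (Fin n)) : dotL n a b = dot a b := rfl

theorem dot_comm (a b : EuclideanSpace ℂ (Fin n)) : dot a b = dot b a :=
  Finset.sum_congr rfl fun _ _ => mul_comm _ _

theorem norm_dot_le (a b : EuclideanSpace ℂ (Fin n)) : ‖dot a b‖ ≤ ‖a‖ * ‖b‖ := by
  rw [EuclideanSpace.norm_eq, EuclideanSpace.norm_eq]
  refine (norm_sum_le _ _).trans ?_
  simp only [norm_mul]
  exact Real.sum_mul_le_sqrt_mul_sqrt _ _ _

theorem aestronglyMeasurable_dot {α : Type*} [MeasurableSpace α] {μ : Measure α}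
    {f g : α → EuclideanSpace ℂ (Fin n)} (hf : AEStronglyMeasurable f μ)
    (hg : AEStronglyMeasurable g μ) : AEStronglyMeasurable (fun x => dot (f x) (g x)) μ :=
  (dotL n).aestronglyMeasurable_comp₂ hf hg

theorem memLp_fn (u : H1 Ω) : MemLp (fn u) 2 (vol Ω) := Lp.memLp _

theorem memLp_grad (u : H1 Ω) : MemLp (grad u) 2 (vol Ω) := Lp.memLp _

theorem fn_ofTest (φ : 𝓓(Ω, ℂ)) : fn (ofTest Ω φ) =ᵐ[vol Ω] φ := (memLp_test φ).coeFn_toLp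

theorem grad_ofTest (φ : 𝓓(Ω, ℂ)) : grad (ofTest Ω φ) =ᵐ[vol Ω] gradient φ :=
  (memLp_gradient φ).coeFn_toLp

theorem integral_sq_fn (u : H1 Ω) : ∫ x in Ω, ‖fn u x‖ ^ 2 = ‖fn u‖ ^ 2 :=
  (sq_norm_Lp_two (fn u)).symm

theorem integral_sq_grad (u : H1 Ω) : ∫ x in Ω, ‖grad u x‖ ^ 2 = ‖grad u‖ ^ 2 :=
  (sq_norm_Lp_two (grad u)).symm

theorem norm_sq_eq (u : H1 Ω) : ‖u‖ ^ 2 = ‖fn u‖ ^ 2 + ‖grad u‖ ^ 2 :=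
  WithLp.prod_norm_sq_eq_of_L2 (u : L2Pair Ω)

theorem norm_fn_le (u : H1 Ω) : ‖fn u‖ ≤ ‖u‖ :=
  WithLp.norm_fst_le _ (u : L2Pair Ω)

theorem norm_grad_le (u : H1 Ω) : ‖grad u‖ ≤ ‖u‖ :=
  WithLp.norm_snd_le _ (u : L2Pair Ω)

/-- The map `u ↦ u` from `H¹(Ω)` to `L²(Ω)` as a continuous linear map. -/
noncomputable def fnL (Ω : Opens (EuclideanSpace ℝ (Fin n))) : H1 Ω →L[ℂ] Lp ℂ 2 (vol Ω) :=
  WithLp.fstL 2 ℂ _ _ ∘L (H1 Ω).subtypeL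

/-- The weak gradient as a continuous linear map. -/
noncomputable def gradL (Ω : Opens (EuclideanSpace ℝ (Fin n))) :
    H1 Ω →L[ℂ] Lp (EuclideanSpace ℂ (Fin n)) 2 (vol Ω) :=
  WithLp.sndL 2 ℂ _ _ ∘L (H1 Ω).subtypeL

theorem fnL_apply (u : H1 Ω) : fnL Ω u = fn u := rfl

theorem gradL_apply (u : H1 Ω) : gradL Ω u = grad u := rfl

theorem continuous_integral_mul {α : Type*} [MeasurableSpace α] {μ : Measure α} {ψ : α → ℂ}
    (hψ : MemLp ψ 2 μ) : Continuous fun f : Lp ℂ 2 μ => ∫ x, f x * ψ x ∂μ := by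
  have h : ∀ f : Lp ℂ 2 μ,
      (ContinuousLinearMap.mul ℂ ℂ).lpPairing μ 2 2 f (hψ.toLp ψ) = ∫ x, f x * ψ x ∂μ := fun f => by
    rw [ContinuousLinearMap.lpPairing_eq_integral]
    refine integral_congr_ae ?_
    filter_upwards [hψ.coeFn_toLp] with x hx
    rw [hx, ContinuousLinearMap.mul_apply']
  simp only [← h]
  fun_prop

theorem isClosed_H1 : IsClosed (H1 Ω : Set (L2Pair Ω)) := by
  have hcoord : ∀ (G : Lp (EuclideanSpace ℂ (Fin n)) 2 (vol Ω)) (φ : 𝓓(Ω, ℂ)) (j : Fin n),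
      ∫ x in Ω, (EuclideanSpace.proj j : EuclideanSpace ℂ (Fin n) →L[ℂ] ℂ).compLpL 2 (vol Ω) G x
        * φ x = ∫ x in Ω, G x j * φ x := fun G φ j => by
    refine integral_congr_ae ?_
    filter_upwards [(EuclideanSpace.proj j :
      EuclideanSpace ℂ (Fin n) →L[ℂ] ℂ).coeFn_compLpL (p := 2) G] with x hx
    rw [hx]
    rfl
  have heq : (H1 Ω : Set (L2Pair Ω)) = ⋂ (φ : 𝓓(Ω, ℂ)) (j : Fin n),
      {w : L2Pair Ω | ∫ x in Ω, w.fst x * partialDeriv j φ x = - ∫ x in Ω, w.snd x j * φ x} := by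
    ext w
    simp only [Set.mem_iInter, Set.mem_ofPred_eq]
    rfl
  simp only [heq, ← hcoord]
  refine isClosed_iInter fun φ => isClosed_iInter fun j => isClosed_eq ?_ ?_
  · exact (continuous_integral_mul (memLp_partialDeriv φ j)).comp (WithLp.fstL 2 ℂ _ _).continuous
  · exact ((continuous_integral_mul (memLp_test φ)).comp
      ((ContinuousLinearMap.continuous _).comp (WithLp.sndL 2 ℂ _ _).continuous)).neg

instance completeSpace_H1 : CompleteSpace (H1 Ω) := isClosed_H1.completeSpace_coe

instance completeSpace_H10 : CompleteSpace (H10 Ω) :=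
  (Submodule.isClosed_topologicalClosure _).completeSpace_coe

theorem ofTest_mem_H10 (φ : 𝓓(Ω, ℂ)) : ofTest Ω φ ∈ H10 Ω :=
  Submodule.le_topologicalClosure _ ⟨φ, rfl⟩

theorem H10_induction {P : H1 Ω → Prop} (hP : IsClosed {u | P u})
    (h : ∀ φ, P (ofTest Ω φ)) {u : H1 Ω} (hu : u ∈ H10 Ω) : P u :=
  have hsub : (LinearMap.range (ofTest Ω) : Set (H1 Ω)) ⊆ {u | P u} := by
    rintro _ ⟨φ, rfl⟩
    exact h φ
  closure_minimal hsub hP hu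

/-! ### The magnetic form -/

/-- The bilinear pairing `∫_Ω (u v + G · H) dx` of the pairs `(u, G)` and `(v, H)`. -/
noncomputable def pairing (Ω : Opens (EuclideanSpace ℝ (Fin n))) :
    L2Pair Ω →L[ℂ] L2Pair Ω →L[ℂ] ℂ :=
  ((ContinuousLinearMap.mul ℂ ℂ).lpPairing (vol Ω) 2 2).bilinearComp
      (WithLp.fstL 2 ℂ _ _) (WithLp.fstL 2 ℂ _ _)
    + ((dotL n).lpPairing (vol Ω) 2 2).bilinearComp (WithLp.sndL 2 ℂ _ _) (WithLp.sndL 2 ℂ _ _)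

theorem integrable_dot {α : Type*} [MeasurableSpace α] {μ : Measure α}
    {f g : α → EuclideanSpace ℂ (Fin n)} (hf : MemLp f 2 μ) (hg : MemLp g 2 μ) :
    Integrable (fun x => dot (f x) (g x)) μ :=
  (hf.norm.integrable_mul hg.norm).mono' (aestronglyMeasurable_dot hf.1 hg.1)
    (ae_of_all _ fun _ => norm_dot_le _ _)

theorem pairing_apply (p w : L2Pair Ω) :
    pairing Ω p w = ∫ x in Ω, (p.fst x * w.fst x + dot (p.snd x) (w.snd x)) := by
  have h1 : Integrable (fun x => p.fst x * w.fst x) (vol Ω) :=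
    (Lp.memLp p.fst).integrable_mul (Lp.memLp w.fst)
  rw [integral_add h1 (integrable_dot (Lp.memLp p.snd) (Lp.memLp w.snd))]
  exact congrArg₂ (fun a b : ℂ => a + b) (ContinuousLinearMap.lpPairing_eq_integral _ _ _)
    (ContinuousLinearMap.lpPairing_eq_integral _ _ _)

section Flux

variable {A : EuclideanSpace ℝ (Fin n) → EuclideanSpace ℂ (Fin n)}
  {Q : EuclideanSpace ℝ (Fin n) → ℂ}

/-- The operator `u ↦ (Q u - i A · ∇u, i u A)`. Its divergence form `Q u - i A · ∇u - ∇ · (i u A)`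
is the part of order at most one of the magnetic operator when `Q = A² + q`. -/
noncomputable def lowerFlux (hA : MemLp A ⊤ (vol Ω)) (hQ : MemLp Q ⊤ (vol Ω)) :
    H1 Ω →L[ℂ] L2Pair Ω :=
  (WithLp.prodContinuousLinearEquiv 2 ℂ _ _).symm.toContinuousLinearMap ∘L
    ((((ContinuousLinearMap.mul ℂ ℂ).holderL (vol Ω) ⊤ 2 2 (hQ.toLp Q)) ∘L fnL Ω
        - Complex.I • ((dotL n).holderL (vol Ω) ⊤ 2 2 (hA.toLp A)) ∘L gradL Ω).prod
      (Complex.I • ((ContinuousLinearMap.lsmul ℂ ℂ).flip.holderL (vol Ω) ⊤ 2 2 (hA.toLp A))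
        ∘L fnL Ω))

/-- The operator `u ↦ (0, ∇u)`. -/
noncomputable def gradFlux (Ω : Opens (EuclideanSpace ℝ (Fin n))) : H1 Ω →L[ℂ] L2Pair Ω :=
  (WithLp.prodContinuousLinearEquiv 2 ℂ _ _).symm.toContinuousLinearMap ∘L
    ((0 : H1 Ω →L[ℂ] Lp ℂ 2 (vol Ω)).prod (gradL Ω))

theorem lowerFlux_fst (hA : MemLp A ⊤ (vol Ω)) (hQ : MemLp Q ⊤ (vol Ω)) (u : H1 Ω) :
    (lowerFlux hA hQ u).fst =ᵐ[vol Ω] fun x => Q x * fn u x - Complex.I * dot (A x) (grad u x) := by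
  have h : (lowerFlux hA hQ u).fst = (ContinuousLinearMap.mul ℂ ℂ).holder 2 (hQ.toLp Q) (fn u)
      - Complex.I • (dotL n).holder 2 (hA.toLp A) (grad u) := rfl
  rw [h]
  filter_upwards [Lp.coeFn_sub ((ContinuousLinearMap.mul ℂ ℂ).holder 2 (hQ.toLp Q) (fn u))
      (Complex.I • (dotL n).holder 2 (hA.toLp A) (grad u)),
    Lp.coeFn_smul Complex.I ((dotL n).holder 2 (hA.toLp A) (grad u)),
    (ContinuousLinearMap.mul ℂ ℂ).coeFn_holder (r := 2) (hQ.toLp Q) (fn u),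
    (dotL n).coeFn_holder (r := 2) (hA.toLp A) (grad u), hA.coeFn_toLp, hQ.coeFn_toLp]
    with x h1 h2 h3 h4 h5 h6
  simp only [h1, h2, h3, h4, h5, h6, Pi.sub_apply, Pi.smul_apply, dotL_apply, smul_eq_mul,
    ContinuousLinearMap.mul_apply']

theorem lowerFlux_snd (hA : MemLp A ⊤ (vol Ω)) (hQ : MemLp Q ⊤ (vol Ω)) (u : H1 Ω) :
    (lowerFlux hA hQ u).snd =ᵐ[vol Ω] fun x => Complex.I • fn u x • A x := by
  have h : (lowerFlux hA hQ u).snd =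
      Complex.I • (ContinuousLinearMap.lsmul ℂ ℂ).flip.holder 2 (hA.toLp A) (fn u) := rfl
  rw [h]
  filter_upwards [Lp.coeFn_smul Complex.I
      ((ContinuousLinearMap.lsmul ℂ ℂ).flip.holder 2 (hA.toLp A) (fn u)),
    (ContinuousLinearMap.lsmul ℂ ℂ).flip.coeFn_holder (r := 2) (hA.toLp A) (fn u), hA.coeFn_toLp]
    with x h1 h2 h3
  simp only [h1, h2, h3, Pi.smul_apply, ContinuousLinearMap.flip_apply,
    ContinuousLinearMap.lsmul_apply]

/-- The Dirichlet form `∫_Ω ∇u · ∇g dx`. -/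
noncomputable def gradForm (u g : H1 Ω) : ℂ := ∫ x in Ω, dot (grad u x) (grad g x)

/-- The integrand of `lowerForm`. -/
noncomputable def lowerIntegrand (A : EuclideanSpace ℝ (Fin n) → EuclideanSpace ℂ (Fin n))
    (Q : EuclideanSpace ℝ (Fin n) → ℂ) (u g : H1 Ω) (x : EuclideanSpace ℝ (Fin n)) : ℂ :=
  Complex.I * dot (A x) (fn u x • grad g x - fn g x • grad u x) + Q x * fn u x * fn g x

/-- The lower order form `∫_Ω (i A · (u ∇g - g ∇u) + Q u g) dx`. -/
noncomputable def lowerForm (A : EuclideanSpace ℝ (Fin n) → EuclideanSpace ℂ (Fin n))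
    (Q : EuclideanSpace ℝ (Fin n) → ℂ) (u g : H1 Ω) : ℂ :=
  ∫ x in Ω, lowerIntegrand A Q u g x

theorem pairing_gradFlux (u g : H1 Ω) : pairing Ω (gradFlux Ω u) g = gradForm u g := by
  rw [pairing_apply]
  refine integral_congr_ae ?_
  filter_upwards [Lp.coeFn_zero ℂ 2 (vol Ω)] with x hx
  have h : (gradFlux Ω u).fst x = 0 := hx
  rw [h, zero_mul, zero_add]
  rfl

theorem lowerFlux_mul_add_dot (hA : MemLp A ⊤ (vol Ω)) (hQ : MemLp Q ⊤ (vol Ω)) (u g : H1 Ω) :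
    (fun x => (lowerFlux hA hQ u).fst x * fn g x + dot ((lowerFlux hA hQ u).snd x) (grad g x))
      =ᵐ[vol Ω] lowerIntegrand A Q u g := by
  filter_upwards [lowerFlux_fst hA hQ u, lowerFlux_snd hA hQ u] with x h1 h2
  simp only [h1, h2, lowerIntegrand, ← dotL_apply, map_sub, map_smul, smul_eq_mul, smul_apply]
  ring

theorem integrable_lowerIntegrand (hA : MemLp A ⊤ (vol Ω)) (hQ : MemLp Q ⊤ (vol Ω)) (u g : H1 Ω) :
    Integrable (lowerIntegrand A Q u g) (vol Ω) :=
  (((Lp.memLp (lowerFlux hA hQ u).fst).integrable_mul (memLp_fn g)).add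
    (integrable_dot (Lp.memLp (lowerFlux hA hQ u).snd) (memLp_grad g))).congr
    (lowerFlux_mul_add_dot hA hQ u g)

theorem pairing_lowerFlux (hA : MemLp A ⊤ (vol Ω)) (hQ : MemLp Q ⊤ (vol Ω)) (u g : H1 Ω) :
    pairing Ω (lowerFlux hA hQ u) g = lowerForm A Q u g := by
  rw [pairing_apply]
  exact integral_congr_ae (lowerFlux_mul_add_dot hA hQ u g)

end Flux

section Majorant

/-- A majorant of the integrands of the lower order forms. -/
noncomputable def lowerMajorant (u g : H1 Ω) (x : EuclideanSpace ℝ (Fin n)) : ℝ :=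
  ‖fn u x‖ * ‖grad g x‖ + ‖fn g x‖ * ‖grad u x‖ + ‖fn u x‖ * ‖fn g x‖

theorem integrable_lowerMajorant (u g : H1 Ω) : Integrable (lowerMajorant u g) (vol Ω) :=
  (((memLp_fn u).norm.integrable_mul (memLp_grad g).norm).add
    ((memLp_fn g).norm.integrable_mul (memLp_grad u).norm)).add
    ((memLp_fn u).norm.integrable_mul (memLp_fn g).norm)

theorem integral_lowerMajorant (u g : H1 Ω) :
    ∫ x in Ω, lowerMajorant u g x = (∫ x in Ω, ‖fn u x‖ * ‖grad g x‖)
      + (∫ x in Ω, ‖fn g x‖ * ‖grad u x‖) + ∫ x in Ω, ‖fn u x‖ * ‖fn g x‖ := by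
  have h1 : Integrable (fun x => ‖fn u x‖ * ‖grad g x‖) (vol Ω) :=
    (memLp_fn u).norm.integrable_mul (memLp_grad g).norm
  have h2 : Integrable (fun x => ‖fn g x‖ * ‖grad u x‖) (vol Ω) :=
    (memLp_fn g).norm.integrable_mul (memLp_grad u).norm
  have h3 : Integrable (fun x => ‖fn u x‖ * ‖fn g x‖) (vol Ω) :=
    (memLp_fn u).norm.integrable_mul (memLp_fn g).norm
  simp only [lowerMajorant]
  rw [← integral_add h1 h2]
  exact integral_add (h1.add h2) h3

theorem integral_lowerMajorant_le (u g : H1 Ω) :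
    ∫ x in Ω, lowerMajorant u g x
      ≤ ‖fn u‖ * ‖grad g‖ + ‖fn g‖ * ‖grad u‖ + ‖fn u‖ * ‖fn g‖ := by
  rw [integral_lowerMajorant]
  gcongr
  · exact integral_norm_mul_norm_le (memLp_fn u) (memLp_grad g) (norm_nonneg _) (norm_nonneg _)
      (integral_sq_fn u).le (integral_sq_grad g).le
  · exact integral_norm_mul_norm_le (memLp_fn g) (memLp_grad u) (norm_nonneg _) (norm_nonneg _)
      (integral_sq_fn g).le (integral_sq_grad u).le
  · exact integral_norm_mul_norm_le (memLp_fn u) (memLp_fn g) (norm_nonneg _) (norm_nonneg _)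
      (integral_sq_fn u).le (integral_sq_fn g).le

variable {A : EuclideanSpace ℝ (Fin n) → EuclideanSpace ℂ (Fin n)}
  {Q : EuclideanSpace ℝ (Fin n) → ℂ}

theorem exists_norm_lowerFlux_le (hA : MemLp A ⊤ (vol Ω)) (hQ : MemLp Q ⊤ (vol Ω)) :
    ∃ K : ℝ, 0 ≤ K ∧ ∀ u : H1 Ω, ∀ᵐ x ∂vol Ω,
      ‖(lowerFlux hA hQ u).fst x‖ ≤ K * (‖fn u x‖ + ‖grad u x‖) ∧
      ‖(lowerFlux hA hQ u).snd x‖ ≤ K * ‖fn u x‖ := by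
  obtain ⟨a, ha, hAa⟩ := exists_ae_norm_le hA
  obtain ⟨b, hb, hQb⟩ := exists_ae_norm_le hQ
  refine ⟨a + b, by positivity, fun u => ?_⟩
  filter_upwards [hAa, hQb, lowerFlux_fst hA hQ u, lowerFlux_snd hA hQ u] with x hxa hxb h1 h2
  rw [h1, h2]
  constructor
  · calc ‖Q x * fn u x - Complex.I * dot (A x) (grad u x)‖
        ≤ ‖Q x‖ * ‖fn u x‖ + ‖A x‖ * ‖grad u x‖ := by
          refine (norm_sub_le _ _).trans ?_
          rw [norm_mul, norm_mul, Complex.norm_I, one_mul]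
          gcongr
          exact norm_dot_le _ _
      _ ≤ b * ‖fn u x‖ + a * ‖grad u x‖ := by gcongr
      _ ≤ (a + b) * (‖fn u x‖ + ‖grad u x‖) := by
          nlinarith [mul_nonneg ha (norm_nonneg (fn u x)), mul_nonneg hb (norm_nonneg (grad u x))]
  · rw [norm_smul, norm_smul, Complex.norm_I, one_mul, mul_comm]
    gcongr
    linarith

theorem norm_inner_le_integral (p w : L2Pair Ω) :
    ‖⟪w, p⟫_ℂ‖ ≤ ∫ x in Ω, (‖p.fst x‖ * ‖w.fst x‖ + ‖p.snd x‖ * ‖w.snd x‖) := by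
  have h1 : Integrable (fun x => ‖p.fst x‖ * ‖w.fst x‖) (vol Ω) :=
    (Lp.memLp p.fst).norm.integrable_mul (Lp.memLp w.fst).norm
  have h2 : Integrable (fun x => ‖p.snd x‖ * ‖w.snd x‖) (vol Ω) :=
    (Lp.memLp p.snd).norm.integrable_mul (Lp.memLp w.snd).norm
  rw [integral_add h1 h2, WithLp.prod_inner_apply, L2.inner_def, L2.inner_def]
  refine (norm_add_le _ _).trans (add_le_add ?_ ?_)
  · exact norm_integral_le_of_norm_le h1 (ae_of_all _ fun x =>
      (norm_inner_le_norm _ _).trans_eq (mul_comm _ _))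
  · exact norm_integral_le_of_norm_le h2 (ae_of_all _ fun x =>
      (norm_inner_le_norm _ _).trans_eq (mul_comm _ _))

theorem norm_pairing_le_integral (p w : L2Pair Ω) :
    ‖pairing Ω p w‖ ≤ ∫ x in Ω, (‖p.fst x‖ * ‖w.fst x‖ + ‖p.snd x‖ * ‖w.snd x‖) := by
  rw [pairing_apply]
  refine norm_integral_le_of_norm_le (((Lp.memLp p.fst).norm.integrable_mul
    (Lp.memLp w.fst).norm).add ((Lp.memLp p.snd).norm.integrable_mul (Lp.memLp w.snd).norm))
    (ae_of_all _ fun x => (norm_add_le _ _).trans ?_)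
  rw [norm_mul]
  exact add_le_add_right (norm_dot_le _ _) _

theorem exists_integral_norm_lowerFlux_mul_le (hA : MemLp A ⊤ (vol Ω)) (hQ : MemLp Q ⊤ (vol Ω)) :
    ∃ K : ℝ, 0 ≤ K ∧ ∀ u g : H1 Ω,
      ∫ x in Ω, (‖(lowerFlux hA hQ u).fst x‖ * ‖fn g x‖
        + ‖(lowerFlux hA hQ u).snd x‖ * ‖grad g x‖) ≤ K * ∫ x in Ω, lowerMajorant u g x := by
  obtain ⟨K, hK, h⟩ := exists_norm_lowerFlux_le hA hQ
  refine ⟨K, hK, fun u g => ?_⟩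
  rw [← integral_const_mul]
  refine integral_mono_of_nonneg (ae_of_all _ fun _ => by positivity)
    ((integrable_lowerMajorant u g).const_mul K) ?_
  filter_upwards [h u] with x hx
  calc _ ≤ K * (‖fn u x‖ + ‖grad u x‖) * ‖fn g x‖ + K * ‖fn u x‖ * ‖grad g x‖ := by
        gcongr
        exacts [hx.1, hx.2]
    _ = K * lowerMajorant u g x := by
        rw [lowerMajorant]
        ring

theorem exists_norm_inner_lowerFlux_le (hA : MemLp A ⊤ (vol Ω)) (hQ : MemLp Q ⊤ (vol Ω)) :
    ∃ K : ℝ, 0 ≤ K ∧ ∀ u g : H1 Ω,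
      ‖⟪(g : L2Pair Ω), lowerFlux hA hQ u⟫_ℂ‖ ≤ K * ∫ x in Ω, lowerMajorant u g x :=
  (exists_integral_norm_lowerFlux_mul_le hA hQ).imp fun _ h =>
    ⟨h.1, fun u g => (norm_inner_le_integral _ _).trans (h.2 u g)⟩

theorem exists_norm_lowerForm_le (hA : MemLp A ⊤ (vol Ω)) (hQ : MemLp Q ⊤ (vol Ω)) :
    ∃ K : ℝ, 0 ≤ K ∧ ∀ u g : H1 Ω, ‖lowerForm A Q u g‖ ≤ K * ∫ x in Ω, lowerMajorant u g x :=
  (exists_integral_norm_lowerFlux_mul_le hA hQ).imp fun _ h => ⟨h.1, fun u g => by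
    rw [← pairing_lowerFlux hA hQ]
    exact (norm_pairing_le_integral _ _).trans (h.2 u g)⟩

end Majorant

section MagneticForm

variable {A : EuclideanSpace ℝ (Fin n) → EuclideanSpace ℂ (Fin n)}
  {q : EuclideanSpace ℝ (Fin n) → ℂ}

theorem memLp_top_dot_add (hA : MemLp A ⊤ (vol Ω)) (hq : MemLp q ⊤ (vol Ω)) :
    MemLp (fun x => dot (A x) (A x) + q x) ⊤ (vol Ω) := by
  obtain ⟨a, ha, hAa⟩ := exists_ae_norm_le hA
  refine MemLp.add (memLp_top_of_bound (aestronglyMeasurable_dot hA.1 hA.1) (a * a) ?_) hq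
  filter_upwards [hAa] with x hx
  exact (norm_dot_le _ _).trans (mul_le_mul hx hx (norm_nonneg _) ha)

/-- The operator `u ↦ ((A² + q) u - i A · ∇u, ∇u + i u A)`, through which `magneticForm` is
expressed by `pairing`. -/
noncomputable def flux (hA : MemLp A ⊤ (vol Ω)) (hq : MemLp q ⊤ (vol Ω)) : H1 Ω →L[ℂ] L2Pair Ω :=
  gradFlux Ω + lowerFlux hA (memLp_top_dot_add hA hq)

theorem magneticForm_eq (hA : MemLp A ⊤ (vol Ω)) (hq : MemLp q ⊤ (vol Ω)) (u g : H1 Ω) :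
    magneticForm Ω A q u g
      = gradForm u g + lowerForm A (fun x => dot (A x) (A x) + q x) u g := by
  rw [gradForm, lowerForm, ← integral_add (integrable_dot (memLp_grad u) (memLp_grad g))
    (integrable_lowerIntegrand hA (memLp_top_dot_add hA hq) u g)]
  simp only [lowerIntegrand, magneticForm, add_assoc]

theorem pairing_flux (hA : MemLp A ⊤ (vol Ω)) (hq : MemLp q ⊤ (vol Ω)) (u g : H1 Ω) :
    pairing Ω (flux hA hq u) g = magneticForm Ω A q u g := by
  rw [magneticForm_eq hA hq, ← pairing_gradFlux,
    ← pairing_lowerFlux hA (memLp_top_dot_add hA hq), flux, add_apply, map_add, add_apply]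

theorem magneticForm_comm (u g : H1 Ω) :
    magneticForm Ω A q u g = magneticForm Ω (-A) q g u := by
  refine integral_congr_ae (ae_of_all _ fun x => ?_)
  simp only [Pi.neg_apply, ← dotL_apply, map_sub, map_neg, neg_apply, neg_neg]
  rw [dotL_apply, dot_comm, ← dotL_apply]
  ring

end MagneticForm

theorem magneticForm_sub_magneticForm
    {A₁ A₂ : EuclideanSpace ℝ (Fin n) → EuclideanSpace ℂ (Fin n)}
    {q₁ q₂ : EuclideanSpace ℝ (Fin n) → ℂ}
    (hA₁ : MemLp A₁ ⊤ (vol Ω)) (hq₁ : MemLp q₁ ⊤ (vol Ω))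
    (hA₂ : MemLp A₂ ⊤ (vol Ω)) (hq₂ : MemLp q₂ ⊤ (vol Ω)) (u v : H1 Ω) :
    magneticForm Ω A₁ q₁ u v - magneticForm Ω A₂ q₂ u v
      = lowerForm (A₁ - A₂) (fun x => (dot (A₁ x) (A₁ x) + q₁ x) - (dot (A₂ x) (A₂ x) + q₂ x))
        u v := by
  rw [magneticForm_eq hA₁ hq₁, magneticForm_eq hA₂ hq₂, add_sub_add_left_eq_sub, lowerForm,
    lowerForm, ← integral_sub (integrable_lowerIntegrand hA₁ (memLp_top_dot_add hA₁ hq₁) u v)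
    (integrable_lowerIntegrand hA₂ (memLp_top_dot_add hA₂ hq₂) u v)]
  refine integral_congr_ae (ae_of_all _ fun x => ?_)
  simp only [lowerIntegrand, Pi.sub_apply, ← dotL_apply, map_sub, sub_apply]
  ring

/-! ### Solutions and their Cauchy data -/

/-- The complex conjugate of a test function; it turns the bilinear `pairing` into the inner
product of `L²(Ω, ℂ) × L²(Ω, ℂⁿ)`. -/
noncomputable def conjTest (φ : 𝓓(Ω, ℂ)) : 𝓓(Ω, ℂ) where
  toFun := fun x => starRingEnd ℂ (φ x)
  contDiff' := Complex.conjCLE.contDiff.comp φ.contDiff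
  hasCompactSupport' := φ.hasCompactSupport.comp_left (map_zero (starRingEnd ℂ))
  tsupport_subset' :=
    (closure_mono (Function.support_comp_subset (map_zero (starRingEnd ℂ)) φ)).trans
      φ.tsupport_subset

theorem conjTest_apply (φ : 𝓓(Ω, ℂ)) (x : EuclideanSpace ℝ (Fin n)) :
    conjTest φ x = starRingEnd ℂ (φ x) := rfl

theorem conjTest_conjTest (φ : 𝓓(Ω, ℂ)) : conjTest (conjTest φ) = φ := by
  ext x
  simp [conjTest_apply]

theorem gradient_conjTest (φ : 𝓓(Ω, ℂ)) (x : EuclideanSpace ℝ (Fin n)) (j : Fin n) :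
    gradient (conjTest φ) x j = starRingEnd ℂ (gradient φ x j) := by
  have hφ : DifferentiableAt ℝ φ x := φ.contDiff.differentiable (by simp) x
  have h : HasFDerivAt (conjTest φ) ((Complex.conjCLE : ℂ →L[ℝ] ℂ).comp (fderiv ℝ φ x)) x :=
    (Complex.conjCLE : ℂ →L[ℝ] ℂ).hasFDerivAt.comp x hφ.hasFDerivAt
  change fderiv ℝ (conjTest φ) x _ = _
  rw [h.fderiv]
  rfl

theorem inner_ofTest_conjTest (φ : 𝓓(Ω, ℂ)) (p : L2Pair Ω) :
    ⟪(ofTest Ω (conjTest φ) : L2Pair Ω), p⟫_ℂ = pairing Ω p (ofTest Ω φ) := by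
  rw [pairing_apply, WithLp.prod_inner_apply, L2.inner_def, L2.inner_def,
    ← integral_add (L2.integrable_inner _ _) (L2.integrable_inner _ _)]
  refine integral_congr_ae ?_
  filter_upwards [fn_ofTest φ, grad_ofTest φ, fn_ofTest (conjTest φ), grad_ofTest (conjTest φ)]
    with x h1 h2 h3 h4
  change ⟪fn (ofTest Ω (conjTest φ)) x, p.fst x⟫_ℂ
    + ⟪grad (ofTest Ω (conjTest φ)) x, p.snd x⟫_ℂ
      = p.fst x * fn (ofTest Ω φ) x + dot (p.snd x) (grad (ofTest Ω φ) x)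
  rw [h1, h2, h3, h4]
  simp only [PiLp.inner_apply, RCLike.inner_apply, conjTest_apply, gradient_conjTest,
    Complex.conj_conj, dot]

theorem pairing_eq_zero_of_mem_H10 {p : L2Pair Ω} (hp : ∀ φ : 𝓓(Ω, ℂ), pairing Ω p (ofTest Ω φ) = 0)
    {w : H1 Ω} (hw : w ∈ H10 Ω) : pairing Ω p w = 0 := by
  refine H10_induction (P := fun w : H1 Ω => pairing Ω p w = 0) ?_ hp hw
  exact isClosed_eq (pairing Ω p ∘L (H1 Ω).subtypeL).continuous continuous_const

theorem inner_eq_zero_of_mem_H10 {p : L2Pair Ω} (hp : ∀ φ : 𝓓(Ω, ℂ), pairing Ω p (ofTest Ω φ) = 0)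
    {w : H1 Ω} (hw : w ∈ H10 Ω) : ⟪(w : L2Pair Ω), p⟫_ℂ = 0 := by
  refine H10_induction (P := fun w : H1 Ω => ⟪(w : L2Pair Ω), p⟫_ℂ = 0)
    (isClosed_eq (by fun_prop) continuous_const) (fun φ => ?_) hw
  rw [← conjTest_conjTest φ, inner_ofTest_conjTest]
  exact hp _

theorem forall_pairing_ofTest_eq_zero {p : L2Pair Ω}
    (hp : ∀ w ∈ H10 Ω, ⟪(w : L2Pair Ω), p⟫_ℂ = 0) (φ : 𝓓(Ω, ℂ)) :
    pairing Ω p (ofTest Ω φ) = 0 := by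
  rw [← inner_ofTest_conjTest]
  exact hp _ (ofTest_mem_H10 _)

section Solutions

variable {A : EuclideanSpace ℝ (Fin n) → EuclideanSpace ℂ (Fin n)}
  {q : EuclideanSpace ℝ (Fin n) → ℂ}

theorem IsSolution.pairing_flux_eq_zero (hA : MemLp A ⊤ (vol Ω)) (hq : MemLp q ⊤ (vol Ω))
    {u : H1 Ω} (hu : IsSolution Ω A q u) {g : H1 Ω} (hg : g ∈ H10 Ω) :
    pairing Ω (flux hA hq u) g = 0 :=
  pairing_eq_zero_of_mem_H10 (fun φ => (pairing_flux hA hq u _).trans (hu φ)) hg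

theorem IsSolution.exists_isNormalTrace (hA : MemLp A ⊤ (vol Ω)) (hq : MemLp q ⊤ (vol Ω))
    {u : H1 Ω} (hu : IsSolution Ω A q u) : ∃ ℓ : DualTraceSpace Ω, IsNormalTrace Ω A q u ℓ := by
  let B : H1 Ω →L[ℂ] ℂ := pairing Ω (flux hA hq u) ∘L (H1 Ω).subtypeL
  have hB : H10 Ω ≤ LinearMap.ker (B : H1 Ω →ₗ[ℂ] ℂ) := fun g hg =>
    hu.pairing_flux_eq_zero hA hq hg
  exact ⟨⟨(H10 Ω).liftQ (B : H1 Ω →ₗ[ℂ] ℂ) hB, B.continuous.quotient_lift _⟩,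
    fun g => pairing_flux hA hq u g⟩

theorem magneticForm_eq_of_cauchyData_eq
    {A' : EuclideanSpace ℝ (Fin n) → EuclideanSpace ℂ (Fin n)} {q' : EuclideanSpace ℝ (Fin n) → ℂ}
    (hA : MemLp A ⊤ (vol Ω)) (hq : MemLp q ⊤ (vol Ω)) (hA' : MemLp A' ⊤ (vol Ω))
    (hq' : MemLp q' ⊤ (vol Ω)) (hC : cauchyData Ω A q = cauchyData Ω A' q') {u v : H1 Ω}
    (hu : IsSolution Ω A q u) (hv : IsSolution Ω (-A') q' v) :
    magneticForm Ω A q u v = magneticForm Ω A' q' u v := by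
  obtain ⟨ℓ, hℓ⟩ := hu.exists_isNormalTrace hA hq
  obtain ⟨u', -, htr, hℓ'⟩ : (trace Ω u, ℓ) ∈ cauchyData Ω A' q' := hC ▸ ⟨u, hu, rfl, hℓ⟩
  have hdiff : u - u' ∈ H10 Ω := (Submodule.Quotient.eq _).1 htr
  have hu' : magneticForm Ω A' q' (u - u') v = 0 := by
    rw [magneticForm_comm, ← pairing_flux hA'.neg hq']
    exact hv.pairing_flux_eq_zero hA'.neg hq' hdiff
  rw [← pairing_flux hA' hq', map_sub, map_sub, sub_apply, sub_eq_zero, pairing_flux,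
    pairing_flux] at hu'
  rw [hu', ← hℓ v, ← hℓ' v]

theorem exists_garding (hA : MemLp A ⊤ (vol Ω)) (hq : MemLp q ⊤ (vol Ω)) :
    ∃ K : ℝ, 0 ≤ K ∧ ∀ u : H1 Ω, 2⁻¹ * ‖grad u‖ ^ 2 - K * ‖fn u‖ ^ 2
      ≤ (⟪(u : L2Pair Ω), flux hA hq u⟫_ℂ).re := by
  obtain ⟨K, hK, hb⟩ := exists_norm_inner_lowerFlux_le hA (memLp_top_dot_add hA hq)
  refine ⟨2 * K ^ 2 + K, by positivity, fun u => ?_⟩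
  have hgrad : ⟪(u : L2Pair Ω), gradFlux Ω u⟫_ℂ = (‖grad u‖ ^ 2 : ℝ) := by
    rw [WithLp.prod_inner_apply]
    change ⟪fn u, 0⟫_ℂ + ⟪grad u, grad u⟫_ℂ = _
    rw [inner_zero_right, zero_add, inner_self_eq_norm_sq_to_K]
    norm_cast
  have hlower : ‖⟪(u : L2Pair Ω), lowerFlux hA (memLp_top_dot_add hA hq) u⟫_ℂ‖
      ≤ K * (‖fn u‖ * ‖grad u‖ + ‖fn u‖ * ‖grad u‖ + ‖fn u‖ * ‖fn u‖) :=
    (hb u u).trans (mul_le_mul_of_nonneg_left (integral_lowerMajorant_le u u) hK)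
  have hre := (abs_le.1 ((Complex.abs_re_le_norm _).trans hlower)).1
  rw [flux, add_apply, inner_add_right, hgrad, Complex.add_re, Complex.ofReal_re]
  nlinarith [sq_nonneg (2 * K * ‖fn u‖ - ‖grad u‖)]

end Solutions

/-! ### The Poincaré inequality up to finitely many functionals -/

section Fourier

open scoped FourierTransform LineDeriv SchwartzMap

theorem norm_fourierChar_sub_le (a b : ℝ) :
    ‖(Real.fourierChar a : ℂ) - Real.fourierChar b‖ ≤ 2 * Real.pi * |a - b| := by
  have e : (Real.fourierChar a : ℂ) - Real.fourierChar b
      = Real.fourierChar b * (Complex.exp (Complex.I * ((2 * Real.pi * (a - b) : ℝ) : ℂ)) - 1) := by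
    rw [Real.fourierChar_apply, Real.fourierChar_apply, mul_sub, mul_one, ← Complex.exp_add]
    congr 2
    push_cast
    ring
  rw [e, norm_mul, Circle.norm_coe, one_mul]
  refine Real.norm_exp_I_mul_ofReal_sub_one_le.trans_eq ?_
  rw [Real.norm_eq_abs, abs_mul, abs_of_nonneg (by positivity)]

variable {V F : Type*} [NormedAddCommGroup V] [InnerProductSpace ℝ V] [FiniteDimensional ℝ V]
  [MeasurableSpace V] [BorelSpace V] [NormedAddCommGroup F]

theorem norm_fourier_sub_le [NormedSpace ℂ F] {f : V → F} (hf : Integrable f) {D : ℝ}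
    (hD : ∀ x, f x ≠ 0 → ‖x‖ ≤ D) (ξ η : V) :
    ‖𝓕 f ξ - 𝓕 f η‖ ≤ 2 * Real.pi * D * ‖ξ - η‖ * ∫ x, ‖f x‖ := by
  have hint : ∀ ξ : V, Integrable fun x => Real.fourierChar (-inner ℝ x ξ) • f x := fun ξ =>
    (Real.fourierIntegral_convergent_iff ξ).2 hf
  rw [Real.fourier_eq, Real.fourier_eq, ← integral_sub (hint ξ) (hint η), ← integral_const_mul]
  refine norm_integral_le_of_norm_le (hf.norm.const_mul _) (ae_of_all _ fun x => ?_)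
  rw [Circle.smul_def, Circle.smul_def, ← sub_smul, norm_smul]
  rcases eq_or_ne (f x) 0 with hx | hx
  · simp [hx]
  · have : 0 ≤ D := (norm_nonneg x).trans (hD x hx)
    gcongr
    refine (norm_fourierChar_sub_le _ _).trans ?_
    rw [neg_sub_neg, ← inner_sub_right, norm_sub_rev ξ η, mul_assoc (2 * Real.pi)]
    refine mul_le_mul_of_nonneg_left ?_ (by positivity)
    exact (abs_real_inner_le_norm _ _).trans (mul_le_mul_of_nonneg_right (hD x hx) (norm_nonneg _))

theorem norm_sq_fourier_lineDeriv [InnerProductSpace ℂ F] (f : 𝓢(V, F)) (v ξ : V) :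
    ‖𝓕 (∂_{v} f) ξ‖ ^ 2 = 4 * Real.pi ^ 2 * (inner ℝ ξ v ^ 2 * ‖𝓕 f ξ‖ ^ 2) := by
  have hg : (inner ℝ · v).HasTemperateGrowth := ((innerSL ℝ).flip v).hasTemperateGrowth
  rw [SchwartzMap.fourier_lineDerivOp_eq, smul_apply, SchwartzMap.smulLeftCLM_apply_apply hg,
    norm_smul, norm_smul]
  simp only [norm_mul, Complex.norm_ofNat, Complex.norm_real, Complex.norm_I, mul_one, mul_pow,
    Real.norm_eq_abs, sq_abs]
  ring

theorem integrable_norm_sq_schwartz [NormedSpace ℝ F] (f : 𝓢(V, F)) :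
    Integrable fun x => ‖f x‖ ^ 2 :=
  (f.memLp 2 volume).integrable_norm_pow (by norm_num)

theorem integral_norm_sq_le_low_frequency [InnerProductSpace ℂ F] [CompleteSpace F]
    {ι : Type*} [Fintype ι] (b : OrthonormalBasis ι ℝ V) (f : 𝓢(V, F)) {R : ℝ} (hR : 0 < R) :
    ∫ x, ‖f x‖ ^ 2 ≤ (∫ ξ in Metric.closedBall 0 R, ‖𝓕 f ξ‖ ^ 2)
      + (4 * Real.pi ^ 2 * R ^ 2)⁻¹ * ∑ i, ∫ x, ‖∂_{b i} f x‖ ^ 2 := by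
  have hball : MeasurableSet (Metric.closedBall (0 : V) R) := measurableSet_closedBall
  have hi := integrable_norm_sq_schwartz (𝓕 f)
  have hsum : Integrable fun ξ => (4 * Real.pi ^ 2 * R ^ 2)⁻¹ * ∑ i, ‖𝓕 (∂_{b i} f) ξ‖ ^ 2 :=
    (integrable_finsetSum _ fun i _ => integrable_norm_sq_schwartz (𝓕 (∂_{b i} f))).const_mul _
  have hpt : ∀ ξ, (4 * Real.pi ^ 2 * R ^ 2)⁻¹ * ∑ i, ‖𝓕 (∂_{b i} f) ξ‖ ^ 2
      = (‖ξ‖ / R) ^ 2 * ‖𝓕 f ξ‖ ^ 2 := fun ξ => by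
    simp only [norm_sq_fourier_lineDeriv, ← Finset.mul_sum, ← Finset.sum_mul]
    rw [b.sum_sq_inner_left]
    field_simp
  simp only [← f.integral_norm_sq_fourier, fun i => ((∂_{b i} f).integral_norm_sq_fourier).symm]
  rw [← integral_indicator hball, ← integral_finsetSum _ fun i _ =>
    integrable_norm_sq_schwartz (𝓕 (∂_{b i} f)), ← integral_const_mul,
    ← integral_add (hi.indicator hball) hsum]
  refine integral_mono hi ((hi.indicator hball).add hsum) fun ξ => ?_
  rw [hpt]
  by_cases hξ : ξ ∈ Metric.closedBall (0 : V) R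
  · rw [Set.indicator_of_mem hξ]
    exact le_add_of_nonneg_right (by positivity)
  · rw [Set.indicator_of_notMem hξ, zero_add]
    rw [mem_closedBall_zero_iff, not_le] at hξ
    exact le_mul_of_one_le_left (by positivity) (one_le_pow₀ ((one_le_div hR).2 hξ.le))

theorem integral_test_eq [NormedSpace ℝ F] (φ : 𝓓(Ω, ℂ)) {f : EuclideanSpace ℝ (Fin n) → F}
    (hf : ∀ x ∉ tsupport φ, f x = 0) : ∫ x, f x = ∫ x in Ω, f x :=
  (setIntegral_eq_integral_of_forall_compl_eq_zero fun x hx =>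
    hf x fun h => hx (φ.tsupport_subset h)).symm

theorem integral_sq_test (φ : 𝓓(Ω, ℂ)) : ∫ x, ‖φ x‖ ^ 2 = ‖fn (ofTest Ω φ)‖ ^ 2 := by
  rw [integral_test_eq φ fun x hx => by rw [image_eq_zero_of_notMem_tsupport hx]; simp,
    ← integral_sq_fn]
  refine integral_congr_ae ?_
  filter_upwards [fn_ofTest φ] with x hx
  rw [hx]

theorem partialDeriv_eq_zero_of_notMem {φ : EuclideanSpace ℝ (Fin n) → ℂ} (j : Fin n)
    {x : EuclideanSpace ℝ (Fin n)} (hx : x ∉ tsupport φ) : partialDeriv j φ x = 0 := by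
  rw [partialDeriv, fderiv_of_notMem_tsupport ℝ hx]
  rfl

theorem sum_integral_sq_partialDeriv (φ : 𝓓(Ω, ℂ)) :
    ∑ j, ∫ x, ‖partialDeriv j φ x‖ ^ 2 = ‖grad (ofTest Ω φ)‖ ^ 2 := by
  rw [← integral_finsetSum, integral_test_eq φ, ← integral_sq_grad]
  · refine integral_congr_ae ?_
    filter_upwards [grad_ofTest φ] with x hx
    rw [hx, EuclideanSpace.norm_sq_eq]
    rfl
  · intro x hx
    simp [partialDeriv_eq_zero_of_notMem _ hx]
  · intro j _
    exact (((continuous_partialDeriv φ j).memLp_of_hasCompactSupport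
      (hasCompactSupport_partialDeriv φ j)).integrable_norm_pow (p := 2) (by norm_num))

theorem norm_sq_test_le_low_frequency (φ : 𝓓(Ω, ℂ)) {R : ℝ} (hR : 0 < R) :
    ‖fn (ofTest Ω φ)‖ ^ 2 ≤ (∫ ξ in Metric.closedBall 0 R, ‖𝓕 ⇑φ ξ‖ ^ 2)
      + (4 * Real.pi ^ 2 * R ^ 2)⁻¹ * ‖grad (ofTest Ω φ)‖ ^ 2 := by
  have h := integral_norm_sq_le_low_frequency (EuclideanSpace.basisFun (Fin n) ℝ)
    (φ.hasCompactSupport.toSchwartzMap φ.contDiff) hR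
  rw [SchwartzMap.fourier_coe] at h
  rw [← integral_sq_test, ← sum_integral_sq_partialDeriv]
  simp only [EuclideanSpace.basisFun_apply] at h
  exact h

theorem exists_clm_ofTest_eq_fourier
    (hbdd : Bornology.IsBounded (Ω : Set (EuclideanSpace ℝ (Fin n))))
    (ξ : EuclideanSpace ℝ (Fin n)) :
    ∃ L : StrongDual ℂ (H1 Ω), ∀ φ : 𝓓(Ω, ℂ), L (ofTest Ω φ) = 𝓕 ⇑φ ξ := by
  have : IsFiniteMeasure (vol Ω) := ⟨by simpa using hbdd.measure_lt_top⟩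
  have hm : MemLp (fun x => (Real.fourierChar (-inner ℝ x ξ) : ℂ)) 2 (vol Ω) := by
    refine MemLp.of_bound ?_ 1 (ae_of_all _ fun x => (Circle.norm_coe _).le)
    exact (continuous_subtype_val.comp
      (Real.continuous_fourierChar.comp (by fun_prop))).aestronglyMeasurable
  refine ⟨((ContinuousLinearMap.mul ℂ ℂ).lpPairing (vol Ω) 2 2 (hm.toLp _)) ∘L fnL Ω, fun φ => ?_⟩
  rw [ContinuousLinearMap.comp_apply, ContinuousLinearMap.lpPairing_eq_integral, Real.fourier_eq,
    integral_test_eq φ fun x hx => by rw [image_eq_zero_of_notMem_tsupport hx, smul_zero]]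
  refine integral_congr_ae ?_
  filter_upwards [fn_ofTest φ, hm.coeFn_toLp] with x hx hx'
  rw [fnL_apply, hx, hx', Circle.smul_def, smul_eq_mul, ContinuousLinearMap.mul_apply']

theorem exists_norm_fourier_test_sub_le
    (hbdd : Bornology.IsBounded (Ω : Set (EuclideanSpace ℝ (Fin n)))) :
    ∃ C : ℝ, 0 ≤ C ∧ ∀ (φ : 𝓓(Ω, ℂ)) (ξ η : EuclideanSpace ℝ (Fin n)),
      ‖𝓕 ⇑φ ξ - 𝓕 ⇑φ η‖ ≤ C * ‖ξ - η‖ * ‖fn (ofTest Ω φ)‖ := by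
  have : IsFiniteMeasure (vol Ω) := ⟨by simpa using hbdd.measure_lt_top⟩
  obtain ⟨D, hD0, hD⟩ := hbdd.exists_pos_norm_le
  let b : ℝ := √(∫ _ in (Ω : Set (EuclideanSpace ℝ (Fin n))), (1 : ℝ) ^ 2)
  refine ⟨2 * Real.pi * D * b, by positivity, fun φ ξ η => ?_⟩
  have hL1 : ∫ x, ‖φ x‖ ≤ b * ‖fn (ofTest Ω φ)‖ := by
    rw [integral_test_eq φ fun x hx => by rw [image_eq_zero_of_notMem_tsupport hx, norm_zero]]
    have hsq : ∫ x in Ω, ‖φ x‖ ^ 2 ≤ ‖fn (ofTest Ω φ)‖ ^ 2 := by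
      rw [← integral_sq_test, integral_test_eq φ fun x hx => by
        rw [image_eq_zero_of_notMem_tsupport hx]; simp]
    have hb : ∫ _ in (Ω : Set (EuclideanSpace ℝ (Fin n))), ‖(1 : ℝ)‖ ^ 2 ≤ b ^ 2 := by
      rw [norm_one, Real.sq_sqrt (integral_nonneg fun _ => by positivity)]
    simpa only [norm_one, one_mul] using integral_norm_mul_norm_le (memLp_const (1 : ℝ))
      (memLp_test φ) (Real.sqrt_nonneg _) (norm_nonneg (fn (ofTest Ω φ))) hb hsq
  calc ‖𝓕 ⇑φ ξ - 𝓕 ⇑φ η‖ ≤ 2 * Real.pi * D * ‖ξ - η‖ * ∫ x, ‖φ x‖ :=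
        norm_fourier_sub_le (φ.continuous.integrable_of_hasCompactSupport φ.hasCompactSupport)
          (fun x hx => hD x (φ.tsupport_subset (subset_tsupport _ hx))) ξ η
    _ ≤ 2 * Real.pi * D * ‖ξ - η‖ * (b * ‖fn (ofTest Ω φ)‖) := by gcongr
    _ = 2 * Real.pi * D * b * ‖ξ - η‖ * ‖fn (ofTest Ω φ)‖ := by ring

theorem norm_sq_le_of_norm_sub_le {a b : F} {c : ℝ} (h : ‖a - b‖ ≤ c) :
    ‖a‖ ^ 2 ≤ 2 * ‖b‖ ^ 2 + 2 * c ^ 2 := by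
  have hab : ‖a‖ ≤ ‖b‖ + c := by linarith [norm_le_norm_add_norm_sub' a b]
  calc ‖a‖ ^ 2 ≤ (‖b‖ + c) ^ 2 := by gcongr
    _ ≤ 2 * (‖b‖ ^ 2 + c ^ 2) := add_sq_le
    _ = 2 * ‖b‖ ^ 2 + 2 * c ^ 2 := mul_add _ _ _

-- The frequencies in a ball are sampled at a net so fine that the Lipschitz bound applies.
theorem exists_finset_integral_closedBall_le
    (hbdd : Bornology.IsBounded (Ω : Set (EuclideanSpace ℝ (Fin n)))) (R : ℝ) {ε : ℝ}
    (hε : 0 < ε) :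
    ∃ (s : Finset (StrongDual ℂ (H1 Ω))) (C : ℝ), ∀ φ : 𝓓(Ω, ℂ),
      ∫ ξ in Metric.closedBall 0 R, ‖𝓕 ⇑φ ξ‖ ^ 2
        ≤ C * ∑ L ∈ s, ‖L (ofTest Ω φ)‖ ^ 2 + ε * ‖fn (ofTest Ω φ)‖ ^ 2 := by
  classical
  obtain ⟨K, hK, hLip⟩ := exists_norm_fourier_test_sub_le hbdd
  choose L hL using exists_clm_ofTest_eq_fourier hbdd
  let v : ℝ := volume.real (Metric.closedBall (0 : EuclideanSpace ℝ (Fin n)) R)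
  obtain ⟨c, hc, hcε⟩ := exists_pos_mul_lt hε (2 * K ^ 2 * v)
  obtain ⟨t, -, htf, htc⟩ := (isCompact_closedBall (0 : EuclideanSpace ℝ (Fin n))
    R).finite_cover_balls (Real.sqrt_pos.2 hc)
  refine ⟨htf.toFinset.image L, 2 * v, fun φ => ?_⟩
  set a := ‖fn (ofTest Ω φ)‖
  set S := ∑ L ∈ htf.toFinset.image L, ‖L (ofTest Ω φ)‖ ^ 2
  have hpt : ∀ ξ ∈ Metric.closedBall (0 : EuclideanSpace ℝ (Fin n)) R,
      ‖𝓕 ⇑φ ξ‖ ^ 2 ≤ 2 * S + 2 * (K * √c * a) ^ 2 := fun ξ hξ => by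
    obtain ⟨ζ, hζ, hd⟩ := Set.mem_iUnion₂.1 (htc hξ)
    rw [Metric.mem_ball, dist_eq_norm] at hd
    have hS : ‖𝓕 ⇑φ ζ‖ ^ 2 ≤ S := by
      rw [← hL]
      exact Finset.single_le_sum (f := fun L : StrongDual ℂ (H1 Ω) => ‖L (ofTest Ω φ)‖ ^ 2)
        (fun _ _ => by positivity) (Finset.mem_image_of_mem L (htf.mem_toFinset.2 hζ))
    refine (norm_sq_le_of_norm_sub_le ((hLip φ ξ ζ).trans (?_ : _ ≤ K * √c * a))).trans (by gcongr)
    gcongr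
  have hint : Integrable fun ξ => ‖𝓕 ⇑φ ξ‖ ^ 2 := by
    have := integrable_norm_sq_schwartz (𝓕 (φ.hasCompactSupport.toSchwartzMap φ.contDiff))
    rwa [SchwartzMap.fourier_coe] at this
  calc ∫ ξ in Metric.closedBall 0 R, ‖𝓕 ⇑φ ξ‖ ^ 2
      ≤ ∫ _ in Metric.closedBall (0 : EuclideanSpace ℝ (Fin n)) R,
        (2 * S + 2 * (K * √c * a) ^ 2) :=
        setIntegral_mono_on hint.integrableOn (integrableOn_const measure_closedBall_lt_top.ne)
          measurableSet_closedBall hpt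
    _ = 2 * v * S + 2 * K ^ 2 * v * c * a ^ 2 := by
        rw [setIntegral_const, smul_eq_mul, mul_pow, mul_pow, Real.sq_sqrt hc.le]
        ring
    _ ≤ 2 * v * S + ε * a ^ 2 := by gcongr

theorem exists_finset_norm_sq_fn_le
    (hbdd : Bornology.IsBounded (Ω : Set (EuclideanSpace ℝ (Fin n)))) {δ : ℝ} (hδ : 0 < δ) :
    ∃ (s : Finset (StrongDual ℂ (H1 Ω))) (C : ℝ), ∀ u ∈ H10 Ω,
      ‖fn u‖ ^ 2 ≤ δ * ‖grad u‖ ^ 2 + C * ∑ L ∈ s, ‖L u‖ ^ 2 := by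
  obtain ⟨s, C, hs⟩ := exists_finset_integral_closedBall_le hbdd (√δ)⁻¹ (ε := 2⁻¹) (by norm_num)
  refine ⟨s, 2 * C, fun u hu => ?_⟩
  refine H10_induction (P := fun u => ‖fn u‖ ^ 2 ≤ δ * ‖grad u‖ ^ 2
    + 2 * C * ∑ L ∈ s, ‖L u‖ ^ 2) ?_ (fun φ => ?_) hu
  · simp only [← fnL_apply, ← gradL_apply]
    exact isClosed_le (by fun_prop) (by fun_prop)
  · have hhigh : (4 * Real.pi ^ 2 * (√δ)⁻¹ ^ 2)⁻¹ ≤ 2⁻¹ * δ := by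
      rw [inv_pow, Real.sq_sqrt hδ.le, mul_inv, inv_inv]
      gcongr
      nlinarith [Real.pi_gt_three]
    have hlow := norm_sq_test_le_low_frequency φ (inv_pos.2 (Real.sqrt_pos.2 hδ))
    have := mul_le_mul_of_nonneg_right hhigh (sq_nonneg ‖grad (ofTest Ω φ)‖)
    linarith [hs φ]

end Fourier

/-! ### Correcting approximate solutions -/

section Correction

variable {A : EuclideanSpace ℝ (Fin n) → EuclideanSpace ℂ (Fin n)}
  {q : EuclideanSpace ℝ (Fin n) → ℂ}

/-- The residual of `u` in the equation `L_{A,q} u = 0`: the element of `H¹₀(Ω)` which represents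
the antilinear functional `w ↦ magneticForm Ω A q u (conj w)`. -/
noncomputable def residual (hA : MemLp A ⊤ (vol Ω)) (hq : MemLp q ⊤ (vol Ω)) :
    H1 Ω →L[ℂ] H10 Ω :=
  (ContinuousLinearMap.adjoint (𝕜 := ℂ) (E := H10 Ω) (F := L2Pair Ω)
    ((H1 Ω).subtypeL ∘L (H10 Ω).subtypeL)) ∘L flux hA hq

theorem inner_residual (hA : MemLp A ⊤ (vol Ω)) (hq : MemLp q ⊤ (vol Ω)) (w : H10 Ω) (u : H1 Ω) :
    ⟪w, residual hA hq u⟫_ℂ = ⟪((w : H1 Ω) : L2Pair Ω), flux hA hq u⟫_ℂ :=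
  ContinuousLinearMap.adjoint_inner_right (𝕜 := ℂ) (E := H10 Ω) (F := L2Pair Ω) _ w _

theorem isSolution_of_residual_eq_zero (hA : MemLp A ⊤ (vol Ω)) (hq : MemLp q ⊤ (vol Ω))
    {u : H1 Ω} (hu : residual hA hq u = 0) : IsSolution Ω A q u := by
  have h : ∀ w ∈ H10 Ω, ⟪(w : L2Pair Ω), flux hA hq u⟫_ℂ = 0 := fun w hw => by
    rw [← inner_residual hA hq ⟨w, hw⟩, hu]
    exact inner_zero_right (𝕜 := ℂ) (E := H10 Ω) _
  exact fun φ => (pairing_flux hA hq u _).symm.trans (forall_pairing_ofTest_eq_zero h φ)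

theorem norm_residual_le (hA : MemLp A ⊤ (vol Ω)) (hq : MemLp q ⊤ (vol Ω)) {u : H1 Ω} {m : ℝ}
    (hm : 0 ≤ m) (h : ∀ w ∈ H10 Ω, ‖⟪(w : L2Pair Ω), flux hA hq u⟫_ℂ‖ ≤ m * ‖w‖) :
    ‖residual hA hq u‖ ≤ m := by
  have hsq : ‖residual hA hq u‖ ^ 2 ≤ m * ‖residual hA hq u‖ := by
    rw [← inner_self_eq_norm_sq (𝕜 := ℂ) (E := H10 Ω)]
    refine (RCLike.re_le_norm _).trans ?_
    rw [inner_residual]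
    exact h _ (residual hA hq u).2
  nlinarith [norm_nonneg (residual hA hq u)]

theorem exists_finset_coercive
    (hbdd : Bornology.IsBounded (Ω : Set (EuclideanSpace ℝ (Fin n))))
    (hA : MemLp A ⊤ (vol Ω)) (hq : MemLp q ⊤ (vol Ω)) :
    ∃ s : Finset (StrongDual ℂ (H1 Ω)), ∀ w ∈ H10 Ω, (∀ L ∈ s, L w = 0) →
      8⁻¹ * ‖w‖ ^ 2 ≤ (⟪(w : L2Pair Ω), flux hA hq w⟫_ℂ).re := by
  obtain ⟨K, hK, hgard⟩ := exists_garding hA hq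
  obtain ⟨s, M, hpoin⟩ := exists_finset_norm_sq_fn_le hbdd (δ := (4 * (K + 1))⁻¹) (by positivity)
  refine ⟨s, fun w hw hs => ?_⟩
  have hfn : ‖fn w‖ ^ 2 ≤ (4 * (K + 1))⁻¹ * ‖grad w‖ ^ 2 := by
    simpa +contextual [Finset.sum_eq_zero, hs] using hpoin w hw
  have hK' : (K + 1) * ‖fn w‖ ^ 2 ≤ 4⁻¹ * ‖grad w‖ ^ 2 := by
    calc (K + 1) * ‖fn w‖ ^ 2 ≤ (K + 1) * ((4 * (K + 1))⁻¹ * ‖grad w‖ ^ 2) := by gcongr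
      _ = 4⁻¹ * ‖grad w‖ ^ 2 := by field_simp
  have := hgard w
  have := norm_sq_eq w
  linarith [sq_nonneg ‖fn w‖, sq_nonneg ‖grad w‖]

theorem exists_solution_correction
    (hbdd : Bornology.IsBounded (Ω : Set (EuclideanSpace ℝ (Fin n))))
    (hA : MemLp A ⊤ (vol Ω)) (hq : MemLp q ⊤ (vol Ω)) (Y : Submodule ℂ (H1 Ω)) :
    ∃ E ≤ Y, FiniteDimensional ℂ E ∧ ∃ C : ℝ, 0 ≤ C ∧ ∀ u ∈ Y, ∃ w ∈ H10 Ω, ∃ e ∈ E,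
      IsSolution Ω A q (u - (w + e)) ∧ ‖w‖ ≤ C * ‖residual hA hq u‖ ∧
        ‖e‖ ≤ C * ‖residual hA hq u‖ := by
  classical
  obtain ⟨s, hs⟩ := exists_finset_coercive hbdd hA hq
  have hco : ∀ w : H10 Ω, (∀ L ∈ s.image (· ∘L (H10 Ω).subtypeL), L w = 0) →
      8⁻¹ * ‖w‖ ^ 2 ≤ RCLike.re ⟪w, residual hA hq w⟫_ℂ := fun w hw => by
    rw [inner_residual]
    exact hs w w.2 fun L hL => hw _ (Finset.mem_image_of_mem _ hL)
  have solve := exists_finiteDimensional_solve (𝕜 := ℂ) (H := H10 Ω) (X := H1 Ω) (H10 Ω).subtypeL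
  obtain ⟨E, hEY, hE, C, hC, h⟩ := solve (residual hA hq) _ (by norm_num) hco Y
  refine ⟨E, hEY, hE, C, hC, fun u hu => ?_⟩
  obtain ⟨w, e, he, hwe, hw, he'⟩ := h u hu
  have hsol : residual hA hq (u - (w + e)) = 0 := by
    rw [(residual hA hq).map_sub, (residual hA hq).map_add, sub_eq_zero]
    exact hwe.symm
  exact ⟨w, w.2, e, he, isSolution_of_residual_eq_zero hA hq hsol, hw, he'⟩

end Correction

/-! ### Functions that are smooth up to the boundary -/

theorem continuousOn_partialDeriv {O : Set (EuclideanSpace ℝ (Fin n))} (hO : IsOpen O)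
    {f : EuclideanSpace ℝ (Fin n) → ℂ} (hf : ContDiffOn ℝ 1 f O) (j : Fin n) :
    ContinuousOn (partialDeriv j f) O :=
  (hf.continuousOn_fderiv_of_isOpen hO le_rfl).clm_apply continuousOn_const

theorem integrable_mul_of_hasCompactSupport {O : Set (EuclideanSpace ℝ (Fin n))}
    {f ψ : EuclideanSpace ℝ (Fin n) → ℂ} (hf : ContinuousOn f O) (hψ : Continuous ψ)
    (hc : HasCompactSupport ψ) (hs : tsupport ψ ⊆ O) : Integrable fun x => f x * ψ x := by
  have h : IntegrableOn (fun x => f x * ψ x) (tsupport ψ) :=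
    ((hf.mono hs).mul hψ.continuousOn).integrableOn_compact hc
  refine (integrableOn_iff_integrable_of_support_subset fun x hx => ?_).1 h
  exact subset_tsupport _ fun h0 => hx (by simp [h0])

theorem integral_mul_partialDeriv {O : Set (EuclideanSpace ℝ (Fin n))} (hO : IsOpen O)
    {f ψ : EuclideanSpace ℝ (Fin n) → ℂ} (hf : ContDiffOn ℝ 1 f O) (hψ : ContDiff ℝ 1 ψ)
    (hc : HasCompactSupport ψ) (hs : tsupport ψ ⊆ O) (j : Fin n) :
    ∫ x, f x * partialDeriv j ψ x = - ∫ x, partialDeriv j f x * ψ x := by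
  have hcd : Continuous (partialDeriv j ψ) :=
    (hψ.continuous_fderiv (by simp)).clm_apply continuous_const
  refine integral_mul_fderiv_eq_neg_fderiv_mul_of_integrable ?_ ?_ ?_ ?_ ?_
  · exact integrable_mul_of_hasCompactSupport (continuousOn_partialDeriv hO hf j) hψ.continuous
      hc hs
  · refine integrable_mul_of_hasCompactSupport hf.continuousOn hcd (hc.fderiv_apply ℝ _) ?_
    exact (tsupport_fderiv_apply_subset ℝ _).trans hs
  · exact integrable_mul_of_hasCompactSupport hf.continuousOn hψ.continuous hc hs
  · exact fun x hx => (hf.contDiffAt (hO.mem_nhds (hs hx))).differentiableAt (by simp)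
  · exact fun x _ => hψ.differentiable (by simp) x

theorem setIntegral_mul_partialDeriv {O : Set (EuclideanSpace ℝ (Fin n))} (hO : IsOpen O)
    {f : EuclideanSpace ℝ (Fin n) → ℂ} (hf : ContDiffOn ℝ 1 f O)
    (hs : (Ω : Set (EuclideanSpace ℝ (Fin n))) ⊆ O) (φ : 𝓓(Ω, ℂ)) (j : Fin n) :
    ∫ x in Ω, f x * partialDeriv j φ x = - ∫ x in Ω, partialDeriv j f x * φ x := by
  rw [← integral_test_eq φ fun x hx => by rw [partialDeriv_eq_zero_of_notMem _ hx, mul_zero],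
    ← integral_test_eq φ fun x hx => by rw [image_eq_zero_of_notMem_tsupport hx, mul_zero]]
  exact integral_mul_partialDeriv hO hf (φ.contDiff.of_le (by simp)) φ.hasCompactSupport
    (φ.tsupport_subset.trans hs) j

theorem memLp_of_continuousOn_closure {F : Type*} [NormedAddCommGroup F] [SecondCountableTopology F]
    (hbdd : Bornology.IsBounded (Ω : Set (EuclideanSpace ℝ (Fin n))))
    {f : EuclideanSpace ℝ (Fin n) → F}
    (hf : ContinuousOn f (closure (Ω : Set (EuclideanSpace ℝ (Fin n))))) (p : ℝ≥0∞) :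
    MemLp f p (vol Ω) := by
  have : IsFiniteMeasure (vol Ω) := ⟨by simpa using hbdd.measure_lt_top⟩
  obtain ⟨C, hC⟩ := hbdd.isCompact_closure.exists_bound_of_continuousOn hf
  refine MemLp.of_bound ((hf.mono subset_closure).aestronglyMeasurable Ω.isOpen.measurableSet) C ?_
  filter_upwards [ae_restrict_mem Ω.isOpen.measurableSet] with x hx
  exact hC x (subset_closure hx)

theorem exists_H1_of_contDiffOn (hbdd : Bornology.IsBounded (Ω : Set (EuclideanSpace ℝ (Fin n))))
    {O : Set (EuclideanSpace ℝ (Fin n))} (hO : IsOpen O)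
    (hs : closure (Ω : Set (EuclideanSpace ℝ (Fin n))) ⊆ O)
    {f : EuclideanSpace ℝ (Fin n) → ℂ} (hf : ContDiffOn ℝ 1 f O) :
    ∃ u : H1 Ω, fn u =ᵐ[vol Ω] f ∧ grad u =ᵐ[vol Ω] gradient f := by
  have h1 : MemLp f 2 (vol Ω) := memLp_of_continuousOn_closure hbdd (hf.continuousOn.mono hs) 2
  have h2 : MemLp (gradient f) 2 (vol Ω) := MemLp.of_eval_piLp fun j =>
    memLp_of_continuousOn_closure hbdd ((continuousOn_partialDeriv hO hf j).mono hs) 2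
  refine ⟨⟨WithLp.toLp 2 (h1.toLp f, h2.toLp (gradient f)), fun φ j => ?_⟩, h1.coeFn_toLp,
    h2.coeFn_toLp⟩
  have e1 : ∫ x in Ω, (h1.toLp f) x * partialDeriv j φ x = ∫ x in Ω, f x * partialDeriv j φ x := by
    refine integral_congr_ae ?_
    filter_upwards [h1.coeFn_toLp] with x hx
    rw [hx]
  have e2 : ∫ x in Ω, (h2.toLp (gradient f)) x j * φ x = ∫ x in Ω, partialDeriv j f x * φ x := by
    refine integral_congr_ae ?_
    filter_upwards [h2.coeFn_toLp] with x hx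
    rw [hx]
    rfl
  exact e1.trans ((setIntegral_mul_partialDeriv hO hf (subset_closure.trans hs) φ j).trans
    (congrArg Neg.neg e2.symm))

theorem gradForm_ofTest_eq_zero {O : Set (EuclideanSpace ℝ (Fin n))} (hO : IsOpen O)
    (hs : (Ω : Set (EuclideanSpace ℝ (Fin n))) ⊆ O)
    {f : EuclideanSpace ℝ (Fin n) → ℂ} (hf : ∀ j, ContDiffOn ℝ 1 (partialDeriv j f) O)
    (hlap : ∀ x ∈ O, ∑ j, partialDeriv j (partialDeriv j f) x = 0)
    {u : H1 Ω} (hu : grad u =ᵐ[vol Ω] gradient f) (φ : 𝓓(Ω, ℂ)) :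
    gradForm u (ofTest Ω φ) = 0 := by
  have e : gradForm u (ofTest Ω φ) = ∫ x in Ω, ∑ j, partialDeriv j f x * partialDeriv j φ x := by
    refine integral_congr_ae ?_
    filter_upwards [hu, grad_ofTest φ] with x h1 h2
    rw [h1, h2]
    rfl
  have hi1 : ∀ j, Integrable (fun x => partialDeriv j f x * partialDeriv j φ x) (vol Ω) := fun j =>
    (integrable_mul_of_hasCompactSupport (hf j).continuousOn (continuous_partialDeriv φ j)
      (hasCompactSupport_partialDeriv φ j)
      (((tsupport_fderiv_apply_subset ℝ _).trans φ.tsupport_subset).trans hs)).restrict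
  have hi2 : ∀ j, Integrable (fun x => partialDeriv j (partialDeriv j f) x * φ x) (vol Ω) :=
    fun j => (integrable_mul_of_hasCompactSupport (continuousOn_partialDeriv hO (hf j) j)
      φ.continuous φ.hasCompactSupport (φ.tsupport_subset.trans hs)).restrict
  rw [e, integral_finsetSum _ fun j _ => hi1 j]
  simp only [fun j => setIntegral_mul_partialDeriv hO (hf j) hs φ j]
  rw [Finset.sum_neg_distrib, ← integral_finsetSum _ fun j _ => hi2 j, neg_eq_zero]
  refine setIntegral_eq_zero_of_forall_eq_zero fun x hx => ?_
  rw [← Finset.sum_mul, hlap x (hs hx), zero_mul]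

theorem partialDeriv_congr {O : Set (EuclideanSpace ℝ (Fin n))} (hO : IsOpen O)
    {f g : EuclideanSpace ℝ (Fin n) → ℂ} (h : Set.EqOn f g O) (j : Fin n) :
    Set.EqOn (partialDeriv j f) (partialDeriv j g) O := fun x hx => by
  rw [partialDeriv, partialDeriv, (h.eventuallyEq_of_mem (hO.mem_nhds hx)).fderiv_eq]

theorem fderiv_apply_eq_sum (f : EuclideanSpace ℝ (Fin n) → ℂ) (x v : EuclideanSpace ℝ (Fin n)) :
    fderiv ℝ f x v = ∑ j, v j * partialDeriv j f x := by
  conv_lhs => rw [← (EuclideanSpace.basisFun (Fin n) ℝ).sum_repr v, map_sum]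
  simp [partialDeriv]

theorem norm_fderiv_apply_le (f : EuclideanSpace ℝ (Fin n) → ℂ) (x v : EuclideanSpace ℝ (Fin n)) :
    ‖fderiv ℝ f x v‖ ≤ ‖v‖ * ‖gradient f x‖ := by
  have h := norm_dot_le (WithLp.toLp 2 fun j => (v j : ℂ)) (gradient f x)
  rw [fderiv_apply_eq_sum]
  simpa [dot, gradient, EuclideanSpace.norm_eq] using h

theorem integral_fderiv_apply_eq_neg {O : Set (EuclideanSpace ℝ (Fin n))} (hO : IsOpen O)
    {X : EuclideanSpace ℝ (Fin n) → EuclideanSpace ℝ (Fin n)} {ψ : EuclideanSpace ℝ (Fin n) → ℂ}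
    (hX : ∀ j, ContDiffOn ℝ 1 (fun x => (X x j : ℂ)) O) (hψ : ContDiff ℝ 1 ψ)
    (hc : HasCompactSupport ψ) (hs : tsupport ψ ⊆ O) :
    ∫ x, fderiv ℝ ψ x (X x) = -∫ x, (∑ j, partialDeriv j (fun z => (X z j : ℂ)) x) * ψ x := by
  have hcd : ∀ j, Continuous (partialDeriv j ψ) := fun j =>
    (hψ.continuous_fderiv (by simp)).clm_apply continuous_const
  simp only [fderiv_apply_eq_sum, Finset.sum_mul]
  rw [integral_finsetSum _ fun j _ => ?_, integral_finsetSum _ fun j _ => ?_,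
    ← Finset.sum_neg_distrib]
  · exact Finset.sum_congr rfl fun j _ => integral_mul_partialDeriv hO (hX j) hψ hc hs j
  · exact integrable_mul_of_hasCompactSupport (continuousOn_partialDeriv hO (hX j) j)
      hψ.continuous hc hs
  · exact integrable_mul_of_hasCompactSupport (hX j).continuousOn (hcd j) (hc.fderiv_apply ℝ _)
      ((tsupport_fderiv_apply_subset ℝ _).trans hs)

/-! ### Harmonic functions with a pole -/

section Pole

/-- The function `(α + ⟨x - y, β⟩) |x - y|^{2m}`, as a complex-valued function of `x`: the
fundamental solution with pole `y` and its derivatives are of this form. -/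
noncomputable def poleFn (α : ℝ) (β y : EuclideanSpace ℝ (Fin n)) (m : ℝ)
    (x : EuclideanSpace ℝ (Fin n)) : ℂ :=
  (((α + ⟪x - y, β⟫_ℝ) * (‖x - y‖ ^ 2) ^ m : ℝ) : ℂ)

/-- The gradient of `poleFn α β y m`. -/
noncomputable def poleGrad (α : ℝ) (β y : EuclideanSpace ℝ (Fin n)) (m : ℝ)
    (x : EuclideanSpace ℝ (Fin n)) : EuclideanSpace ℝ (Fin n) :=
  (‖x - y‖ ^ 2) ^ m • β + (2 * m * (α + ⟪x - y, β⟫_ℝ) * (‖x - y‖ ^ 2) ^ (m - 1)) • (x - y)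

variable {y : EuclideanSpace ℝ (Fin n)} {m : ℝ}

theorem norm_sub_sq_ne_zero {x : EuclideanSpace ℝ (Fin n)} (hx : x ≠ y) : ‖x - y‖ ^ 2 ≠ 0 :=
  pow_ne_zero 2 (norm_ne_zero_iff.2 (sub_ne_zero.2 hx))

theorem sq_mul_rpow_sub_one {x : EuclideanSpace ℝ (Fin n)} (hx : x ≠ y) (m : ℝ) :
    ‖x - y‖ ^ 2 * (‖x - y‖ ^ 2) ^ (m - 1) = (‖x - y‖ ^ 2) ^ m := by
  rw [Real.rpow_sub_one (norm_sub_sq_ne_zero hx), mul_div_cancel₀ _ (norm_sub_sq_ne_zero hx)]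

theorem hasFDerivAt_norm_sub_sq_rpow {x : EuclideanSpace ℝ (Fin n)} (hx : x ≠ y) (m : ℝ) :
    HasFDerivAt (fun x : EuclideanSpace ℝ (Fin n) => (‖x - y‖ ^ 2) ^ m)
      ((2 * m * (‖x - y‖ ^ 2) ^ (m - 1)) • innerSL ℝ (x - y)) x := by
  refine ((((hasFDerivAt_id x).sub_const y).norm_sq).rpow_const (p := m)
    (Or.inl (norm_sub_sq_ne_zero hx))).congr_fderiv (ContinuousLinearMap.ext fun v => ?_)
  simp only [id_eq, map_sub, ContinuousLinearMap.comp_id, smul_apply, sub_apply,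
    coe_innerSL_apply, nsmul_eq_mul, Nat.cast_ofNat, smul_eq_mul]
  ring

theorem hasFDerivAt_inner_sub (β x : EuclideanSpace ℝ (Fin n)) :
    HasFDerivAt (fun x => ⟪x - y, β⟫_ℝ) (innerSL ℝ β) x := by
  refine (((hasFDerivAt_id x).sub_const y).inner ℝ (hasFDerivAt_const β x)).congr_fderiv
    (ContinuousLinearMap.ext fun v => ?_)
  simp [real_inner_comm]

theorem contDiffOn_norm_sub_sq_rpow (y : EuclideanSpace ℝ (Fin n)) (m : ℝ) :
    ContDiffOn ℝ 1 (fun x : EuclideanSpace ℝ (Fin n) => (‖x - y‖ ^ 2) ^ m) {y}ᶜ := fun _ hx =>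
  (((contDiff_id.sub contDiff_const).norm_sq ℝ).contDiffAt.rpow_const_of_ne
    (norm_sub_sq_ne_zero hx)).contDiffWithinAt

theorem contDiffOn_poleFn (α : ℝ) (β y : EuclideanSpace ℝ (Fin n)) (m : ℝ) :
    ContDiffOn ℝ 1 (poleFn α β y m) {y}ᶜ :=
  Complex.ofRealCLM.contDiff.comp_contDiffOn
    (((contDiff_const.add ((contDiff_id.sub contDiff_const).inner ℝ contDiff_const)).contDiffOn).mul
      (contDiffOn_norm_sub_sq_rpow y m))

theorem contDiffOn_poleGrad_apply (α : ℝ) (β y : EuclideanSpace ℝ (Fin n)) (m : ℝ) (j : Fin n) :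
    ContDiffOn ℝ 1 (fun x => (poleGrad α β y m x j : ℂ)) {y}ᶜ := by
  have hP : ContDiff ℝ 1 fun x : EuclideanSpace ℝ (Fin n) => α + ⟪x - y, β⟫_ℝ :=
    contDiff_const.add ((contDiff_id.sub contDiff_const).inner ℝ contDiff_const)
  have h : ContDiffOn ℝ 1 (poleGrad α β y m) {y}ᶜ :=
    ((contDiffOn_norm_sub_sq_rpow y m).smul contDiffOn_const).add
      (((contDiff_const.mul hP).contDiffOn.mul (contDiffOn_norm_sub_sq_rpow y (m - 1))).smul
        (contDiff_id.sub contDiff_const).contDiffOn)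
  exact Complex.ofRealCLM.contDiff.comp_contDiffOn (contDiffOn_euclidean.1 h j)

theorem partialDeriv_ofReal {f : EuclideanSpace ℝ (Fin n) → ℝ}
    {f' : EuclideanSpace ℝ (Fin n) →L[ℝ] ℝ} {x : EuclideanSpace ℝ (Fin n)}
    (h : HasFDerivAt f f' x) (j : Fin n) :
    partialDeriv j (fun z => (f z : ℂ)) x = (f' (EuclideanSpace.single j 1) : ℂ) := by
  have hc : HasFDerivAt (fun z => (f z : ℂ)) (Complex.ofRealCLM.comp f') x :=
    Complex.ofRealCLM.hasFDerivAt.comp x h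
  rw [partialDeriv, hc.fderiv]
  rfl

theorem partialDeriv_poleFn (α : ℝ) (β : EuclideanSpace ℝ (Fin n))
    {x : EuclideanSpace ℝ (Fin n)} (hx : x ≠ y) (j : Fin n) :
    partialDeriv j (poleFn α β y m) x = (poleGrad α β y m x j : ℂ) := by
  have h := ((hasFDerivAt_inner_sub (y := y) β x).const_add α).mul
    (hasFDerivAt_norm_sub_sq_rpow hx m)
  refine (partialDeriv_ofReal h j).trans (congrArg _ ?_)
  simp only [map_sub, add_apply, smul_apply, sub_apply, coe_innerSL_apply,
    EuclideanSpace.inner_single_right, Real.ringHom_apply, one_mul, smul_eq_mul, poleGrad,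
    PiLp.add_apply, PiLp.smul_apply, PiLp.sub_apply]
  ring

theorem contDiffOn_partialDeriv_poleFn (α : ℝ) (β : EuclideanSpace ℝ (Fin n)) (j : Fin n) :
    ContDiffOn ℝ 1 (partialDeriv j (poleFn α β y m)) {y}ᶜ :=
  (contDiffOn_poleGrad_apply α β y m j).congr fun _ hx => partialDeriv_poleFn α β hx j

theorem norm_gradient_poleFn (α : ℝ) (β : EuclideanSpace ℝ (Fin n))
    {x : EuclideanSpace ℝ (Fin n)} (hx : x ≠ y) :
    ‖gradient (poleFn α β y m) x‖ = ‖poleGrad α β y m x‖ := by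
  simp [EuclideanSpace.norm_eq, gradient, partialDeriv_poleFn α β hx]

theorem partialDeriv_poleGrad (α : ℝ) (β : EuclideanSpace ℝ (Fin n))
    {x : EuclideanSpace ℝ (Fin n)} (hx : x ≠ y) (j : Fin n) :
    partialDeriv j (fun z => (poleGrad α β y m z j : ℂ)) x
      = ((2 * m * (‖x - y‖ ^ 2) ^ (m - 1) * (2 * (β j * (x - y) j) + (α + ⟪x - y, β⟫_ℝ))
        + 4 * m * (m - 1) * (α + ⟪x - y, β⟫_ℝ) * (‖x - y‖ ^ 2) ^ (m - 1 - 1)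
          * (x - y) j ^ 2 : ℝ) : ℂ) := by
  let proj : EuclideanSpace ℝ (Fin n) →L[ℝ] ℝ := EuclideanSpace.proj j
  have hcoord : HasFDerivAt (fun z : EuclideanSpace ℝ (Fin n) => (z - y) j) proj x :=
    proj.hasFDerivAt.comp x ((hasFDerivAt_id x).sub_const y)
  have h := ((hasFDerivAt_norm_sub_sq_rpow hx m).mul_const (β j)).add
    (((((hasFDerivAt_inner_sub (y := y) β x).const_add α).const_mul (2 * m)).mul
      (hasFDerivAt_norm_sub_sq_rpow hx (m - 1))).mul hcoord)
  refine (partialDeriv_ofReal (f := fun z => poleGrad α β y m z j) h j).trans (congrArg _ ?_)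
  simp only [map_sub, Pi.mul_apply, PiLp.sub_apply, smul_add, add_apply, smul_apply, sub_apply,
    coe_innerSL_apply, EuclideanSpace.inner_single_right, Real.ringHom_apply, one_mul, smul_eq_mul,
    PiLp.proj_apply, PiLp.single_eq_same, mul_one, proj]
  ring

theorem sum_partialDeriv_poleGrad (α : ℝ) (β : EuclideanSpace ℝ (Fin n))
    {x : EuclideanSpace ℝ (Fin n)} (hx : x ≠ y) :
    ∑ j, partialDeriv j (fun z => (poleGrad α β y m z j : ℂ)) x
      = ((2 * m * (‖x - y‖ ^ 2) ^ (m - 1) * (2 * ⟪x - y, β⟫_ℝ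
        + (n + 2 * (m - 1)) * (α + ⟪x - y, β⟫_ℝ)) : ℝ) : ℂ) := by
  have hinner : ∑ j, β j * (x - y) j = ⟪x - y, β⟫_ℝ := by simp [PiLp.inner_apply]
  have hnorm : ∑ j, (x - y) j ^ 2 = ‖x - y‖ ^ 2 := by simp [EuclideanSpace.norm_sq_eq]
  simp only [partialDeriv_poleGrad α β hx]
  rw [← Complex.ofReal_sum]
  congr 1
  rw [Finset.sum_add_distrib, ← Finset.mul_sum, ← Finset.mul_sum, Finset.sum_add_distrib,
    ← Finset.mul_sum, hinner, hnorm, ← sq_mul_rpow_sub_one hx (m - 1)]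
  simp only [Finset.sum_const, Finset.card_univ, Fintype.card_fin, smul_add, nsmul_eq_mul]
  ring

theorem laplacian_poleFn (α : ℝ) (β : EuclideanSpace ℝ (Fin n))
    {x : EuclideanSpace ℝ (Fin n)} (hx : x ≠ y) :
    ∑ j, partialDeriv j (partialDeriv j (poleFn α β y m)) x
      = ((2 * m * (‖x - y‖ ^ 2) ^ (m - 1) * (2 * ⟪x - y, β⟫_ℝ
        + (n + 2 * (m - 1)) * (α + ⟪x - y, β⟫_ℝ)) : ℝ) : ℂ) := by
  rw [← sum_partialDeriv_poleGrad α β hx]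
  exact Finset.sum_congr rfl fun j _ =>
    partialDeriv_congr isOpen_compl_singleton (fun z hz => partialDeriv_poleFn α β hz j) j hx

end Pole

/-! ### Hardy's inequality -/

section Hardy

variable {y : EuclideanSpace ℝ (Fin n)}

/-- The vector field `(x - y) / |x - y|²`, whose divergence is `(n - 2) / |x - y|²`. -/
noncomputable def hardyField (y x : EuclideanSpace ℝ (Fin n)) : EuclideanSpace ℝ (Fin n) :=
  (‖x - y‖ ^ 2)⁻¹ • (x - y)

theorem norm_hardyField (y x : EuclideanSpace ℝ (Fin n)) : ‖hardyField y x‖ = ‖x - y‖⁻¹ := by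
  rw [hardyField, norm_smul, norm_inv, norm_pow, norm_norm]
  rcases eq_or_ne ‖x - y‖ 0 with h | h
  · simp [h]
  · field_simp

theorem hardyField_apply (y x : EuclideanSpace ℝ (Fin n)) (j : Fin n) :
    (hardyField y x j : ℂ) = poleFn 0 (EuclideanSpace.single j 1) y (-1) x := by
  simp [hardyField, poleFn, Real.rpow_neg_one, EuclideanSpace.inner_single_right, mul_comm]

theorem contDiffOn_hardyField_apply (y : EuclideanSpace ℝ (Fin n)) (j : Fin n) :
    ContDiffOn ℝ 1 (fun x => (hardyField y x j : ℂ)) {y}ᶜ := by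
  simp only [hardyField_apply]
  exact contDiffOn_poleFn _ _ _ _

theorem divergence_hardyField {x : EuclideanSpace ℝ (Fin n)} (hx : x ≠ y) :
    ∑ j, partialDeriv j (fun z => (hardyField y z j : ℂ)) x
      = (((n - 2) * (‖x - y‖ ^ 2)⁻¹ : ℝ) : ℂ) := by
  have hnorm : ∑ j, (x - y) j ^ 2 = ‖x - y‖ ^ 2 := by simp [EuclideanSpace.norm_sq_eq]
  have hpd : ∀ j, partialDeriv j (fun z => (hardyField y z j : ℂ)) x
      = (((‖x - y‖ ^ 2)⁻¹ - 2 * (‖x - y‖ ^ 2) ^ (-1 - 1 : ℝ) * (x - y) j ^ 2 : ℝ) : ℂ) := by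
    intro j
    simp only [hardyField_apply]
    rw [partialDeriv_poleFn _ _ hx]
    congr 1
    simp only [poleGrad, Real.rpow_neg_one, mul_neg, mul_one, EuclideanSpace.inner_single_right,
      PiLp.sub_apply, Real.ringHom_apply, one_mul, zero_add, neg_mul, neg_smul, PiLp.add_apply,
      PiLp.smul_apply, PiLp.single_eq_same, smul_eq_mul, PiLp.neg_apply]
    ring
  simp only [hpd]
  rw [← Complex.ofReal_sum, Finset.sum_sub_distrib, ← Finset.mul_sum, hnorm, mul_assoc,
    mul_comm _ (‖x - y‖ ^ 2), sq_mul_rpow_sub_one hx, Real.rpow_neg_one]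
  congr 1
  simp only [Finset.sum_const, Finset.card_univ, Fintype.card_fin, nsmul_eq_mul]
  ring

theorem norm_fderiv_sq_norm_apply_le {f : EuclideanSpace ℝ (Fin n) → ℂ}
    {x : EuclideanSpace ℝ (Fin n)} (hf : DifferentiableAt ℝ f x) (v : EuclideanSpace ℝ (Fin n)) :
    ‖fderiv ℝ (fun z => ((‖f z‖ ^ 2 : ℝ) : ℂ)) x v‖ ≤ 2 * (‖v‖ * ‖f x‖ * ‖gradient f x‖) := by
  have h := (Complex.ofRealCLM.hasFDerivAt.comp x hf.hasFDerivAt.norm_sq).fderiv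
  have hv : fderiv ℝ (fun z => ((‖f z‖ ^ 2 : ℝ) : ℂ)) x v
      = ((2 * ⟪f x, fderiv ℝ f x v⟫_ℝ : ℝ) : ℂ) := by
    change fderiv ℝ (⇑Complex.ofRealCLM ∘ fun z => ‖f z‖ ^ 2) x v = _
    rw [h]
    simp [mul_add]
  rw [hv, Complex.norm_real, norm_mul, Real.norm_two, mul_comm ‖v‖, mul_assoc]
  gcongr
  exact (norm_inner_le_norm _ _).trans (by gcongr; exact norm_fderiv_apply_le f x v)

theorem memLp_inv_norm_sub_mul_of_hasCompactSupport {f : EuclideanSpace ℝ (Fin n) → ℂ}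
    (hf : Continuous f) (hc : HasCompactSupport f) (hy : y ∉ tsupport f) :
    MemLp (fun x => ‖x - y‖⁻¹ * ‖f x‖) 2 := by
  have hcont : ContinuousOn (fun x => ‖x - y‖⁻¹ * ‖f x‖) {y}ᶜ :=
    ((continuous_id.sub continuous_const).norm.continuousOn.inv₀ fun x hx =>
      norm_ne_zero_iff.2 (sub_ne_zero.2 hx)).mul hf.norm.continuousOn
  have hsupp : tsupport (fun x => ‖x - y‖⁻¹ * ‖f x‖) ⊆ tsupport f :=
    closure_mono fun x hx h0 => hx (by simp [h0])
  exact (hcont.continuous_of_tsupport_subset isOpen_compl_singleton fun x hx h =>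
    hy (h ▸ hsupp hx)).memLp_of_hasCompactSupport hc.norm.mul_left

theorem memLp_gradient_of_hasCompactSupport {f : EuclideanSpace ℝ (Fin n) → ℂ}
    (hf : ContDiff ℝ 1 f) (hc : HasCompactSupport f) : MemLp (gradient f) 2 :=
  MemLp.of_eval_piLp fun _ =>
    ((hf.continuous_fderiv one_ne_zero).clm_apply continuous_const).memLp_of_hasCompactSupport
      (hc.fderiv_apply ℝ _)

theorem abs_mul_integral_le_of_hasCompactSupport {f : EuclideanSpace ℝ (Fin n) → ℂ}
    (hf : ContDiff ℝ 1 f) (hc : HasCompactSupport f) (hy : y ∉ tsupport f) :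
    |(n - 2 : ℝ)| * ∫ x, (‖x - y‖⁻¹ * ‖f x‖) ^ 2
      ≤ 2 * ∫ x, ‖‖x - y‖⁻¹ * ‖f x‖‖ * ‖gradient f x‖ := by
  let ψ : EuclideanSpace ℝ (Fin n) → ℂ := fun x => ((‖f x‖ ^ 2 : ℝ) : ℂ)
  have hψ : ContDiff ℝ 1 ψ := Complex.ofRealCLM.contDiff.comp (hf.norm_sq ℝ)
  have hψf : tsupport ψ ⊆ tsupport f := closure_mono fun x hx h0 => hx (by simp [ψ, h0])
  have hψc : HasCompactSupport ψ := hc.mono' (subset_closure.trans hψf)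
  have hdiv := integral_fderiv_apply_eq_neg isOpen_compl_singleton (contDiffOn_hardyField_apply y)
    hψ hψc fun x hx h => hy (h ▸ hψf hx)
  have hrhs : ∫ x, (∑ j, partialDeriv j (fun z => (hardyField y z j : ℂ)) x) * ψ x
      = (((n - 2) * ∫ x, (‖x - y‖⁻¹ * ‖f x‖) ^ 2 : ℝ) : ℂ) := by
    rw [← integral_const_mul, ← integral_complex_ofReal]
    congr 1 with x
    rcases eq_or_ne x y with rfl | hx
    · simp [ψ, image_eq_zero_of_notMem_tsupport hy]
    · rw [divergence_hardyField hx, ← Complex.ofReal_mul, mul_pow, inv_pow, mul_assoc]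
  have habs : |(n - 2 : ℝ)| * ∫ x, (‖x - y‖⁻¹ * ‖f x‖) ^ 2
      = ‖∫ x, fderiv ℝ ψ x (hardyField y x)‖ := by
    rw [hdiv, hrhs, norm_neg, Complex.norm_real, norm_mul, Real.norm_eq_abs,
      Real.norm_of_nonneg (integral_nonneg fun _ => by positivity)]
  rw [habs, ← integral_const_mul]
  have hmem := memLp_inv_norm_sub_mul_of_hasCompactSupport hf.continuous hc hy
  have hint := (hmem.norm.integrable_mul
    (memLp_gradient_of_hasCompactSupport hf hc).norm).const_mul 2
  refine norm_integral_le_of_norm_le hint (.of_forall fun x => ?_)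
  have h := norm_fderiv_sq_norm_apply_le (hf.differentiable one_ne_zero x) (hardyField y x)
  rwa [norm_hardyField, ← Real.norm_of_nonneg (by positivity : 0 ≤ ‖x - y‖⁻¹ * ‖f x‖)] at h

theorem hardy_of_hasCompactSupport {f : EuclideanSpace ℝ (Fin n) → ℂ} (hf : ContDiff ℝ 1 f)
    (hc : HasCompactSupport f) (hy : y ∉ tsupport f) :
    (n - 2 : ℝ) ^ 2 * ∫ x, (‖x - y‖⁻¹ * ‖f x‖) ^ 2 ≤ 4 * ∫ x, ‖gradient f x‖ ^ 2 := by
  set S := ∫ x, (‖x - y‖⁻¹ * ‖f x‖) ^ 2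
  set G := ∫ x, ‖gradient f x‖ ^ 2
  have hS : 0 ≤ S := integral_nonneg fun _ => by positivity
  have hG : 0 ≤ G := integral_nonneg fun _ => by positivity
  have hmem := memLp_inv_norm_sub_mul_of_hasCompactSupport hf.continuous hc hy
  have hcs : ∫ x, ‖‖x - y‖⁻¹ * ‖f x‖‖ * ‖gradient f x‖ ≤ √S * √G := by
    refine integral_norm_mul_norm_le hmem
      (memLp_gradient_of_hasCompactSupport hf hc) (Real.sqrt_nonneg S) (Real.sqrt_nonneg G) ?_ ?_
    · simp only [Real.norm_eq_abs, sq_abs, Real.sq_sqrt hS]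
      exact le_rfl
    · rw [Real.sq_sqrt hG]
  have hmain : |(n - 2 : ℝ)| * √S * √S ≤ 2 * √G * √S := by
    have h := (abs_mul_integral_le_of_hasCompactSupport hf hc hy).trans
      (mul_le_mul_of_nonneg_left hcs zero_le_two)
    rw [mul_assoc, Real.mul_self_sqrt hS]
    linarith
  have hle : |(n - 2 : ℝ)| * √S ≤ 2 * √G := by
    rcases (Real.sqrt_nonneg S).eq_or_lt with h0 | h0
    · rw [← h0, mul_zero]
      positivity
    · exact le_of_mul_le_mul_right hmain h0
  have hsq := pow_le_pow_left₀ (by positivity) hle 2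
  rw [mul_pow, mul_pow, sq_abs, Real.sq_sqrt hS, Real.sq_sqrt hG] at hsq
  linarith

theorem memLp_top_inv_norm_sub (hy : y ∉ closure (Ω : Set (EuclideanSpace ℝ (Fin n)))) :
    MemLp (fun x => ((‖x - y‖⁻¹ : ℝ) : ℂ)) ⊤ (vol Ω) := by
  have hm : Measurable fun x : EuclideanSpace ℝ (Fin n) => ((‖x - y‖⁻¹ : ℝ) : ℂ) := by fun_prop
  obtain ⟨d, hd, hball⟩ :=
    Metric.nhds_basis_ball.mem_iff.1 (isClosed_closure.isOpen_compl.mem_nhds hy)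
  refine memLp_top_of_bound hm.aestronglyMeasurable d⁻¹ ?_
  filter_upwards [ae_restrict_mem Ω.isOpen.measurableSet] with x hx
  rw [Complex.norm_real, Real.norm_of_nonneg (by positivity)]
  gcongr
  rw [← dist_eq_norm]
  exact not_lt.1 fun h => hball h (subset_closure hx)

theorem memLp_inv_norm_sub_mul (hy : y ∉ closure (Ω : Set (EuclideanSpace ℝ (Fin n)))) (u : H1 Ω) :
    MemLp (fun x => ‖x - y‖⁻¹ * ‖fn u x‖) 2 (vol Ω) := by
  have h := ((memLp_fn u).mul' (memLp_top_inv_norm_sub hy) (p := ⊤) (q := 2) (r := 2)).norm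
  simpa using h

theorem hardy_ofTest (hy : y ∉ (Ω : Set (EuclideanSpace ℝ (Fin n)))) (φ : 𝓓(Ω, ℂ)) :
    (n - 2 : ℝ) ^ 2 * ∫ x in Ω, (‖x - y‖⁻¹ * ‖fn (ofTest Ω φ) x‖) ^ 2
      ≤ 4 * ‖grad (ofTest Ω φ)‖ ^ 2 := by
  have hfn : ∫ x in Ω, (‖x - y‖⁻¹ * ‖fn (ofTest Ω φ) x‖) ^ 2 = ∫ x, (‖x - y‖⁻¹ * ‖φ x‖) ^ 2 := by
    rw [integral_test_eq φ fun x hx => by simp [image_eq_zero_of_notMem_tsupport hx]]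
    refine integral_congr_ae ?_
    filter_upwards [fn_ofTest φ] with x hx
    rw [hx]
  have hgrad : ‖grad (ofTest Ω φ)‖ ^ 2 = ∫ x, ‖gradient φ x‖ ^ 2 := by
    rw [← integral_sq_grad, integral_test_eq φ fun x hx => by
      simp [EuclideanSpace.norm_eq, gradient, partialDeriv_eq_zero_of_notMem _ hx]]
    refine integral_congr_ae ?_
    filter_upwards [grad_ofTest φ] with x hx
    rw [hx]
  rw [hfn, hgrad]
  exact hardy_of_hasCompactSupport (φ.contDiff.of_le (by simp)) φ.hasCompactSupport
    fun h => hy (φ.tsupport_subset h)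

theorem hardy_H10 (hy : y ∉ closure (Ω : Set (EuclideanSpace ℝ (Fin n)))) {u : H1 Ω}
    (hu : u ∈ H10 Ω) :
    (n - 2 : ℝ) ^ 2 * ∫ x in Ω, (‖x - y‖⁻¹ * ‖fn u x‖) ^ 2 ≤ 4 * ‖grad u‖ ^ 2 := by
  let M := (ContinuousLinearMap.mul ℂ ℂ).holderL (vol Ω) ⊤ 2 2 ((memLp_top_inv_norm_sub hy).toLp _)
  have hM : ∀ u : H1 Ω, ∫ x in Ω, (‖x - y‖⁻¹ * ‖fn u x‖) ^ 2 = ‖M (fnL Ω u)‖ ^ 2 := fun u => by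
    rw [sq_norm_Lp_two]
    refine integral_congr_ae ?_
    filter_upwards [(ContinuousLinearMap.mul ℂ ℂ).coeFn_holder (r := 2)
      ((memLp_top_inv_norm_sub hy).toLp _) (fnL Ω u), (memLp_top_inv_norm_sub hy).coeFn_toLp]
      with x hx hk
    rw [show M (fnL Ω u) x = _ from hx, hk, fnL_apply]
    simp
  refine H10_induction (P := fun u : H1 Ω =>
    (n - 2 : ℝ) ^ 2 * ∫ x in Ω, (‖x - y‖⁻¹ * ‖fn u x‖) ^ 2 ≤ 4 * ‖grad u‖ ^ 2)
    ?_ (hardy_ofTest fun h => hy (subset_closure h)) hu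
  simp only [hM]
  exact isClosed_le (((M.continuous.comp (fnL Ω).continuous).norm.pow 2).const_mul _)
    (((gradL Ω).continuous.norm.pow 2).const_mul 4)

end Hardy

/-! ### Solutions with a prescribed singular part -/

section SingularPart

variable {y : EuclideanSpace ℝ (Fin n)}

/-- The weighted bounds satisfied, uniformly in the pole `y`, by a function with a singularity
at `y`. -/
structure SingularBound (y : EuclideanSpace ℝ (Fin n)) (a : ℝ) (u : H1 Ω) : Prop where
  norm_fn_le : ‖fn u‖ ≤ a
  integral_le : ∫ x in Ω, (‖x - y‖ * ‖grad u x‖) ^ 2 ≤ a ^ 2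

/-- The weighted bounds satisfied by the functions to which Hardy's inequality with pole `y`
applies. -/
structure HardyBound (y : EuclideanSpace ℝ (Fin n)) (b : ℝ) (z : H1 Ω) : Prop where
  norm_le : ‖z‖ ≤ b
  integral_le : ∫ x in Ω, (‖x - y‖⁻¹ * ‖fn z x‖) ^ 2 ≤ b ^ 2

/-- `u` is harmonic in `Ω` in the sense of distributions. -/
def IsWeaklyHarmonic (u : H1 Ω) : Prop := ∀ φ, gradForm u (ofTest Ω φ) = 0

theorem SingularBound.nonneg {a : ℝ} {u : H1 Ω} (hu : SingularBound y a u) : 0 ≤ a :=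
  (norm_nonneg _).trans hu.norm_fn_le

theorem HardyBound.nonneg {b : ℝ} {z : H1 Ω} (hz : HardyBound y b z) : 0 ≤ b :=
  (norm_nonneg _).trans hz.norm_le

theorem HardyBound.mono {b c : ℝ} {z : H1 Ω} (hz : HardyBound y b z) (hbc : b ≤ c) :
    HardyBound y c z :=
  ⟨hz.norm_le.trans hbc, hz.integral_le.trans (pow_le_pow_left₀ hz.nonneg hbc 2)⟩

theorem fn_add_ae (u v : H1 Ω) : fn (u + v) =ᵐ[vol Ω] fn u + fn v := Lp.coeFn_add _ _

theorem memLp_norm_sub_mul (hbdd : Bornology.IsBounded (Ω : Set (EuclideanSpace ℝ (Fin n))))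
    (y : EuclideanSpace ℝ (Fin n)) (u : H1 Ω) :
    MemLp (fun x => ‖x - y‖ * ‖grad u x‖) 2 (vol Ω) :=
  (memLp_grad u).norm.mul' (memLp_of_continuousOn_closure hbdd
    (continuous_id.sub continuous_const).norm.continuousOn ⊤)

theorem integral_lowerMajorant_le_of_bounds
    (hbdd : Bornology.IsBounded (Ω : Set (EuclideanSpace ℝ (Fin n))))
    (hy : y ∉ closure (Ω : Set (EuclideanSpace ℝ (Fin n)))) {u g : H1 Ω} {a b : ℝ}
    (hu : SingularBound y a u) (hg : HardyBound y b g) :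
    ∫ x in Ω, lowerMajorant u g x ≤ 3 * a * b := by
  have hfn : ∫ x in Ω, ‖fn u x‖ ^ 2 ≤ a ^ 2 :=
    (integral_sq_fn u).trans_le (pow_le_pow_left₀ (norm_nonneg _) hu.norm_fn_le 2)
  have hgfn : ∫ x in Ω, ‖fn g x‖ ^ 2 ≤ b ^ 2 := (integral_sq_fn g).trans_le
    (pow_le_pow_left₀ (norm_nonneg _) ((norm_fn_le g).trans hg.norm_le) 2)
  have hggrad : ∫ x in Ω, ‖grad g x‖ ^ 2 ≤ b ^ 2 := (integral_sq_grad g).trans_le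
    (pow_le_pow_left₀ (norm_nonneg _) ((norm_grad_le g).trans hg.norm_le) 2)
  have hcancel : ∫ x in Ω, ‖fn g x‖ * ‖grad u x‖
      = ∫ x in Ω, ‖‖x - y‖ * ‖grad u x‖‖ * ‖‖x - y‖⁻¹ * ‖fn g x‖‖ := by
    refine setIntegral_congr_fun Ω.isOpen.measurableSet fun x hx => ?_
    have : ‖x - y‖ ≠ 0 := norm_ne_zero_iff.2 (sub_ne_zero.2 fun h => hy (h ▸ subset_closure hx))
    simp only [norm_mul, norm_norm, norm_inv]
    field_simp
  have hweighted : ∫ x in Ω, ‖fn g x‖ * ‖grad u x‖ ≤ a * b := by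
    rw [hcancel]
    exact integral_norm_mul_norm_le (memLp_norm_sub_mul hbdd y u) (memLp_inv_norm_sub_mul hy g)
      hu.nonneg hg.nonneg (by simpa using hu.integral_le) (by simpa using hg.integral_le)
  have hfngrad :=
    integral_norm_mul_norm_le (memLp_fn u) (memLp_grad g) hu.nonneg hg.nonneg hfn hggrad
  have hfnfn := integral_norm_mul_norm_le (memLp_fn u) (memLp_fn g) hu.nonneg hg.nonneg hfn hgfn
  rw [integral_lowerMajorant]
  linarith

theorem HardyBound.neg {b : ℝ} {z : H1 Ω} (hz : HardyBound y b z) : HardyBound y b (-z) := by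
  refine ⟨(norm_neg z).trans_le hz.norm_le, le_of_eq_of_le (integral_congr_ae ?_) hz.integral_le⟩
  filter_upwards [Lp.coeFn_neg (fn z)] with x hx
  rw [show fn (-z) x = _ from hx, Pi.neg_apply, norm_neg]

theorem HardyBound.add (hy : y ∉ closure (Ω : Set (EuclideanSpace ℝ (Fin n)))) {b c : ℝ}
    {z w : H1 Ω} (hz : HardyBound y b z) (hw : HardyBound y c w) :
    HardyBound y (b + c) (z + w) := by
  refine ⟨(norm_add_le z w).trans (add_le_add hz.norm_le hw.norm_le), ?_⟩
  have hzm := memLp_inv_norm_sub_mul hy z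
  have hwm := memLp_inv_norm_sub_mul hy w
  have hcross := integral_norm_mul_norm_le hzm hwm hz.nonneg hw.nonneg
    (by simpa using hz.integral_le) (by simpa using hw.integral_le)
  simp only [norm_mul, norm_norm, norm_inv] at hcross
  have hzw : Integrable (fun x => ‖x - y‖⁻¹ * ‖fn z x‖ * (‖x - y‖⁻¹ * ‖fn w x‖)) (vol Ω) :=
    hzm.integrable_mul hwm
  calc ∫ x in Ω, (‖x - y‖⁻¹ * ‖fn (z + w) x‖) ^ 2
      ≤ ∫ x in Ω, ((‖x - y‖⁻¹ * ‖fn z x‖) ^ 2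
        + 2 * (‖x - y‖⁻¹ * ‖fn z x‖ * (‖x - y‖⁻¹ * ‖fn w x‖)) + (‖x - y‖⁻¹ * ‖fn w x‖) ^ 2) := by
        refine integral_mono_of_nonneg (.of_forall fun _ => sq_nonneg _)
          ((hzm.integrable_sq.add (hzw.const_mul 2)).add hwm.integrable_sq) ?_
        filter_upwards [fn_add_ae z w] with x hx
        have hle : ‖fn (z + w) x‖ ≤ ‖fn z x‖ + ‖fn w x‖ := by
          rw [hx]
          exact norm_add_le _ _
        calc (‖x - y‖⁻¹ * ‖fn (z + w) x‖) ^ 2 ≤ (‖x - y‖⁻¹ * (‖fn z x‖ + ‖fn w x‖)) ^ 2 := by gcongr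
          _ = _ := by ring
    _ ≤ b ^ 2 + 2 * (b * c) + c ^ 2 := by
        rw [integral_add ?_ hwm.integrable_sq, integral_add hzm.integrable_sq (hzw.const_mul 2),
          integral_const_mul]
        swap
        · exact hzm.integrable_sq.add (hzw.const_mul 2)
        linarith [hz.integral_le, hw.integral_le]
    _ = (b + c) ^ 2 := by ring

theorem hardyBound_of_mem_H10 (hn : 3 ≤ n) (hy : y ∉ closure (Ω : Set (EuclideanSpace ℝ (Fin n))))
    {w : H1 Ω} (hw : w ∈ H10 Ω) : HardyBound y (2 * ‖w‖) w := by
  refine ⟨by linarith [norm_nonneg w], ?_⟩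
  have hn' : (3 : ℝ) ≤ n := by exact_mod_cast hn
  have hI : 0 ≤ ∫ x in Ω, (‖x - y‖⁻¹ * ‖fn w x‖) ^ 2 := integral_nonneg fun _ => sq_nonneg _
  calc ∫ x in Ω, (‖x - y‖⁻¹ * ‖fn w x‖) ^ 2
      ≤ (n - 2 : ℝ) ^ 2 * ∫ x in Ω, (‖x - y‖⁻¹ * ‖fn w x‖) ^ 2 :=
        le_mul_of_one_le_left hI (one_le_pow₀ (by linarith))
    _ ≤ 4 * ‖grad w‖ ^ 2 := hardy_H10 hy hw
    _ ≤ 4 * ‖w‖ ^ 2 := by gcongr; exact norm_grad_le w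
    _ = (2 * ‖w‖) ^ 2 := by ring

theorem hardyBound_of_ae_norm_le (hbdd : Bornology.IsBounded (Ω : Set (EuclideanSpace ℝ (Fin n))))
    (hy : y ∉ closure (Ω : Set (EuclideanSpace ℝ (Fin n)))) {I c k : ℝ}
    (hI : ∫ x in Ω, ‖x - y‖⁻¹ ^ 2 ≤ I) (hk : 0 ≤ k) {e : H1 Ω} (hec : ‖e‖ ≤ c)
    (he : ∀ᵐ x ∂vol Ω, ‖fn e x‖ ≤ k * c) : HardyBound y ((1 + k * √I) * c) e := by
  have hfin : IsFiniteMeasure (vol Ω) := ⟨by simpa using hbdd.measure_lt_top⟩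
  have hc : 0 ≤ c := (norm_nonneg e).trans hec
  have hI0 : 0 ≤ I := (integral_nonneg fun _ => sq_nonneg _).trans hI
  have hle : k * √I * c ≤ (1 + k * √I) * c := by gcongr; linarith
  refine ⟨hec.trans (le_mul_of_one_le_left hc (le_add_of_nonneg_right (by positivity))), ?_⟩
  have hinv : MemLp (fun x => ‖x - y‖⁻¹) 2 (vol Ω) := by
    simpa using ((memLp_top_inv_norm_sub hy).mono_exponent le_top).norm
  calc ∫ x in Ω, (‖x - y‖⁻¹ * ‖fn e x‖) ^ 2 ≤ ∫ x in Ω, (k * c) ^ 2 * ‖x - y‖⁻¹ ^ 2 := by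
        refine integral_mono_of_nonneg (.of_forall fun _ => sq_nonneg _)
          (hinv.integrable_sq.const_mul _) ?_
        filter_upwards [he] with x hx
        rw [mul_comm, ← mul_pow]
        gcongr
    _ ≤ (k * c) ^ 2 * I := by
        rw [integral_const_mul]
        gcongr
    _ = (k * √I * c) ^ 2 := by
        rw [mul_right_comm, mul_pow _ √I, Real.sq_sqrt hI0]
    _ ≤ ((1 + k * √I) * c) ^ 2 := by gcongr

/-- The class of `u` modulo equality almost everywhere. -/
noncomputable def aeFn (Ω : Opens (EuclideanSpace ℝ (Fin n))) :
    H1 Ω →ₗ[ℂ] EuclideanSpace ℝ (Fin n) →ₘ[vol Ω] ℂ :=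
  (Lp.LpSubmodule ℂ ℂ 2 (vol Ω)).subtype ∘ₗ (fnL Ω).toLinearMap

/-- The bounded functions in `H¹(Ω)`. -/
noncomputable def boundedH1 (Ω : Opens (EuclideanSpace ℝ (Fin n))) : Submodule ℂ (H1 Ω) :=
  (Lp.LpSubmodule ℂ ℂ ⊤ (vol Ω)).comap (aeFn Ω)

theorem ae_norm_le_norm_Lp_top {α : Type*} [MeasurableSpace α] {μ : Measure α} (f : Lp ℂ ⊤ μ) :
    ∀ᵐ x ∂μ, ‖f x‖ ≤ ‖f‖ := by
  filter_upwards [ae_le_eLpNormEssSup (f := f) (μ := μ)] with x hx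
  rw [← eLpNorm_exponent_top] at hx
  simpa [Lp.norm_def] using ENNReal.toReal_mono (Lp.memLp f).2.ne hx

theorem exists_norm_le_of_finiteDimensional {X W : Type*} [NormedAddCommGroup X]
    [NormedSpace ℂ X] [NormedAddCommGroup W] [NormedSpace ℂ W] {E : Submodule ℂ X}
    [FiniteDimensional ℂ E] (Λ : E →ₗ[ℂ] W) :
    ∃ K : ℝ, 0 ≤ K ∧ ∀ e : E, ‖Λ e‖ ≤ K * ‖(e : X)‖ :=
  ⟨‖LinearMap.toContinuousLinearMap Λ‖, ContinuousLinearMap.opNorm_nonneg _,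
    (LinearMap.toContinuousLinearMap Λ).le_opNorm⟩

theorem exists_ae_norm_le_of_finiteDimensional {E : Submodule ℂ (H1 Ω)} [FiniteDimensional ℂ E]
    (hE : E ≤ boundedH1 Ω) :
    ∃ K : ℝ, 0 ≤ K ∧ ∀ e ∈ E, ∀ᵐ x ∂vol Ω, ‖fn e x‖ ≤ K * ‖e‖ := by
  let Λ : E →ₗ[ℂ] Lp ℂ ⊤ (vol Ω) :=
    ((aeFn Ω).domRestrict E).codRestrict (Lp.LpSubmodule ℂ ℂ ⊤ (vol Ω)) fun e => hE e.2
  obtain ⟨K, hK, hΛ⟩ := exists_norm_le_of_finiteDimensional (X := H1 Ω) (E := E) Λ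
  refine ⟨K, hK, fun e he => ?_⟩
  filter_upwards [ae_norm_le_norm_Lp_top (Λ ⟨e, he⟩)] with x hx
  exact hx.trans (hΛ ⟨e, he⟩)

theorem IsWeaklyHarmonic.inner_flux_eq {A : EuclideanSpace ℝ (Fin n) → EuclideanSpace ℂ (Fin n)}
    {q : EuclideanSpace ℝ (Fin n) → ℂ} (hA : MemLp A ⊤ (vol Ω)) (hq : MemLp q ⊤ (vol Ω))
    {u : H1 Ω} (hu : IsWeaklyHarmonic u) {w : H1 Ω} (hw : w ∈ H10 Ω) :
    ⟪(w : L2Pair Ω), flux hA hq u⟫_ℂ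
      = ⟪(w : L2Pair Ω), lowerFlux hA (memLp_top_dot_add hA hq) u⟫_ℂ := by
  have hgrad : ⟪(w : L2Pair Ω), gradFlux Ω u⟫_ℂ = 0 :=
    inner_eq_zero_of_mem_H10 (fun φ => (pairing_gradFlux u _).trans (hu φ)) hw
  rw [flux, add_apply, inner_add_right, hgrad, zero_add]

theorem exists_norm_residual_le_of_harmonic (hn : 3 ≤ n)
    (hbdd : Bornology.IsBounded (Ω : Set (EuclideanSpace ℝ (Fin n))))
    {A : EuclideanSpace ℝ (Fin n) → EuclideanSpace ℂ (Fin n)} {q : EuclideanSpace ℝ (Fin n) → ℂ}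
    (hA : MemLp A ⊤ (vol Ω)) (hq : MemLp q ⊤ (vol Ω)) :
    ∃ K : ℝ, 0 ≤ K ∧ ∀ y ∉ closure (Ω : Set (EuclideanSpace ℝ (Fin n))), ∀ u : H1 Ω,
      IsWeaklyHarmonic u → ∀ a, SingularBound y a u → ‖residual hA hq u‖ ≤ K * a := by
  obtain ⟨K, hK, hlower⟩ := exists_norm_inner_lowerFlux_le hA (memLp_top_dot_add hA hq)
  refine ⟨6 * K, by positivity, fun y hy u hu a hua => ?_⟩
  have ha := hua.nonneg
  refine norm_residual_le hA hq (by positivity) fun w hw => ?_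
  calc ‖⟪(w : L2Pair Ω), flux hA hq u⟫_ℂ‖ ≤ K * ∫ x in Ω, lowerMajorant u w x := by
        rw [hu.inner_flux_eq hA hq hw]
        exact hlower u w
    _ ≤ K * (3 * a * (2 * ‖w‖)) := by
        gcongr
        exact integral_lowerMajorant_le_of_bounds hbdd hy hua (hardyBound_of_mem_H10 hn hy hw)
    _ = 6 * K * a * ‖w‖ := by ring

theorem exists_solution_of_harmonic (hn : 3 ≤ n)
    (hbdd : Bornology.IsBounded (Ω : Set (EuclideanSpace ℝ (Fin n))))
    {A : EuclideanSpace ℝ (Fin n) → EuclideanSpace ℂ (Fin n)} {q : EuclideanSpace ℝ (Fin n) → ℂ}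
    (hA : MemLp A ⊤ (vol Ω)) (hq : MemLp q ⊤ (vol Ω)) (I : ℝ) :
    ∃ C : ℝ, 0 ≤ C ∧ ∀ y ∉ closure (Ω : Set (EuclideanSpace ℝ (Fin n))),
      ∫ x in Ω, ‖x - y‖⁻¹ ^ 2 ≤ I → ∀ u ∈ boundedH1 Ω, IsWeaklyHarmonic u →
        ∀ a, SingularBound y a u → ∃ z, IsSolution Ω A q (u + z) ∧ HardyBound y (C * a) z := by
  obtain ⟨E, hE, _, C, hC, hcorr⟩ := exists_solution_correction hbdd hA hq (boundedH1 Ω)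
  obtain ⟨k, hk, hbound⟩ := exists_ae_norm_le_of_finiteDimensional hE
  obtain ⟨K, hK, hres⟩ := exists_norm_residual_le_of_harmonic hn hbdd hA hq
  refine ⟨(3 + k * √I) * (C * K), by positivity, fun y hy hyI u hu hharm a hua => ?_⟩
  obtain ⟨w, hw, e, he, hsol, hwC, heC⟩ := hcorr u hu
  have hresC : C * ‖residual hA hq u‖ ≤ C * (K * a) := by
    gcongr
    exact hres y hy u hharm a hua
  have hw' : HardyBound y (2 * (C * (K * a))) w :=
    (hardyBound_of_mem_H10 hn hy hw).mono (by linarith)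
  have he' : HardyBound y ((1 + k * √I) * (C * (K * a))) e := by
    refine hardyBound_of_ae_norm_le hbdd hy hyI hk (heC.trans hresC) ?_
    filter_upwards [hbound e he] with x hx
    exact hx.trans (by gcongr; exact heC.trans hresC)
  refine ⟨-(w + e), by rwa [← sub_eq_add_neg], ?_⟩
  convert (hw'.add hy he').neg using 1
  ring

end SingularPart

/-! ### Blow-up at a boundary point -/

section Geometry

open Filter Topology

variable {s : Set (EuclideanSpace ℝ (Fin n))} {x₀ ν : EuclideanSpace ℝ (Fin n)}

/-- `ν` is the inner unit normal of `s` at `x₀`, in the sense that `s` agrees near `x₀` with the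
half space `⟪x - x₀, ν⟫ > 0` up to `o(‖x - x₀‖)`. -/
structure IsInnerNormal (s : Set (EuclideanSpace ℝ (Fin n))) (x₀ ν : EuclideanSpace ℝ (Fin n)) :
    Prop where
  norm_eq : ‖ν‖ = 1
  eventually_mem_imp : ∀ η : ℝ, 0 < η → ∀ᶠ x in 𝓝 x₀, x ∈ s → -(η * ‖x - x₀‖) ≤ ⟪x - x₀, ν⟫_ℝ
  eventually_notMem_imp : ∀ η : ℝ, 0 < η → ∀ᶠ x in 𝓝 x₀, x ∉ s → ⟪x - x₀, ν⟫_ℝ ≤ η * ‖x - x₀‖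

/-- The open half space with inner normal `ν`. -/
def halfSpace (ν : EuclideanSpace ℝ (Fin n)) : Set (EuclideanSpace ℝ (Fin n)) :=
  {z | 0 < ⟪z, ν⟫_ℝ}

theorem IsLocalDefiningFunction.exists_fderiv_eq_inner
    {ρ : EuclideanSpace ℝ (Fin n) → ℝ} (hρ : IsLocalDefiningFunction s x₀ ρ)
    (hx₀ : x₀ ∈ frontier s) :
    ∃ N, (∀ v, fderiv ℝ ρ x₀ v = ⟪v, N⟫_ℝ) ∧ IsInnerNormal s x₀ (‖N‖⁻¹ • N) := by
  obtain ⟨U, hU, hxU, hρU, hs, hfr, hne⟩ := hρ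
  set N := (InnerProductSpace.toDual ℝ _).symm (fderiv ℝ ρ x₀) with hN
  have hinner (v) : fderiv ℝ ρ x₀ v = ⟪v, N⟫_ℝ := by
    rw [real_inner_comm]
    exact InnerProductSpace.toDual_symm_apply.symm
  have hN0 : N ≠ 0 := by simpa [hN] using hne
  have hpos : 0 < ‖N‖ := norm_pos_iff.2 hN0
  have hρ0 : ρ x₀ = 0 := (hfr x₀ hxU).1 hx₀
  have htaylor (η : ℝ) (hη : 0 < η) :
      ∀ᶠ x in 𝓝 x₀, x ∈ U ∧ |ρ x - ‖N‖ * ⟪x - x₀, ‖N‖⁻¹ • N⟫_ℝ| ≤ ‖N‖ * (η * ‖x - x₀‖) := by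
    have hd : HasFDerivAt ρ (fderiv ℝ ρ x₀) x₀ :=
      ((hρU.contDiffAt (hU.mem_nhds hxU)).differentiableAt (by simp)).hasFDerivAt
    filter_upwards [hd.isLittleO.bound (c := ‖N‖ * η) (by positivity), hU.mem_nhds hxU]
      with x hx hxU
    refine ⟨hxU, ?_⟩
    rwa [hρ0, sub_zero, hinner, Real.norm_eq_abs, mul_assoc, ← mul_inv_cancel_left₀ hpos.ne'
      ⟪x - x₀, N⟫_ℝ, ← inner_smul_right] at hx
  refine ⟨N, hinner, norm_smul_inv_norm hN0, fun η hη => ?_, fun η hη => ?_⟩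
  · filter_upwards [htaylor η hη] with x ⟨hxU, hx⟩ hxs
    have := (hs x hxU).1 hxs
    refine le_of_mul_le_mul_left ?_ hpos
    linarith [le_of_abs_le hx]
  · filter_upwards [htaylor η hη] with x ⟨hxU, hx⟩ hxs
    have := not_lt.1 (mt (hs x hxU).2 hxs)
    refine le_of_mul_le_mul_left ?_ hpos
    linarith [neg_le_of_abs_le hx]

theorem IsTangentVector.exists_isInnerNormal {τ : EuclideanSpace ℝ (Fin n)}
    (hτ : IsTangentVector s x₀ τ) (hx₀ : x₀ ∈ frontier s) :
    ∃ ν, IsInnerNormal s x₀ ν ∧ ⟪ν, τ⟫_ℝ = 0 := by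
  obtain ⟨ρ, hρ, hρτ⟩ := hτ
  obtain ⟨N, hN, hν⟩ := hρ.exists_fderiv_eq_inner hx₀
  refine ⟨‖N‖⁻¹ • N, hν, ?_⟩
  rw [real_inner_smul_left, real_inner_comm, ← hN, hρτ, mul_zero]

theorem IsInnerNormal.compl (h : IsInnerNormal s x₀ ν) : IsInnerNormal sᶜ x₀ (-ν) := by
  refine ⟨(norm_neg ν).trans h.norm_eq, fun η hη => ?_, fun η hη => ?_⟩
  · filter_upwards [h.eventually_notMem_imp η hη] with x hx hxs
    rw [inner_neg_right]
    exact neg_le_neg (hx hxs)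
  · filter_upwards [h.eventually_mem_imp η hη] with x hx hxs
    rw [inner_neg_right]
    exact neg_le.1 (hx (not_not.1 hxs))

theorem tendsto_add_smul (x₀ z : EuclideanSpace ℝ (Fin n)) :
    Tendsto (fun ε : ℝ => x₀ + ε • z) (𝓝[>] 0) (𝓝 x₀) :=
  ((by fun_prop : Continuous fun ε : ℝ => x₀ + ε • z).tendsto' 0 x₀ (by simp)).mono_left
    nhdsWithin_le_nhds

theorem IsInnerNormal.eventually_mem (h : IsInnerNormal s x₀ ν) {z : EuclideanSpace ℝ (Fin n)}
    (hz : z ∈ halfSpace ν) : ∀ᶠ ε : ℝ in 𝓝[>] 0, x₀ + ε • z ∈ s := by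
  obtain ⟨η, hη, hηz⟩ := exists_pos_mul_lt (show 0 < ⟪z, ν⟫_ℝ from hz) ‖z‖
  filter_upwards [(tendsto_add_smul x₀ z).eventually (h.eventually_notMem_imp η hη),
    self_mem_nhdsWithin] with ε himp (hε : 0 < ε)
  by_contra hmem
  have hle := himp hmem
  rw [add_sub_cancel_left, real_inner_smul_left, norm_smul, Real.norm_of_nonneg hε.le,
    mul_left_comm] at hle
  linarith [le_of_mul_le_mul_left hle hε]

theorem IsInnerNormal.eventually_notMem (h : IsInnerNormal s x₀ ν)
    {z : EuclideanSpace ℝ (Fin n)} (hz : z ∈ halfSpace (-ν)) :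
    ∀ᶠ ε : ℝ in 𝓝[>] 0, x₀ + ε • z ∉ s :=
  h.compl.eventually_mem hz

theorem half_norm_add_one_le (hν : ‖ν‖ = 1) {z : EuclideanSpace ℝ (Fin n)}
    (hz : -(1 / 2 * ‖z‖) ≤ ⟪z, ν⟫_ℝ) : (‖z‖ + 1) / 2 ≤ ‖z + ν‖ := by
  refine le_of_sq_le_sq ?_ (norm_nonneg _)
  rw [norm_add_sq_real, hν]
  nlinarith [sq_nonneg (‖z‖ - 1)]

theorem IsInnerNormal.eventually_le_norm_add (h : IsInnerNormal s x₀ ν) :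
    ∀ᶠ ε : ℝ in 𝓝[>] 0, ∀ z, x₀ + ε • z ∈ s → (‖z‖ + 1) / 2 ≤ ‖z + ν‖ := by
  obtain ⟨r, hr, hball⟩ :=
    Metric.eventually_nhds_iff_ball.1 (h.eventually_mem_imp (1 / 2) one_half_pos)
  filter_upwards [Ioo_mem_nhdsGT (show 0 < r / 3 by positivity)] with ε ⟨hε, hεr⟩ z hz
  have hnorm : ‖x₀ + ε • z - x₀‖ = ε * ‖z‖ := by
    rw [add_sub_cancel_left, norm_smul, Real.norm_of_nonneg hε.le]
  by_cases hzr : ε * ‖z‖ < r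
  · have hinner := hball _ (by rwa [mem_ball_iff_norm, hnorm]) hz
    rw [hnorm, add_sub_cancel_left, real_inner_smul_left] at hinner
    exact half_norm_add_one_le h.norm_eq (le_of_mul_le_mul_left (by linarith) hε)
  · have hz3 : 3 ≤ ‖z‖ := le_of_mul_le_mul_left (by linarith) hε
    have := norm_sub_le_norm_add z ν
    rw [h.norm_eq] at this
    linarith

theorem IsInnerNormal.eventually_le_norm_sub (h : IsInnerNormal s x₀ ν) :
    ∀ᶠ ε : ℝ in 𝓝[>] 0, ∀ x ∈ s, (‖x - x₀‖ + ε) / 2 ≤ ‖x - (x₀ - ε • ν)‖ := by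
  filter_upwards [h.eventually_le_norm_add, self_mem_nhdsWithin] with ε hle (hε : 0 < ε) x hx
  have hz := hle (ε⁻¹ • (x - x₀)) (by rwa [smul_inv_smul₀ hε.ne', add_sub_cancel])
  have hsub : x - (x₀ - ε • ν) = ε • (ε⁻¹ • (x - x₀) + ν) := by
    rw [smul_add, smul_inv_smul₀ hε.ne']
    abel
  rw [hsub, norm_smul, Real.norm_of_nonneg hε.le]
  calc (‖x - x₀‖ + ε) / 2 = ε * ((‖ε⁻¹ • (x - x₀)‖ + 1) / 2) := by
        rw [norm_smul, norm_inv, Real.norm_of_nonneg hε.le]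
        field_simp
    _ ≤ _ := by gcongr

theorem notMem_closure_of_forall_le_norm_sub {y : EuclideanSpace ℝ (Fin n)} {d : ℝ} (hd : 0 < d)
    (h : ∀ x ∈ s, d ≤ ‖x - y‖) : y ∉ closure s := by
  intro hy
  obtain ⟨x, hx, hxy⟩ := Metric.mem_closure_iff.1 hy d hd
  rw [dist_comm, dist_eq_norm] at hxy
  exact (h x hx).not_gt hxy

end Geometry

section Blowup

open Filter Topology

/-- The function `|ζ| ^ (2 - 2 * n)`, which is the size of the products of the functions with a
pole and their derivatives. -/
noncomputable def baseKernel (ζ : EuclideanSpace ℝ (Fin n)) : ℝ := ‖ζ‖ ^ 2 * ((‖ζ‖ ^ 2) ^ n)⁻¹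

/-- A kernel that is homogeneous of degree `2 - 2 * n` and continuous away from the origin. -/
structure IsHomogeneousKernel (k : EuclideanSpace ℝ (Fin n) → ℝ) : Prop where
  continuousOn : ContinuousOn k {0}ᶜ
  exists_abs_le : ∃ K, ∀ ζ, |k ζ| ≤ K * baseKernel ζ
  smul_eq : ∀ ε : ℝ, 0 < ε → ∀ ζ, k (ε • ζ) = ε ^ 2 * ((ε ^ 2) ^ n)⁻¹ * k ζ

theorem baseKernel_nonneg (ζ : EuclideanSpace ℝ (Fin n)) : 0 ≤ baseKernel ζ := by
  unfold baseKernel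
  positivity

theorem continuousOn_inv_norm_sq_pow :
    ContinuousOn (fun ζ : EuclideanSpace ℝ (Fin n) => ((‖ζ‖ ^ 2) ^ n)⁻¹) {0}ᶜ :=
  ContinuousOn.inv₀ (by fun_prop) fun _ hζ => pow_ne_zero _ (pow_ne_zero _ (norm_ne_zero_iff.2 hζ))

theorem isHomogeneousKernel_baseKernel :
    IsHomogeneousKernel (baseKernel : EuclideanSpace ℝ (Fin n) → ℝ) where
  continuousOn := ContinuousOn.mul (by fun_prop) continuousOn_inv_norm_sq_pow
  exists_abs_le := ⟨1, fun ζ => by rw [abs_of_nonneg (baseKernel_nonneg ζ), one_mul]⟩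
  smul_eq ε hε ζ := by
    unfold baseKernel
    rw [norm_smul, Real.norm_of_nonneg hε.le, mul_pow, mul_pow, mul_inv]
    ring

namespace IsHomogeneousKernel

variable {k : EuclideanSpace ℝ (Fin n) → ℝ}

theorem measurable (hk : IsHomogeneousKernel k) : Measurable k :=
  measurable_of_continuousOn_compl_singleton 0 hk.continuousOn

theorem continuousOn_sub (hk : IsHomogeneousKernel k) (y : EuclideanSpace ℝ (Fin n)) :
    ContinuousOn (fun x => k (x - y)) {y}ᶜ :=
  hk.continuousOn.comp (by fun_prop) fun _ hx => sub_ne_zero.2 hx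

theorem memLp_sub (hk : IsHomogeneousKernel k)
    (hbdd : Bornology.IsBounded (Ω : Set (EuclideanSpace ℝ (Fin n))))
    {y : EuclideanSpace ℝ (Fin n)} (hy : y ∉ closure (Ω : Set (EuclideanSpace ℝ (Fin n))))
    (p : ℝ≥0∞) : MemLp (fun x => k (x - y)) p (vol Ω) :=
  memLp_of_continuousOn_closure hbdd
    ((hk.continuousOn_sub y).mono (Set.subset_compl_singleton_iff.2 hy)) p

end IsHomogeneousKernel

/-- An integrable majorant, uniform in the unit vector `ν`, of `z ↦ baseKernel (z + ν)` on the
rescaled domains. -/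
noncomputable def kernelMajorant (n : ℕ) (z : EuclideanSpace ℝ (Fin n)) : ℝ :=
  2 ^ (2 * n - 2) * (1 + ‖z‖) ^ (-((2 * n - 2 : ℕ) : ℝ))

theorem kernelMajorant_nonneg (z : EuclideanSpace ℝ (Fin n)) : 0 ≤ kernelMajorant n z := by
  unfold kernelMajorant
  positivity

theorem integrable_kernelMajorant (hn : 3 ≤ n) : Integrable (kernelMajorant n) := by
  refine (integrable_one_add_norm ?_).const_mul _
  rw [finrank_euclideanSpace, Fintype.card_fin]
  exact_mod_cast (by lia : n < 2 * n - 2)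

theorem baseKernel_le_kernelMajorant (hn : 1 ≤ n) {ν z : EuclideanSpace ℝ (Fin n)}
    (h : (‖z‖ + 1) / 2 ≤ ‖z + ν‖) : baseKernel (z + ν) ≤ kernelMajorant n z := by
  have hpos : 0 < ‖z + ν‖ := lt_of_lt_of_le (by positivity) h
  calc baseKernel (z + ν) = (‖z + ν‖ ^ (2 * n - 2))⁻¹ := by
        have hsplit : (‖z + ν‖ ^ 2) ^ n = ‖z + ν‖ ^ 2 * ‖z + ν‖ ^ (2 * n - 2) := by
          rw [← pow_mul, ← pow_add]
          congr 1
          lia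
        rw [baseKernel, hsplit]
        field_simp
    _ ≤ (((‖z‖ + 1) / 2) ^ (2 * n - 2))⁻¹ := by gcongr
    _ = kernelMajorant n z := by
        rw [kernelMajorant, Real.rpow_neg (by positivity), Real.rpow_natCast, div_pow, inv_div,
          div_eq_mul_inv, add_comm]

theorem IsHomogeneousKernel.exists_abs_le_kernelMajorant (hn : 1 ≤ n)
    {k : EuclideanSpace ℝ (Fin n) → ℝ} (hk : IsHomogeneousKernel k) :
    ∃ K, 0 ≤ K ∧ ∀ ν z, (‖z‖ + 1) / 2 ≤ ‖z + ν‖ → |k (z + ν)| ≤ K * kernelMajorant n z := by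
  obtain ⟨K, hK⟩ := hk.exists_abs_le
  refine ⟨|K|, abs_nonneg K, fun ν z h => (hK _).trans ?_⟩
  exact mul_le_mul (le_abs_self K) (baseKernel_le_kernelMajorant hn h) (baseKernel_nonneg _)
    (abs_nonneg K)

theorem isOpen_halfSpace (ν : EuclideanSpace ℝ (Fin n)) : IsOpen (halfSpace ν) :=
  isOpen_lt continuous_const (by fun_prop)

theorem half_norm_add_one_le_of_mem_halfSpace {ν z : EuclideanSpace ℝ (Fin n)} (hν : ‖ν‖ = 1)
    (hz : z ∈ halfSpace ν) : (‖z‖ + 1) / 2 ≤ ‖z + ν‖ :=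
  half_norm_add_one_le hν ((by simp : -(1 / 2 * ‖z‖) ≤ 0).trans (show 0 < ⟪z, ν⟫_ℝ from hz).le)

theorem IsHomogeneousKernel.integrableOn_halfSpace (hn : 3 ≤ n)
    {k : EuclideanSpace ℝ (Fin n) → ℝ} (hk : IsHomogeneousKernel k)
    {ν : EuclideanSpace ℝ (Fin n)} (hν : ‖ν‖ = 1) :
    IntegrableOn (fun z => k (z + ν)) (halfSpace ν) := by
  obtain ⟨K, -, hK⟩ := hk.exists_abs_le_kernelMajorant (by lia)
  refine ((integrable_kernelMajorant hn).const_mul K).integrableOn.mono'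
    (hk.measurable.comp (measurable_add_const ν)).aestronglyMeasurable ?_
  filter_upwards [ae_restrict_mem (isOpen_halfSpace ν).measurableSet] with z hz
  exact hK ν z (half_norm_add_one_le_of_mem_halfSpace hν hz)

theorem quasiMeasurePreserving_add_smul (x₀ : EuclideanSpace ℝ (Fin n)) {ε : ℝ} (hε : ε ≠ 0) :
    Measure.QuasiMeasurePreserving fun z : EuclideanSpace ℝ (Fin n) => x₀ + ε • z := by
  have hsmul : Measure.QuasiMeasurePreserving fun z : EuclideanSpace ℝ (Fin n) => ε • z := by
    refine ⟨measurable_const_smul ε, ?_⟩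
    rw [Measure.map_addHaar_smul volume hε]
    exact Measure.smul_absolutelyContinuous
  exact (measurePreserving_add_left volume x₀).quasiMeasurePreserving.comp hsmul

theorem ae_inner_ne_zero {ν : EuclideanSpace ℝ (Fin n)} (hν : ν ≠ 0) :
    ∀ᵐ z : EuclideanSpace ℝ (Fin n), ⟪z, ν⟫_ℝ ≠ 0 := by
  have hne : (ℝ ∙ ν)ᗮ ≠ ⊤ := by
    rw [Ne, Submodule.orthogonal_eq_top_iff, Submodule.span_singleton_eq_bot]
    exact hν
  refine measure_mono_null (fun z hz => ?_)
    (Measure.addHaar_submodule (volume : Measure (EuclideanSpace ℝ (Fin n))) _ hne)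
  exact Submodule.mem_orthogonal_singleton_iff_inner_left.2 (not_not.1 hz)

theorem IsInnerNormal.tendsto_indicator {X : Type*} [Zero X] [TopologicalSpace X]
    {s : Set (EuclideanSpace ℝ (Fin n))} {x₀ ν z : EuclideanSpace ℝ (Fin n)}
    (hν : IsInnerNormal s x₀ ν) (hz : ⟪z, ν⟫_ℝ ≠ 0)
    {g : EuclideanSpace ℝ (Fin n) → X} {g₀ : X} (hg : Tendsto g (𝓝[s] x₀) (𝓝 g₀)) :
    Tendsto (fun ε : ℝ => s.indicator g (x₀ + ε • z)) (𝓝[>] 0)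
      (𝓝 ((halfSpace ν).indicator (fun _ => g₀) z)) := by
  rcases hz.lt_or_gt with hneg | hpos
  · have hz : z ∈ halfSpace (-ν) := by
      change 0 < ⟪z, -ν⟫_ℝ
      rwa [inner_neg_right, neg_pos]
    rw [Set.indicator_of_notMem (show z ∉ halfSpace ν from hneg.not_gt)]
    refine tendsto_const_nhds.congr' ?_
    filter_upwards [hν.eventually_notMem hz] with ε hε
    rw [Set.indicator_of_notMem hε]
  · rw [Set.indicator_of_mem (show z ∈ halfSpace ν from hpos)]
    refine (hg.comp (tendsto_nhdsWithin_iff.2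
      ⟨tendsto_add_smul x₀ z, hν.eventually_mem hpos⟩)).congr' ?_
    filter_upwards [hν.eventually_mem hpos] with ε hε
    rw [Set.indicator_of_mem hε, Function.comp_apply]

variable {F : Type*} [NormedAddCommGroup F] [NormedSpace ℝ F]

theorem integral_comp_add_smul (f : EuclideanSpace ℝ (Fin n) → F) (x₀ : EuclideanSpace ℝ (Fin n))
    {ε : ℝ} (hε : 0 < ε) : ∫ x, f x = ε ^ n • ∫ z, f (x₀ + ε • z) := by
  have hsmul := Measure.integral_comp_smul (volume : Measure (EuclideanSpace ℝ (Fin n)))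
    (fun x => f (x₀ + x)) ε
  rw [finrank_euclideanSpace, Fintype.card_fin, integral_add_left_eq_self f x₀,
    abs_of_pos (by positivity)] at hsmul
  rw [hsmul, smul_inv_smul₀ (by positivity)]

theorem IsHomogeneousKernel.tendsto_integral_rescaled (hn : 3 ≤ n)
    {k : EuclideanSpace ℝ (Fin n) → ℝ} (hk : IsHomogeneousKernel k)
    {x₀ ν : EuclideanSpace ℝ (Fin n)} (hν : IsInnerNormal (Ω : Set _) x₀ ν)
    {g : EuclideanSpace ℝ (Fin n) → F} (hg : MemLp g ⊤ (vol Ω)) {g₀ : F}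
    (hg₀ : Tendsto g (𝓝[Ω] x₀) (𝓝 g₀)) :
    Tendsto (fun ε : ℝ => ∫ z, k (z + ν) • (Ω : Set _).indicator g (x₀ + ε • z)) (𝓝[>] 0)
      (𝓝 (∫ z, k (z + ν) • (halfSpace ν).indicator (fun _ => g₀) z)) := by
  obtain ⟨G, hG, hgG⟩ := exists_ae_norm_le hg
  obtain ⟨K, hK, hkK⟩ := hk.exists_abs_le_kernelMajorant (by lia)
  have hkν : AEStronglyMeasurable fun z => k (z + ν) :=
    (hk.measurable.comp (measurable_add_const ν)).aestronglyMeasurable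
  have hν0 : ν ≠ 0 := norm_ne_zero_iff.1 (by simp [hν.norm_eq])
  refine tendsto_integral_filter_of_dominated_convergence (fun z => K * kernelMajorant n z * G)
    ?_ ?_ (((integrable_kernelMajorant hn).const_mul K).mul_const G) ?_
  · filter_upwards [self_mem_nhdsWithin] with ε (hε : 0 < ε)
    exact hkν.smul (((aestronglyMeasurable_indicator_iff Ω.isOpen.measurableSet).2
      hg.1).comp_quasiMeasurePreserving (quasiMeasurePreserving_add_smul x₀ hε.ne'))
  · filter_upwards [hν.eventually_le_norm_add, self_mem_nhdsWithin] with ε hle (hε : 0 < ε)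
    filter_upwards [(quasiMeasurePreserving_add_smul x₀ hε.ne').ae
      ((ae_restrict_iff' Ω.isOpen.measurableSet).1 hgG)] with z hz
    by_cases hmem : x₀ + ε • z ∈ (Ω : Set (EuclideanSpace ℝ (Fin n)))
    · rw [Set.indicator_of_mem hmem, norm_smul]
      exact mul_le_mul (hkK ν z (hle z hmem)) (hz hmem) (norm_nonneg _)
        (mul_nonneg hK (kernelMajorant_nonneg z))
    · rw [Set.indicator_of_notMem hmem, smul_zero, norm_zero]
      exact mul_nonneg (mul_nonneg hK (kernelMajorant_nonneg z)) hG
  · filter_upwards [ae_inner_ne_zero hν0] with z hz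
    exact (hν.tendsto_indicator hz hg₀).const_smul _

theorem pow_mul_pow_mul_eq_one (hn : 2 ≤ n) {ε : ℝ} (hε : ε ≠ 0) :
    ε ^ (n - 2) * ε ^ n * (ε ^ 2 * ((ε ^ 2) ^ n)⁻¹) = 1 := by
  obtain ⟨m, rfl⟩ := Nat.exists_eq_add_of_le' hn
  rw [Nat.add_sub_cancel]
  field_simp
  ring

theorem IsHomogeneousKernel.pow_smul_setIntegral_eq (hn : 2 ≤ n)
    {k : EuclideanSpace ℝ (Fin n) → ℝ} (hk : IsHomogeneousKernel k)
    (x₀ ν : EuclideanSpace ℝ (Fin n)) (g : EuclideanSpace ℝ (Fin n) → F) {ε : ℝ} (hε : 0 < ε) :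
    ε ^ (n - 2) • ∫ x in Ω, k (x - (x₀ - ε • ν)) • g x
      = ∫ z, k (z + ν) • (Ω : Set _).indicator g (x₀ + ε • z) := by
  have hrescale (z : EuclideanSpace ℝ (Fin n)) : (Ω : Set (EuclideanSpace ℝ (Fin n))).indicator
      (fun x => k (x - (x₀ - ε • ν)) • g x) (x₀ + ε • z)
        = (ε ^ 2 * ((ε ^ 2) ^ n)⁻¹) • k (z + ν) • (Ω : Set _).indicator g (x₀ + ε • z) := by
    rw [Set.indicator_smul_apply, smul_smul, ← hk.smul_eq ε hε]
    congr 3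
    module
  rw [← integral_indicator Ω.isOpen.measurableSet, integral_comp_add_smul _ x₀ hε]
  simp only [hrescale]
  rw [integral_smul, smul_smul, smul_smul, pow_mul_pow_mul_eq_one hn hε.ne', one_smul]

theorem IsHomogeneousKernel.tendsto_pow_smul_setIntegral [CompleteSpace F] (hn : 3 ≤ n)
    {k : EuclideanSpace ℝ (Fin n) → ℝ} (hk : IsHomogeneousKernel k)
    {x₀ ν : EuclideanSpace ℝ (Fin n)} (hν : IsInnerNormal (Ω : Set _) x₀ ν)
    {g : EuclideanSpace ℝ (Fin n) → F} (hg : MemLp g ⊤ (vol Ω)) {g₀ : F}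
    (hg₀ : Tendsto g (𝓝[Ω] x₀) (𝓝 g₀)) :
    Tendsto (fun ε : ℝ => ε ^ (n - 2) • ∫ x in Ω, k (x - (x₀ - ε • ν)) • g x) (𝓝[>] 0)
      (𝓝 ((∫ z in halfSpace ν, k (z + ν)) • g₀)) := by
  have hlim : ∫ z, k (z + ν) • (halfSpace ν).indicator (fun _ => g₀) z
      = (∫ z in halfSpace ν, k (z + ν)) • g₀ := by
    simp only [← Set.indicator_smul_apply (halfSpace ν) (fun z => k (z + ν))]
    rw [integral_indicator (isOpen_halfSpace ν).measurableSet, integral_smul_const]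
  rw [← hlim]
  refine (hk.tendsto_integral_rescaled hn hν hg hg₀).congr' ?_
  filter_upwards [self_mem_nhdsWithin] with ε hε
  exact (hk.pow_smul_setIntegral_eq (by lia) x₀ ν g hε).symm

end Blowup

section LimitKernel

/-- The kernel `⟪ζ, a⟫ ⟪ζ, b⟫ |ζ| ^ (-2 * n)`. -/
noncomputable def innerKernel (a b ζ : EuclideanSpace ℝ (Fin n)) : ℝ :=
  ⟪ζ, a⟫_ℝ * ⟪ζ, b⟫_ℝ * ((‖ζ‖ ^ 2) ^ n)⁻¹

/-- The function `U ∂_a V - V ∂_a U` for `U = |ζ| ^ (2 - n)` and `V = ⟪ζ, τ⟫ |ζ| ^ (-n)`. -/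
noncomputable def wronskianKernel (τ a ζ : EuclideanSpace ℝ (Fin n)) : ℝ :=
  ⟪a, τ⟫_ℝ * baseKernel ζ - 2 * innerKernel τ a ζ

theorem IsHomogeneousKernel.const_mul {k : EuclideanSpace ℝ (Fin n) → ℝ}
    (hk : IsHomogeneousKernel k) (c : ℝ) : IsHomogeneousKernel fun ζ => c * k ζ where
  continuousOn := continuousOn_const.mul hk.continuousOn
  exists_abs_le := by
    obtain ⟨K, hK⟩ := hk.exists_abs_le
    refine ⟨|c| * K, fun ζ => ?_⟩
    rw [abs_mul, mul_assoc]
    exact mul_le_mul_of_nonneg_left (hK ζ) (abs_nonneg c)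
  smul_eq ε hε ζ := by rw [hk.smul_eq ε hε, mul_left_comm]

theorem IsHomogeneousKernel.sub {k l : EuclideanSpace ℝ (Fin n) → ℝ}
    (hk : IsHomogeneousKernel k) (hl : IsHomogeneousKernel l) :
    IsHomogeneousKernel fun ζ => k ζ - l ζ where
  continuousOn := hk.continuousOn.sub hl.continuousOn
  exists_abs_le := by
    obtain ⟨K, hK⟩ := hk.exists_abs_le
    obtain ⟨L, hL⟩ := hl.exists_abs_le
    refine ⟨K + L, fun ζ => (abs_sub _ _).trans ?_⟩
    rw [add_mul]
    exact add_le_add (hK ζ) (hL ζ)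
  smul_eq ε hε ζ := by rw [hk.smul_eq ε hε, hl.smul_eq ε hε, mul_sub]

theorem isHomogeneousKernel_innerKernel (a b : EuclideanSpace ℝ (Fin n)) :
    IsHomogeneousKernel (innerKernel a b) where
  continuousOn := ContinuousOn.mul (by fun_prop) continuousOn_inv_norm_sq_pow
  exists_abs_le := by
    refine ⟨‖a‖ * ‖b‖, fun ζ => ?_⟩
    unfold innerKernel baseKernel
    rw [abs_mul, abs_mul, abs_of_nonneg (by positivity : 0 ≤ ((‖ζ‖ ^ 2) ^ n)⁻¹), ← mul_assoc]
    refine mul_le_mul_of_nonneg_right ?_ (by positivity)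
    calc |⟪ζ, a⟫_ℝ| * |⟪ζ, b⟫_ℝ| ≤ (‖ζ‖ * ‖a‖) * (‖ζ‖ * ‖b‖) := by
          gcongr <;> exact abs_real_inner_le_norm _ _
      _ = ‖a‖ * ‖b‖ * ‖ζ‖ ^ 2 := by ring
  smul_eq ε hε ζ := by
    unfold innerKernel
    rw [norm_smul, Real.norm_of_nonneg hε.le, mul_pow, mul_pow, mul_inv, real_inner_smul_left,
      real_inner_smul_left]
    ring

theorem isHomogeneousKernel_wronskianKernel (τ a : EuclideanSpace ℝ (Fin n)) :
    IsHomogeneousKernel (wronskianKernel τ a) :=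
  (isHomogeneousKernel_baseKernel.const_mul _).sub
    ((isHomogeneousKernel_innerKernel τ a).const_mul 2)

variable {ν τ σ : EuclideanSpace ℝ (Fin n)}

theorem integral_halfSpace_comp_linearIsometryEquiv
    (R : EuclideanSpace ℝ (Fin n) ≃ₗᵢ[ℝ] EuclideanSpace ℝ (Fin n)) (hR : R ν = ν)
    (f : EuclideanSpace ℝ (Fin n) → ℝ) :
    ∫ z in halfSpace ν, f (R (z + ν)) = ∫ z in halfSpace ν, f (z + ν) := by
  have hpre : R ⁻¹' halfSpace ν = halfSpace ν := by
    ext z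
    change 0 < ⟪R z, ν⟫_ℝ ↔ 0 < ⟪z, ν⟫_ℝ
    conv_lhs => rw [← hR, LinearIsometryEquiv.inner_map_map]
  have hcov := R.measurePreserving.setIntegral_preimage_emb
    R.toHomeomorph.measurableEmbedding (fun z => f (z + ν)) (halfSpace ν)
  rw [hpre] at hcov
  rw [← hcov]
  simp only [map_add, hR]

theorem innerKernel_map (R : EuclideanSpace ℝ (Fin n) ≃ₗᵢ[ℝ] EuclideanSpace ℝ (Fin n))
    (a b ζ : EuclideanSpace ℝ (Fin n)) : innerKernel (R a) (R b) (R ζ) = innerKernel a b ζ := by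
  simp only [innerKernel, LinearIsometryEquiv.inner_map_map, LinearIsometryEquiv.norm_map]

theorem integral_innerKernel_map (R : EuclideanSpace ℝ (Fin n) ≃ₗᵢ[ℝ] EuclideanSpace ℝ (Fin n))
    (hR : R ν = ν) (a b : EuclideanSpace ℝ (Fin n)) :
    ∫ z in halfSpace ν, innerKernel (R a) (R b) (z + ν)
      = ∫ z in halfSpace ν, innerKernel a b (z + ν) := by
  simp only [← integral_halfSpace_comp_linearIsometryEquiv R hR (innerKernel (R a) (R b)),
    innerKernel_map]

theorem reflection_eq_self_of_inner_eq_zero {a : EuclideanSpace ℝ (Fin n)}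
    (h : ⟪τ, a⟫_ℝ = 0) : (ℝ ∙ τ)ᗮ.reflection a = a :=
  Submodule.reflection_mem_subspace_eq_self (Submodule.mem_orthogonal_singleton_iff_inner_right.2 h)

theorem integral_innerKernel_eq_zero {b : EuclideanSpace ℝ (Fin n)} (hντ : ⟪ν, τ⟫_ℝ = 0)
    (hbτ : ⟪b, τ⟫_ℝ = 0) : ∫ z in halfSpace ν, innerKernel τ b (z + ν) = 0 := by
  have hRν : (ℝ ∙ τ)ᗮ.reflection ν = ν :=
    reflection_eq_self_of_inner_eq_zero (by rwa [real_inner_comm])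
  have hRb : (ℝ ∙ τ)ᗮ.reflection b = b :=
    reflection_eq_self_of_inner_eq_zero (by rwa [real_inner_comm])
  have hodd := integral_innerKernel_map _ hRν τ b
  rw [Submodule.reflection_orthogonalComplement_singleton_eq_neg, hRb] at hodd
  simp only [innerKernel, inner_neg_right, neg_mul, integral_neg] at hodd ⊢
  linarith

theorem integral_innerKernel_self_eq (hτσ : ‖τ‖ = ‖σ‖) (hντ : ⟪ν, τ⟫_ℝ = 0)
    (hνσ : ⟪ν, σ⟫_ℝ = 0) :
    ∫ z in halfSpace ν, innerKernel τ τ (z + ν) = ∫ z in halfSpace ν, innerKernel σ σ (z + ν) := by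
  have hRν : (ℝ ∙ (τ - σ))ᗮ.reflection ν = ν := by
    refine reflection_eq_self_of_inner_eq_zero ?_
    rw [real_inner_comm, inner_sub_right, hντ, hνσ, sub_zero]
  rw [← integral_innerKernel_map _ hRν, Submodule.reflection_sub hτσ]

theorem exists_unit_vector_orthogonal (hn : 3 ≤ n) (ν τ : EuclideanSpace ℝ (Fin n)) :
    ∃ σ : EuclideanSpace ℝ (Fin n), ‖σ‖ = 1 ∧ ⟪ν, σ⟫_ℝ = 0 ∧ ⟪τ, σ⟫_ℝ = 0 := by
  classical
  set S := Submodule.span ℝ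
    (({ν, τ} : Finset (EuclideanSpace ℝ (Fin n))) : Set (EuclideanSpace ℝ (Fin n)))
  have hSle : Module.finrank ℝ S ≤ 2 := (finrank_span_finset_le_card _).trans Finset.card_le_two
  have hSperp : Sᗮ ≠ ⊥ := by
    intro hbot
    have hsum := S.finrank_add_finrank_orthogonal
    rw [hbot, finrank_bot, finrank_euclideanSpace, Fintype.card_fin] at hsum
    lia
  obtain ⟨σ, hσ, hσ0⟩ := Submodule.exists_mem_ne_zero_of_ne_bot hSperp
  have hperp (w : EuclideanSpace ℝ (Fin n)) (hw : w ∈ S) : ⟪w, (‖σ‖⁻¹ : ℝ) • σ⟫_ℝ = 0 := by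
    rw [real_inner_smul_right, (Submodule.mem_orthogonal _ _).1 hσ w hw, mul_zero]
  exact ⟨(‖σ‖⁻¹ : ℝ) • σ, norm_smul_inv_norm hσ0, hperp ν (Submodule.subset_span (by simp)),
    hperp τ (Submodule.subset_span (by simp))⟩

theorem orthonormal_vec_three (hν : ‖ν‖ = 1) (hτ : ‖τ‖ = 1) (hσ : ‖σ‖ = 1) (hντ : ⟪ν, τ⟫_ℝ = 0)
    (hνσ : ⟪ν, σ⟫_ℝ = 0) (hτσ : ⟪τ, σ⟫_ℝ = 0) : Orthonormal ℝ ![ν, τ, σ] := by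
  rw [orthonormal_iff_ite]
  intro i j
  fin_cases i <;> fin_cases j <;>
    simp [hν, hτ, hσ, hντ, hνσ, hτσ, real_inner_comm ν, real_inner_comm τ]

theorem innerKernel_add_lt_baseKernel (ho : Orthonormal ℝ ![ν, τ, σ])
    {ζ : EuclideanSpace ℝ (Fin n)} (hζ : ⟪ζ, ν⟫_ℝ ≠ 0) :
    innerKernel τ τ ζ + innerKernel σ σ ζ < baseKernel ζ := by
  have hbessel : ⟪ζ, ν⟫_ℝ ^ 2 + ⟪ζ, τ⟫_ℝ ^ 2 + ⟪ζ, σ⟫_ℝ ^ 2 ≤ ‖ζ‖ ^ 2 := by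
    simpa [Fin.sum_univ_three, real_inner_comm ζ] using
      ho.sum_inner_products_le (x := ζ) (s := Finset.univ)
  have hζ0 : 0 < ‖ζ‖ := norm_pos_iff.2 (by rintro rfl; exact hζ (inner_zero_left ν))
  have hpos : 0 < ⟪ζ, ν⟫_ℝ ^ 2 := by positivity
  unfold innerKernel baseKernel
  rw [← add_mul]
  exact mul_lt_mul_of_pos_right (by linarith) (by positivity)

theorem integral_wronskianKernel (hn : 3 ≤ n) (hν : ‖ν‖ = 1) (τ a : EuclideanSpace ℝ (Fin n)) :
    ∫ z in halfSpace ν, wronskianKernel τ a (z + ν)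
      = ⟪a, τ⟫_ℝ * (∫ z in halfSpace ν, baseKernel (z + ν))
        - 2 * ∫ z in halfSpace ν, innerKernel τ a (z + ν) := by
  simp only [wronskianKernel]
  rw [integral_sub ((isHomogeneousKernel_baseKernel.const_mul _).integrableOn_halfSpace hn hν)
      (((isHomogeneousKernel_innerKernel τ a).const_mul 2).integrableOn_halfSpace hn hν),
    integral_const_mul, integral_const_mul]

theorem setIntegral_lt_setIntegral {X : Type*} [MeasurableSpace X] {μ : Measure X} {s : Set X}
    (hs : MeasurableSet s) (hμs : μ s ≠ 0) {f g : X → ℝ} (hf : IntegrableOn f s μ)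
    (hg : IntegrableOn g s μ) (hfg : ∀ x ∈ s, f x < g x) :
    ∫ x in s, f x ∂μ < ∫ x in s, g x ∂μ := by
  rw [← sub_pos, ← integral_sub hg hf,
    setIntegral_pos_iff_support_of_nonneg_ae (f := fun x => g x - f x) _ (hg.sub hf)]
  · exact (pos_iff_ne_zero.2 hμs).trans_le
      (measure_mono fun x hx => ⟨(sub_pos.2 (hfg x hx)).ne', hx⟩)
  · filter_upwards [ae_restrict_mem hs] with x hx
    exact (sub_pos.2 (hfg x hx)).le

theorem integral_wronskianKernel_self_pos (hn : 3 ≤ n) (hν : ‖ν‖ = 1) (hτ : ‖τ‖ = 1)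
    (hντ : ⟪ν, τ⟫_ℝ = 0) : 0 < ∫ z in halfSpace ν, wronskianKernel τ τ (z + ν) := by
  obtain ⟨σ, hσ, hνσ, hτσ⟩ := exists_unit_vector_orthogonal hn ν τ
  have ho := orthonormal_vec_three hν hτ hσ hντ hνσ hτσ
  have hBi := isHomogeneousKernel_baseKernel.integrableOn_halfSpace hn hν
  have hTi := (isHomogeneousKernel_innerKernel τ τ).integrableOn_halfSpace hn hν
  have hSi := (isHomogeneousKernel_innerKernel σ σ).integrableOn_halfSpace hn hν
  have hlt : ∫ z in halfSpace ν, (innerKernel τ τ (z + ν) + innerKernel σ σ (z + ν))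
      < ∫ z in halfSpace ν, baseKernel (z + ν) := by
    refine setIntegral_lt_setIntegral (isOpen_halfSpace ν).measurableSet
      ((isOpen_halfSpace ν).measure_pos volume ⟨ν, ?_⟩).ne' (hTi.add hSi) hBi fun z hz => ?_
    · change 0 < ⟪ν, ν⟫_ℝ
      rw [real_inner_self_eq_norm_sq, hν]
      norm_num
    · have hz : 0 < ⟪z, ν⟫_ℝ := hz
      refine innerKernel_add_lt_baseKernel ho (ne_of_gt ?_)
      rw [inner_add_left, real_inner_self_eq_norm_sq]
      positivity
  rw [integral_add hTi hSi, ← integral_innerKernel_self_eq (hτ.trans hσ.symm) hντ hνσ] at hlt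
  rw [integral_wronskianKernel hn hν, real_inner_self_eq_norm_sq, hτ]
  linarith

theorem integral_wronskianKernel_eq (hn : 3 ≤ n) (hν : ‖ν‖ = 1) (hτ : ‖τ‖ = 1)
    (hντ : ⟪ν, τ⟫_ℝ = 0) (a : EuclideanSpace ℝ (Fin n)) :
    ∫ z in halfSpace ν, wronskianKernel τ a (z + ν)
      = ⟪a, τ⟫_ℝ * ∫ z in halfSpace ν, wronskianKernel τ τ (z + ν) := by
  set b := a - ⟪a, τ⟫_ℝ • τ with hb
  have hbτ : ⟪b, τ⟫_ℝ = 0 := by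
    rw [hb, inner_sub_left, real_inner_smul_left, real_inner_self_eq_norm_sq, hτ]
    ring
  have hsplit (ζ : EuclideanSpace ℝ (Fin n)) :
      innerKernel τ a ζ = innerKernel τ b ζ + ⟪a, τ⟫_ℝ * innerKernel τ τ ζ := by
    rw [innerKernel, innerKernel, innerKernel, hb, inner_sub_right, real_inner_smul_right]
    ring
  have hinner : ∫ z in halfSpace ν, innerKernel τ a (z + ν)
      = ⟪a, τ⟫_ℝ * ∫ z in halfSpace ν, innerKernel τ τ (z + ν) := by
    simp only [hsplit]
    rw [integral_add ((isHomogeneousKernel_innerKernel τ b).integrableOn_halfSpace hn hν)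
        (((isHomogeneousKernel_innerKernel τ τ).const_mul _).integrableOn_halfSpace hn hν),
      integral_innerKernel_eq_zero hντ hbτ, integral_const_mul, zero_add]
  rw [integral_wronskianKernel hn hν, integral_wronskianKernel hn hν, hinner,
    real_inner_self_eq_norm_sq, hτ]
  ring

end LimitKernel

/-! ### Consequences of equal Cauchy data -/

section EqualCauchyData

variable {A A₁ A₂ : EuclideanSpace ℝ (Fin n) → EuclideanSpace ℂ (Fin n)}
  {Q q₁ q₂ : EuclideanSpace ℝ (Fin n) → ℂ}

theorem lowerMajorant_comm (u g : H1 Ω) : lowerMajorant u g = lowerMajorant g u := by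
  funext x
  simp only [lowerMajorant]
  ring

theorem lowerForm_sub_lowerForm_zero (hA : MemLp A ⊤ (vol Ω)) (hQ : MemLp Q ⊤ (vol Ω))
    (u g : H1 Ω) :
    lowerForm A Q u g - lowerForm A 0 u g = ∫ x in Ω, Q x * fn u x * fn g x := by
  unfold lowerForm
  rw [← integral_sub (integrable_lowerIntegrand hA hQ u g)
    (integrable_lowerIntegrand hA MemLp.zero u g)]
  refine integral_congr_ae (.of_forall fun x => ?_)
  simp only [lowerIntegrand, Pi.zero_apply]
  ring

theorem exists_norm_lowerForm_zero_le (hA : MemLp A ⊤ (vol Ω)) (hQ : MemLp Q ⊤ (vol Ω)) :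
    ∃ K : ℝ, 0 ≤ K ∧ ∀ u g : H1 Ω,
      ‖lowerForm A 0 u g‖ ≤ ‖lowerForm A Q u g‖ + K * (‖fn u‖ * ‖fn g‖) := by
  obtain ⟨K, hK, hKQ⟩ := exists_ae_norm_le hQ
  refine ⟨K, hK, fun u g => ?_⟩
  have hpot : ‖∫ x in Ω, Q x * fn u x * fn g x‖ ≤ K * (‖fn u‖ * ‖fn g‖) :=
    calc ‖∫ x in Ω, Q x * fn u x * fn g x‖ ≤ ∫ x in Ω, K * (‖fn u x‖ * ‖fn g x‖) := by
          refine norm_integral_le_of_norm_le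
            (((memLp_fn u).norm.integrable_mul (memLp_fn g).norm).const_mul K) ?_
          filter_upwards [hKQ] with x hx
          rw [norm_mul, norm_mul, mul_assoc]
          gcongr
      _ ≤ K * (‖fn u‖ * ‖fn g‖) := by
          rw [integral_const_mul]
          gcongr
          exact integral_norm_mul_norm_le (memLp_fn u) (memLp_fn g) (norm_nonneg _) (norm_nonneg _)
            (integral_sq_fn u).le (integral_sq_fn g).le
  rw [← sub_sub_cancel (lowerForm A Q u g) (lowerForm A 0 u g),
    lowerForm_sub_lowerForm_zero hA hQ]
  exact (norm_sub_le _ _).trans (by gcongr)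

theorem lowerForm_add_add (hA : MemLp A ⊤ (vol Ω)) (hQ : MemLp Q ⊤ (vol Ω)) (u z v w : H1 Ω) :
    lowerForm A Q (u + z) (v + w)
      = lowerForm A Q u v + lowerForm A Q u w + (lowerForm A Q z v + lowerForm A Q z w) := by
  simp only [← pairing_lowerFlux hA hQ, map_add, add_apply, Submodule.coe_add]
  exact add_add_add_comm _ _ _ _

theorem exists_norm_lowerForm_le_of_eq_zero
    (hbdd : Bornology.IsBounded (Ω : Set (EuclideanSpace ℝ (Fin n))))
    (hA : MemLp A ⊤ (vol Ω)) (hQ : MemLp Q ⊤ (vol Ω)) :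
    ∃ k : ℝ, 0 ≤ k ∧ ∀ y ∉ closure (Ω : Set (EuclideanSpace ℝ (Fin n))),
      ∀ (u v z w : H1 Ω) (a b c d : ℝ), SingularBound y a u → SingularBound y b v →
        HardyBound y c z → HardyBound y d w → lowerForm A Q (u + z) (v + w) = 0 →
          ‖lowerForm A Q u v‖ ≤ k * (3 * a * d + 3 * b * c + 3 * c * d) := by
  obtain ⟨k, hk, hle⟩ := exists_norm_lowerForm_le hA hQ
  refine ⟨k, hk, fun y hy u v z w a b c d hu hv hz hw h0 => ?_⟩
  have huw : ‖lowerForm A Q u w‖ ≤ k * (3 * a * d) := (hle u w).trans <| by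
    gcongr
    exact integral_lowerMajorant_le_of_bounds hbdd hy hu hw
  have hzv : ‖lowerForm A Q z v‖ ≤ k * (3 * b * c) := (hle z v).trans <| by
    rw [lowerMajorant_comm]
    gcongr
    exact integral_lowerMajorant_le_of_bounds hbdd hy hv hz
  have hzw : ‖lowerForm A Q z w‖ ≤ k * (3 * c * d) := (hle z w).trans <| by
    gcongr
    have hc := hz.nonneg
    have hd := hw.nonneg
    calc ∫ x in Ω, lowerMajorant z w x
        ≤ ‖fn z‖ * ‖grad w‖ + ‖fn w‖ * ‖grad z‖ + ‖fn z‖ * ‖fn w‖ := integral_lowerMajorant_le z w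
      _ ≤ c * d + d * c + c * d := by
          gcongr
          exacts [(norm_fn_le z).trans hz.norm_le, (norm_grad_le w).trans hw.norm_le,
            (norm_fn_le w).trans hw.norm_le, (norm_grad_le z).trans hz.norm_le,
            (norm_fn_le z).trans hz.norm_le, (norm_fn_le w).trans hw.norm_le]
      _ = 3 * c * d := by ring
  rw [lowerForm_add_add hA hQ] at h0
  calc ‖lowerForm A Q u v‖
      = ‖lowerForm A Q u w + lowerForm A Q z v + lowerForm A Q z w‖ := by
        rw [← norm_neg]
        congr 1
        linear_combination -h0
    _ ≤ k * (3 * a * d) + k * (3 * b * c) + k * (3 * c * d) := norm_add₃_le.trans (by gcongr)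
    _ = k * (3 * a * d + 3 * b * c + 3 * c * d) := by ring

theorem exists_norm_lowerForm_harmonic_le (hn : 3 ≤ n)
    (hbdd : Bornology.IsBounded (Ω : Set (EuclideanSpace ℝ (Fin n))))
    (hA₁ : MemLp A₁ ⊤ (vol Ω)) (hq₁ : MemLp q₁ ⊤ (vol Ω))
    (hA₂ : MemLp A₂ ⊤ (vol Ω)) (hq₂ : MemLp q₂ ⊤ (vol Ω))
    (hC : cauchyData Ω A₁ q₁ = cauchyData Ω A₂ q₂) (I : ℝ) :
    ∃ K : ℝ, 0 ≤ K ∧ ∀ y ∉ closure (Ω : Set (EuclideanSpace ℝ (Fin n))),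
      ∫ x in Ω, ‖x - y‖⁻¹ ^ 2 ≤ I → ∀ u ∈ boundedH1 Ω, ∀ v ∈ boundedH1 Ω,
        IsWeaklyHarmonic u → IsWeaklyHarmonic v → ∀ a b, SingularBound y a u →
          SingularBound y b v → ‖lowerForm (A₁ - A₂) 0 u v‖ ≤ K * (a * b) := by
  obtain ⟨C₁, hC₁, hsol₁⟩ := exists_solution_of_harmonic hn hbdd hA₁ hq₁ I
  obtain ⟨C₂, hC₂, hsol₂⟩ := exists_solution_of_harmonic hn hbdd hA₂.neg hq₂ I
  have hQ := (memLp_top_dot_add hA₁ hq₁).sub (memLp_top_dot_add hA₂ hq₂)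
  obtain ⟨k, hk, hpert⟩ := exists_norm_lowerForm_le_of_eq_zero hbdd (hA₁.sub hA₂) hQ
  obtain ⟨K₀, hK₀, hzero⟩ := exists_norm_lowerForm_zero_le (hA₁.sub hA₂) hQ
  refine ⟨k * (3 * C₂ + 3 * C₁ + 3 * C₁ * C₂) + K₀, by positivity,
    fun y hy hyI u hu v hv hharmu hharmv a b hua hvb => ?_⟩
  obtain ⟨z, hz, hzC⟩ := hsol₁ y hy hyI u hu hharmu a hua
  obtain ⟨w, hw, hwC⟩ := hsol₂ y hy hyI v hv hharmv b hvb
  have hform : lowerForm (A₁ - A₂) _ (u + z) (v + w) = 0 :=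
    (magneticForm_sub_magneticForm hA₁ hq₁ hA₂ hq₂ _ _).symm.trans
      (sub_eq_zero.2 (magneticForm_eq_of_cauchyData_eq hA₁ hq₁ hA₂ hq₂ hC hz hw))
  have ha := hua.nonneg
  calc ‖lowerForm (A₁ - A₂) 0 u v‖
      ≤ k * (3 * a * (C₂ * b) + 3 * b * (C₁ * a) + 3 * (C₁ * a) * (C₂ * b)) + K₀ * (a * b) := by
        refine (hzero u v).trans ?_
        gcongr
        exacts [hpert y hy u v z w a b _ _ hua hvb hzC hwC hform, hua.norm_fn_le, hvb.norm_fn_le]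
    _ = (k * (3 * C₂ + 3 * C₁ + 3 * C₁ * C₂) + K₀) * (a * b) := by ring

end EqualCauchyData

/-! ### Harmonic functions with a pole near the boundary -/

section Dipole

theorem integrable_indicator_inv_norm_sq (hn : 3 ≤ n) (R : ℝ) :
    Integrable fun x : EuclideanSpace ℝ (Fin n) =>
      (Set.Iic R).indicator (fun r : ℝ => r⁻¹ ^ 2) ‖x‖ := by
  have : Nonempty (Fin n) := ⟨⟨0, by lia⟩⟩
  rw [integrable_fun_norm_addHaar (volume : Measure (EuclideanSpace ℝ (Fin n)))
    (f := (Set.Iic R).indicator (fun r : ℝ => r⁻¹ ^ 2)), finrank_euclideanSpace, Fintype.card_fin]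
  have hpow : IntegrableOn (fun r : ℝ => r ^ (n - 3)) (Set.Ioc 0 R) :=
    ((continuous_pow (n - 3)).integrableOn_Icc (a := 0) (b := R)).mono_set Set.Ioc_subset_Icc_self
  refine (((integrable_indicator_iff measurableSet_Ioc).2 hpow).integrableOn
    (s := Set.Ioi 0)).congr_fun (fun r (hr : 0 < r) => ?_) measurableSet_Ioi
  by_cases hrR : r ≤ R
  · rw [Set.indicator_of_mem (show r ∈ Set.Ioc 0 R from ⟨hr, hrR⟩),
      Set.indicator_of_mem (show r ∈ Set.Iic R from hrR), smul_eq_mul,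
      show n - 1 = n - 3 + 2 by lia, pow_add]
    field_simp
  · rw [Set.indicator_of_notMem (fun h => hrR h.2), Set.indicator_of_notMem (by exact hrR),
      smul_zero]

theorem exists_integral_inv_norm_sub_sq_le (hn : 3 ≤ n)
    (hbdd : Bornology.IsBounded (Ω : Set (EuclideanSpace ℝ (Fin n))))
    {x₀ : EuclideanSpace ℝ (Fin n)} (hx₀ : x₀ ∉ Ω) :
    ∃ I : ℝ, ∀ y : EuclideanSpace ℝ (Fin n),
      (∀ x ∈ Ω, ‖x - x₀‖ / 2 ≤ ‖x - y‖) → ∫ x in Ω, ‖x - y‖⁻¹ ^ 2 ≤ I := by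
  obtain ⟨R, hR⟩ := hbdd.subset_closedBall x₀
  have hi : IntegrableOn (fun x : EuclideanSpace ℝ (Fin n) => ‖x - x₀‖⁻¹ ^ 2) Ω := by
    refine ((integrable_indicator_inv_norm_sq hn R).comp_sub_right x₀).integrableOn.congr_fun
      (fun x hx => ?_) Ω.isOpen.measurableSet
    exact Set.indicator_of_mem (Set.mem_Iic.2 (mem_closedBall_iff_norm.1 (hR hx))) _
  refine ⟨∫ x in Ω, 4 * ‖x - x₀‖⁻¹ ^ 2, fun y hy => ?_⟩
  refine integral_mono_of_nonneg (.of_forall fun x => by positivity) (hi.const_mul 4) ?_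
  filter_upwards [ae_restrict_mem Ω.isOpen.measurableSet] with x hx
  have hpos : 0 < ‖x - x₀‖ := norm_pos_iff.2 (sub_ne_zero.2 fun h => hx₀ (h ▸ hx))
  calc ‖x - y‖⁻¹ ^ 2 ≤ (‖x - x₀‖ / 2)⁻¹ ^ 2 := by
        gcongr
        exact hy x hx
    _ = 4 * ‖x - x₀‖⁻¹ ^ 2 := by
        rw [inv_div, div_pow, inv_pow]
        ring

/-- The fundamental solution `|x - y|^{2 - n}` of the Laplacian, up to a constant factor. -/
noncomputable abbrev monopole (y : EuclideanSpace ℝ (Fin n)) : EuclideanSpace ℝ (Fin n) → ℂ :=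
  poleFn 1 0 y (1 - (n : ℝ) / 2)

/-- The derivative `⟪x - y, τ⟫ |x - y|^{-n}` of the fundamental solution in the direction `τ`, up
to a constant factor. -/
noncomputable abbrev dipole (τ y : EuclideanSpace ℝ (Fin n)) : EuclideanSpace ℝ (Fin n) → ℂ :=
  poleFn 0 τ y (-(n : ℝ) / 2)

variable {x y τ : EuclideanSpace ℝ (Fin n)}

theorem norm_sub_sq_pos (hx : x ≠ y) : 0 < ‖x - y‖ ^ 2 :=
  (sq_nonneg _).lt_of_ne' (norm_sub_sq_ne_zero hx)

theorem rpow_neg_half_sq {s : ℝ} (hs : 0 ≤ s) : (s ^ (-(n : ℝ) / 2)) ^ 2 = (s ^ n)⁻¹ := by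
  rw [← Real.rpow_mul_natCast hs, ← Real.rpow_natCast s n, ← Real.rpow_neg hs]
  congr 1
  push_cast
  ring

theorem rpow_one_sub_half {s : ℝ} (hs : 0 < s) :
    s ^ (1 - (n : ℝ) / 2) = s * s ^ (-(n : ℝ) / 2) := by
  rw [sub_eq_add_neg, Real.rpow_add hs, Real.rpow_one, neg_div]

theorem one_sub_half_sub_one : 1 - (n : ℝ) / 2 - 1 = -(n : ℝ) / 2 := by ring

theorem norm_sq_monopole (hx : x ≠ y) :
    ‖monopole y x‖ ^ 2 = ‖x - y‖ ^ 2 * baseKernel (x - y) := by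
  rw [monopole, poleFn, Complex.norm_real, Real.norm_eq_abs, sq_abs, inner_zero_right, add_zero,
    one_mul, rpow_one_sub_half (norm_sub_sq_pos hx), mul_pow, rpow_neg_half_sq (sq_nonneg _),
    baseKernel]
  ring

theorem norm_sq_gradient_monopole (hx : x ≠ y) :
    (‖x - y‖ * ‖gradient (monopole y) x‖) ^ 2
      = ((n : ℝ) - 2) ^ 2 * (‖x - y‖ ^ 2 * baseKernel (x - y)) := by
  rw [norm_gradient_poleFn 1 0 hx, poleGrad, smul_zero, zero_add, norm_smul, Real.norm_eq_abs,
    mul_pow, mul_pow, sq_abs, inner_zero_right, add_zero, mul_one, one_sub_half_sub_one, mul_pow,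
    rpow_neg_half_sq (sq_nonneg _), baseKernel]
  ring

theorem norm_sq_dipole_le (τ x y : EuclideanSpace ℝ (Fin n)) :
    ‖dipole τ y x‖ ^ 2 ≤ ‖τ‖ ^ 2 * baseKernel (x - y) := by
  rw [dipole, poleFn, Complex.norm_real, Real.norm_eq_abs, sq_abs, zero_add, mul_pow,
    rpow_neg_half_sq (sq_nonneg _), baseKernel, ← mul_assoc, ← mul_pow, mul_comm ‖τ‖, ← sq_abs]
  gcongr
  exact abs_real_inner_le_norm _ _

theorem norm_poleGrad_dipole_le (hx : x ≠ y) :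
    ‖poleGrad 0 τ y (-(n : ℝ) / 2) x‖ ≤ (n + 1) * ‖τ‖ * (‖x - y‖ ^ 2) ^ (-(n : ℝ) / 2) := by
  have hcoeff : |2 * (-(n : ℝ) / 2)| = n := by
    rw [mul_div_cancel₀ _ two_ne_zero, abs_neg, Nat.abs_cast]
  calc ‖poleGrad 0 τ y (-(n : ℝ) / 2) x‖
      ≤ (‖x - y‖ ^ 2) ^ (-(n : ℝ) / 2) * ‖τ‖
        + n * |⟪x - y, τ⟫_ℝ| * (‖x - y‖ ^ 2) ^ (-(n : ℝ) / 2 - 1) * ‖x - y‖ := by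
        refine (norm_add_le _ _).trans_eq ?_
        rw [norm_smul, norm_smul, Real.norm_of_nonneg (by positivity), zero_add, Real.norm_eq_abs,
          abs_mul, abs_mul, hcoeff, abs_of_nonneg (a := _ ^ (_ - (1 : ℝ))) (by positivity)]
    _ ≤ (‖x - y‖ ^ 2) ^ (-(n : ℝ) / 2) * ‖τ‖
        + n * (‖x - y‖ * ‖τ‖) * (‖x - y‖ ^ 2) ^ (-(n : ℝ) / 2 - 1) * ‖x - y‖ := by
        gcongr
        exact abs_real_inner_le_norm _ _
    _ = (n + 1) * ‖τ‖ * (‖x - y‖ ^ 2) ^ (-(n : ℝ) / 2) := by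
        rw [← sq_mul_rpow_sub_one hx]
        ring

theorem norm_sq_gradient_dipole_le (hx : x ≠ y) :
    (‖x - y‖ * ‖gradient (dipole τ y) x‖) ^ 2 ≤ ((n + 1) * ‖τ‖) ^ 2 * baseKernel (x - y) := by
  calc (‖x - y‖ * ‖gradient (dipole τ y) x‖) ^ 2
      ≤ (‖x - y‖ * ((n + 1) * ‖τ‖ * (‖x - y‖ ^ 2) ^ (-(n : ℝ) / 2))) ^ 2 := by
        gcongr
        rw [norm_gradient_poleFn 0 τ hx]
        exact norm_poleGrad_dipole_le hx
    _ = ((n + 1) * ‖τ‖) ^ 2 * baseKernel (x - y) := by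
        rw [mul_pow, mul_pow, rpow_neg_half_sq (sq_nonneg _), baseKernel]
        ring

theorem gradient_poleFn_apply (α : ℝ) (β : EuclideanSpace ℝ (Fin n)) (m : ℝ) (hx : x ≠ y)
    (j : Fin n) : gradient (poleFn α β y m) x j = (poleGrad α β y m x j : ℂ) :=
  partialDeriv_poleFn α β hx j

theorem monopole_smul_gradient_sub (hx : x ≠ y) (τ : EuclideanSpace ℝ (Fin n)) (j : Fin n) :
    (monopole y x • gradient (dipole τ y) x - dipole τ y x • gradient (monopole y) x) j
      = (wronskianKernel τ (EuclideanSpace.single j 1) (x - y) : ℂ) := by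
  rw [PiLp.sub_apply, PiLp.smul_apply, PiLp.smul_apply, gradient_poleFn_apply 0 τ _ hx,
    gradient_poleFn_apply 1 0 _ hx, smul_eq_mul, smul_eq_mul, monopole, dipole,
    poleFn, poleFn, ← Complex.ofReal_mul, ← Complex.ofReal_mul, ← Complex.ofReal_sub]
  congr 1
  simp only [poleGrad, one_sub_half_sub_one, rpow_one_sub_half (norm_sub_sq_pos hx),
    inner_zero_right, add_zero, zero_add, smul_zero, mul_one, one_mul, PiLp.add_apply,
    PiLp.smul_apply, smul_eq_mul, wronskianKernel, innerKernel, baseKernel,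
    EuclideanSpace.inner_single_left, EuclideanSpace.inner_single_right, map_one, conj_trivial,
    ← rpow_neg_half_sq (n := n) (sq_nonneg ‖x - y‖)]
  linear_combination (-(n : ℝ) * (‖x - y‖ ^ 2) ^ (-(n : ℝ) / 2) * ⟪x - y, τ⟫_ℝ * (x - y) j)
    * sq_mul_rpow_sub_one hx (-(n : ℝ) / 2)

theorem ae_ne_of_notMem_closure (hy : y ∉ closure (Ω : Set (EuclideanSpace ℝ (Fin n)))) :
    ∀ᵐ x ∂vol Ω, x ≠ y := by
  filter_upwards [ae_restrict_mem Ω.isOpen.measurableSet] with x hx hxy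
  exact hy (hxy ▸ subset_closure hx)

theorem exists_isWeaklyHarmonic_poleFn
    (hbdd : Bornology.IsBounded (Ω : Set (EuclideanSpace ℝ (Fin n))))
    (hy : y ∉ closure (Ω : Set (EuclideanSpace ℝ (Fin n)))) {α : ℝ}
    {β : EuclideanSpace ℝ (Fin n)} {m : ℝ}
    (hm : ∀ x, 2 * ⟪x - y, β⟫_ℝ + (n + 2 * (m - 1)) * (α + ⟪x - y, β⟫_ℝ) = 0) :
    ∃ u ∈ boundedH1 Ω, IsWeaklyHarmonic u ∧ fn u =ᵐ[vol Ω] poleFn α β y m ∧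
      grad u =ᵐ[vol Ω] gradient (poleFn α β y m) := by
  have hs : closure (Ω : Set (EuclideanSpace ℝ (Fin n))) ⊆ {y}ᶜ :=
    Set.subset_compl_singleton_iff.2 hy
  have hf := contDiffOn_poleFn α β y m
  obtain ⟨u, hu, hgu⟩ := exists_H1_of_contDiffOn hbdd isOpen_compl_singleton hs hf
  refine ⟨u, ?_, fun φ => ?_, hu, hgu⟩
  · exact Lp.mem_Lp_iff_memLp.2
      ((memLp_of_continuousOn_closure hbdd (hf.continuousOn.mono hs) ⊤).ae_eq hu.symm)
  · refine gradForm_ofTest_eq_zero isOpen_compl_singleton (subset_closure.trans hs)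
      (contDiffOn_partialDeriv_poleFn α β) (fun x hx => ?_) hgu φ
    rw [laplacian_poleFn α β hx, hm, mul_zero, Complex.ofReal_zero]

theorem singularBound_of_ae_le {w : EuclideanSpace ℝ (Fin n) → ℝ} (hw : Integrable w (vol Ω))
    {C a : ℝ} (hC : 0 ≤ C) (ha : 0 ≤ a) (hwa : ∫ x in Ω, w x ≤ a ^ 2) {u : H1 Ω}
    (hfn : ∀ᵐ x ∂vol Ω, ‖fn u x‖ ^ 2 ≤ C ^ 2 * w x)
    (hgrad : ∀ᵐ x ∂vol Ω, (‖x - y‖ * ‖grad u x‖) ^ 2 ≤ C ^ 2 * w x) :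
    SingularBound y (C * a) u := by
  have hle {f : EuclideanSpace ℝ (Fin n) → ℝ} (hf : ∀ᵐ x ∂vol Ω, f x ^ 2 ≤ C ^ 2 * w x) :
      ∫ x in Ω, f x ^ 2 ≤ (C * a) ^ 2 := by
    refine (integral_mono_of_nonneg (.of_forall fun _ => sq_nonneg _) (hw.const_mul _) hf).trans ?_
    rw [integral_const_mul, mul_pow]
    gcongr
  refine ⟨abs_le_of_sq_le_sq' ?_ (by positivity) |>.2, hle hgrad⟩
  exact (integral_sq_fn u).symm.trans_le (hle hfn)

theorem exists_monopole (hn : 1 ≤ n)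
    (hbdd : Bornology.IsBounded (Ω : Set (EuclideanSpace ℝ (Fin n))))
    (hy : y ∉ closure (Ω : Set (EuclideanSpace ℝ (Fin n)))) {a : ℝ} (ha : 0 ≤ a)
    (hint : ∫ x in Ω, ‖x - y‖ ^ 2 * baseKernel (x - y) ≤ a ^ 2) :
    ∃ u ∈ boundedH1 Ω, IsWeaklyHarmonic u ∧ SingularBound y (n * a) u ∧
      fn u =ᵐ[vol Ω] monopole y ∧ grad u =ᵐ[vol Ω] gradient (monopole y) := by
  obtain ⟨u, hub, hharm, hu, hgu⟩ :=
    exists_isWeaklyHarmonic_poleFn hbdd hy (α := 1) (β := 0) (m := 1 - (n : ℝ) / 2) fun x => by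
      rw [inner_zero_right]
      ring
  have hn' : (1 : ℝ) ≤ n := by exact_mod_cast hn
  have hw0 (x : EuclideanSpace ℝ (Fin n)) : 0 ≤ ‖x - y‖ ^ 2 * baseKernel (x - y) :=
    mul_nonneg (sq_nonneg _) (baseKernel_nonneg _)
  have hw : MemLp (fun x => ‖x - y‖ ^ 2 * baseKernel (x - y)) 1 (vol Ω) :=
    (isHomogeneousKernel_baseKernel.memLp_sub hbdd hy 1).mul' <| memLp_of_continuousOn_closure hbdd
      ((continuous_id.sub continuous_const).norm.pow 2).continuousOn ⊤
  refine ⟨u, hub, hharm, singularBound_of_ae_le (memLp_one_iff_integrable.1 hw) n.cast_nonneg ha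
    hint ?_ ?_, hu, hgu⟩
  · filter_upwards [hu, ae_ne_of_notMem_closure hy] with x hx hxy
    rw [hx, norm_sq_monopole hxy]
    exact le_mul_of_one_le_left (hw0 x) (one_le_pow₀ hn')
  · filter_upwards [hgu, ae_ne_of_notMem_closure hy] with x hx hxy
    rw [hx, norm_sq_gradient_monopole hxy]
    exact mul_le_mul_of_nonneg_right (by nlinarith) (hw0 x)

theorem exists_dipole (hbdd : Bornology.IsBounded (Ω : Set (EuclideanSpace ℝ (Fin n))))
    (hy : y ∉ closure (Ω : Set (EuclideanSpace ℝ (Fin n)))) (τ : EuclideanSpace ℝ (Fin n))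
    {b : ℝ} (hb : 0 ≤ b) (hint : ∫ x in Ω, baseKernel (x - y) ≤ b ^ 2) :
    ∃ v ∈ boundedH1 Ω, IsWeaklyHarmonic v ∧ SingularBound y ((n + 1) * ‖τ‖ * b) v ∧
      fn v =ᵐ[vol Ω] dipole τ y ∧ grad v =ᵐ[vol Ω] gradient (dipole τ y) := by
  obtain ⟨v, hvb, hharm, hv, hgv⟩ :=
    exists_isWeaklyHarmonic_poleFn hbdd hy (α := 0) (β := τ) (m := -(n : ℝ) / 2) fun x => by ring
  have hn' : (1 : ℝ) ≤ (n : ℝ) + 1 := le_add_of_nonneg_left n.cast_nonneg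
  have hw := memLp_one_iff_integrable.1 (isHomogeneousKernel_baseKernel.memLp_sub hbdd hy 1)
  refine ⟨v, hvb, hharm, singularBound_of_ae_le hw (by positivity) hb hint ?_ ?_, hv, hgv⟩
  · filter_upwards [hv] with x hx
    rw [hx]
    refine (norm_sq_dipole_le τ x y).trans ?_
    gcongr
    · exact baseKernel_nonneg _
    · exact le_mul_of_one_le_left (norm_nonneg _) hn'
  · filter_upwards [hgv, ae_ne_of_notMem_closure hy] with x hx hxy
    rw [hx]
    exact norm_sq_gradient_dipole_le hxy

theorem lowerForm_monopole_dipole (hy : y ∉ closure (Ω : Set (EuclideanSpace ℝ (Fin n))))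
    (A : EuclideanSpace ℝ (Fin n) → EuclideanSpace ℂ (Fin n)) {u v : H1 Ω}
    (hu : fn u =ᵐ[vol Ω] monopole y) (hgu : grad u =ᵐ[vol Ω] gradient (monopole y))
    (hv : fn v =ᵐ[vol Ω] dipole τ y) (hgv : grad v =ᵐ[vol Ω] gradient (dipole τ y)) :
    lowerForm A 0 u v = Complex.I * ∫ x in Ω,
      ∑ j, wronskianKernel τ (EuclideanSpace.single j 1) (x - y) • A x j := by
  rw [← integral_const_mul]
  refine integral_congr_ae ?_
  filter_upwards [hu, hgu, hv, hgv, ae_ne_of_notMem_closure hy] with x hux hgux hvx hgvx hxy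
  rw [lowerIntegrand, Pi.zero_apply, zero_mul, zero_mul, add_zero, hux, hgux, hvx, hgvx, dot]
  refine congrArg _ (Finset.sum_congr rfl fun j _ => ?_)
  rw [monopole_smul_gradient_sub hxy, mul_comm, Complex.real_smul]

theorem exists_norm_integral_wronskianKernel_le (hn : 3 ≤ n)
    (hbdd : Bornology.IsBounded (Ω : Set (EuclideanSpace ℝ (Fin n))))
    {A₁ A₂ : EuclideanSpace ℝ (Fin n) → EuclideanSpace ℂ (Fin n)}
    {q₁ q₂ : EuclideanSpace ℝ (Fin n) → ℂ}
    (hA₁ : MemLp A₁ ⊤ (vol Ω)) (hq₁ : MemLp q₁ ⊤ (vol Ω))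
    (hA₂ : MemLp A₂ ⊤ (vol Ω)) (hq₂ : MemLp q₂ ⊤ (vol Ω))
    (hC : cauchyData Ω A₁ q₁ = cauchyData Ω A₂ q₂) {x₀ : EuclideanSpace ℝ (Fin n)} (hx₀ : x₀ ∉ Ω)
    (τ : EuclideanSpace ℝ (Fin n)) :
    ∃ K : ℝ, ∀ y ∉ closure (Ω : Set (EuclideanSpace ℝ (Fin n))),
      (∀ x ∈ Ω, ‖x - x₀‖ / 2 ≤ ‖x - y‖) →
        ‖∫ x in Ω, ∑ j, wronskianKernel τ (EuclideanSpace.single j 1) (x - y) • (A₁ - A₂) x j‖ ^ 2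
          ≤ K * ((∫ x in Ω, ‖x - y‖ ^ 2 * baseKernel (x - y)) * ∫ x in Ω, baseKernel (x - y)) := by
  obtain ⟨I, hI⟩ := exists_integral_inv_norm_sub_sq_le hn hbdd hx₀
  obtain ⟨K, -, hmain⟩ := exists_norm_lowerForm_harmonic_le hn hbdd hA₁ hq₁ hA₂ hq₂ hC I
  refine ⟨(K * (n * ((n + 1) * ‖τ‖))) ^ 2, fun y hy hyx₀ => ?_⟩
  have ha : 0 ≤ ∫ x in Ω, ‖x - y‖ ^ 2 * baseKernel (x - y) :=
    integral_nonneg fun _ => mul_nonneg (sq_nonneg _) (baseKernel_nonneg _)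
  have hb : 0 ≤ ∫ x in Ω, baseKernel (x - y) := integral_nonneg fun _ => baseKernel_nonneg _
  obtain ⟨u, hu, hharmu, hubd, hufn, hugrad⟩ :=
    exists_monopole (by lia) hbdd hy (Real.sqrt_nonneg _) (Real.sq_sqrt ha).ge
  obtain ⟨v, hv, hharmv, hvbd, hvfn, hvgrad⟩ :=
    exists_dipole hbdd hy τ (Real.sqrt_nonneg _) (Real.sq_sqrt hb).ge
  have hle := hmain y hy (hI y hyx₀) u hu v hv hharmu hharmv _ _ hubd hvbd
  rw [lowerForm_monopole_dipole hy _ hufn hugrad hvfn hvgrad, norm_mul, Complex.norm_I,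
    one_mul] at hle
  refine (pow_le_pow_left₀ (norm_nonneg _) hle 2).trans_eq ?_
  simp only [mul_pow, Real.sq_sqrt ha, Real.sq_sqrt hb]
  ring

end Dipole

section BoundaryDetermination

open Filter Topology

variable {x₀ ν τ : EuclideanSpace ℝ (Fin n)}

theorem IsInnerNormal.eventually_notMem_closure {s : Set (EuclideanSpace ℝ (Fin n))}
    (hν : IsInnerNormal s x₀ ν) : ∀ᶠ ε : ℝ in 𝓝[>] 0, x₀ - ε • ν ∉ closure s := by
  filter_upwards [hν.eventually_le_norm_sub, self_mem_nhdsWithin] with ε hle (hε : 0 < ε)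
  refine notMem_closure_of_forall_le_norm_sub (half_pos hε) fun x hx => le_trans ?_ (hle x hx)
  linarith [norm_nonneg (x - x₀)]

theorem tendsto_pow_smul_integral_wronskianKernel (hn : 3 ≤ n)
    (hbdd : Bornology.IsBounded (Ω : Set (EuclideanSpace ℝ (Fin n))))
    (hν : IsInnerNormal (Ω : Set _) x₀ ν) (hτ : ‖τ‖ = 1) (hντ : ⟪ν, τ⟫_ℝ = 0)
    {W : EuclideanSpace ℝ (Fin n) → EuclideanSpace ℂ (Fin n)} (hW : MemLp W ⊤ (vol Ω))
    (hW₀ : ContinuousWithinAt W Ω x₀) :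
    Tendsto (fun ε : ℝ => ε ^ (n - 2) • ∫ x in Ω,
        ∑ j, wronskianKernel τ (EuclideanSpace.single j 1) (x - (x₀ - ε • ν)) • W x j) (𝓝[>] 0)
      (𝓝 ((∫ z in halfSpace ν, wronskianKernel τ τ (z + ν)) • ∑ j, (τ j : ℂ) * W x₀ j)) := by
  have hWj (j : Fin n) : MemLp (fun x => W x j) ⊤ (vol Ω) :=
    (EuclideanSpace.proj (𝕜 := ℂ) j).comp_memLp' hW
  have hk (j : Fin n) := isHomogeneousKernel_wronskianKernel τ (EuclideanSpace.single j 1)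
  have hlim (j : Fin n) := (hk j).tendsto_pow_smul_setIntegral hn hν (hWj j)
    (((EuclideanSpace.proj (𝕜 := ℂ) j).continuous.tendsto _).comp hW₀)
  have hconst : (∫ z in halfSpace ν, wronskianKernel τ τ (z + ν)) • ∑ j, (τ j : ℂ) * W x₀ j
      = ∑ j, (∫ z in halfSpace ν, wronskianKernel τ (EuclideanSpace.single j 1) (z + ν))
        • EuclideanSpace.proj (𝕜 := ℂ) j (W x₀) := by
    rw [Finset.smul_sum]
    refine Finset.sum_congr rfl fun j _ => ?_
    rw [integral_wronskianKernel_eq hn hν.norm_eq hτ hντ (EuclideanSpace.single j 1),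
      EuclideanSpace.inner_single_left, map_one, one_mul, mul_comm _ (∫ _ in _, _), mul_smul,
      ← Complex.real_smul]
    rfl
  rw [hconst]
  refine (tendsto_finsetSum _ fun j _ => hlim j).congr' ?_
  filter_upwards [hν.eventually_notMem_closure] with ε hy
  rw [← Finset.smul_sum]
  have hint (j : Fin n) : MemLp ((fun x => wronskianKernel τ (EuclideanSpace.single j 1)
      (x - (x₀ - ε • ν))) • fun x => W x j) 1 (vol Ω) :=
    (hWj j).smul ((hk j).memLp_sub hbdd hy 1)
  exact congrArg _ (integral_finsetSum _ fun j _ => memLp_one_iff_integrable.1 (hint j)).symm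

theorem integral_norm_sq_mul_baseKernel_le
    (hbdd : Bornology.IsBounded (Ω : Set (EuclideanSpace ℝ (Fin n)))) (hν : ‖ν‖ = 1) {ε : ℝ}
    (hy : x₀ - ε • ν ∉ closure (Ω : Set (EuclideanSpace ℝ (Fin n)))) :
    ∫ x in Ω, ‖x - (x₀ - ε • ν)‖ ^ 2 * baseKernel (x - (x₀ - ε • ν))
      ≤ 2 * (∫ x in Ω, baseKernel (x - (x₀ - ε • ν)) * ‖x - x₀‖ ^ 2)
        + 2 * ε ^ 2 * ∫ x in Ω, baseKernel (x - (x₀ - ε • ν)) := by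
  have hb := isHomogeneousKernel_baseKernel.memLp_sub hbdd hy 1
  have hbi := memLp_one_iff_integrable.1 hb
  have hbx : Integrable (fun x => baseKernel (x - (x₀ - ε • ν)) * ‖x - x₀‖ ^ 2) (vol Ω) :=
    memLp_one_iff_integrable.1 <| (memLp_of_continuousOn_closure hbdd (by fun_prop) ⊤).mul' hb
  rw [← integral_const_mul, ← integral_const_mul,
    ← integral_add (hbx.const_mul 2) (hbi.const_mul _)]
  refine integral_mono_of_nonneg
    (.of_forall fun x => mul_nonneg (sq_nonneg _) (baseKernel_nonneg _))
    ((hbx.const_mul 2).add (hbi.const_mul _)) (.of_forall fun x => ?_)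
  have hnorm : ‖x - (x₀ - ε • ν)‖ ^ 2 ≤ 2 * (‖x - x₀‖ ^ 2 + ε ^ 2) := by
    calc ‖x - (x₀ - ε • ν)‖ ^ 2 ≤ (‖x - x₀‖ + |ε|) ^ 2 := by
          gcongr
          rw [sub_sub_eq_add_sub, add_sub_right_comm]
          refine (norm_add_le _ _).trans_eq ?_
          rw [norm_smul, hν, mul_one, Real.norm_eq_abs]
      _ ≤ 2 * (‖x - x₀‖ ^ 2 + ε ^ 2) := by
          rw [← sq_abs ε]
          exact add_sq_le
  calc ‖x - (x₀ - ε • ν)‖ ^ 2 * baseKernel (x - (x₀ - ε • ν))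
      ≤ 2 * (‖x - x₀‖ ^ 2 + ε ^ 2) * baseKernel (x - (x₀ - ε • ν)) :=
        mul_le_mul_of_nonneg_right hnorm (baseKernel_nonneg _)
    _ = _ := by ring

theorem tendsto_pow_mul_integral_baseKernel_mul (hn : 3 ≤ n)
    (hbdd : Bornology.IsBounded (Ω : Set (EuclideanSpace ℝ (Fin n))))
    (hν : IsInnerNormal (Ω : Set _) x₀ ν) {g : EuclideanSpace ℝ (Fin n) → ℝ} (hg : Continuous g) :
    Tendsto (fun ε : ℝ => ε ^ (n - 2) * ∫ x in Ω, baseKernel (x - (x₀ - ε • ν)) * g x) (𝓝[>] 0)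
      (𝓝 ((∫ z in halfSpace ν, baseKernel (z + ν)) * g x₀)) :=
  isHomogeneousKernel_baseKernel.tendsto_pow_smul_setIntegral hn hν
    (memLp_of_continuousOn_closure hbdd hg.continuousOn ⊤) hg.continuousWithinAt

theorem tendsto_pow_mul_integral_baseKernel (hn : 3 ≤ n)
    (hbdd : Bornology.IsBounded (Ω : Set (EuclideanSpace ℝ (Fin n))))
    (hν : IsInnerNormal (Ω : Set _) x₀ ν) :
    Tendsto (fun ε : ℝ => ε ^ (n - 2) * ∫ x in Ω, baseKernel (x - (x₀ - ε • ν))) (𝓝[>] 0)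
      (𝓝 (∫ z in halfSpace ν, baseKernel (z + ν))) := by
  simpa only [mul_one] using
    tendsto_pow_mul_integral_baseKernel_mul hn hbdd hν (continuous_const (y := (1 : ℝ)))

theorem tendsto_pow_mul_integral_norm_sq_mul_baseKernel (hn : 3 ≤ n)
    (hbdd : Bornology.IsBounded (Ω : Set (EuclideanSpace ℝ (Fin n))))
    (hν : IsInnerNormal (Ω : Set _) x₀ ν) :
    Tendsto (fun ε : ℝ => ε ^ (n - 2) *
      ∫ x in Ω, ‖x - (x₀ - ε • ν)‖ ^ 2 * baseKernel (x - (x₀ - ε • ν))) (𝓝[>] 0) (𝓝 0) := by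
  have hbase := tendsto_pow_mul_integral_baseKernel hn hbdd hν
  have hnorm := tendsto_pow_mul_integral_baseKernel_mul hn hbdd hν (g := fun x => ‖x - x₀‖ ^ 2)
    (by fun_prop)
  have hε : Tendsto (fun ε : ℝ => 2 * ε ^ 2) (𝓝[>] 0) (𝓝 0) :=
    ((by fun_prop : Continuous fun ε : ℝ => 2 * ε ^ 2).tendsto' 0 0 (by simp)).mono_left
      nhdsWithin_le_nhds
  have hup := (hnorm.const_mul 2).add (hε.mul hbase)
  rw [sub_self, norm_zero, zero_pow two_ne_zero, mul_zero, mul_zero, zero_mul, add_zero] at hup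
  refine tendsto_of_tendsto_of_tendsto_of_le_of_le' tendsto_const_nhds hup ?_ ?_
  · filter_upwards [self_mem_nhdsWithin] with ε (hε : 0 < ε)
    exact mul_nonneg (by positivity)
      (integral_nonneg fun _ => mul_nonneg (sq_nonneg _) (baseKernel_nonneg _))
  · filter_upwards [hν.eventually_notMem_closure, self_mem_nhdsWithin] with ε hy (hε : 0 < ε)
    refine (mul_le_mul_of_nonneg_left (integral_norm_sq_mul_baseKernel_le hbdd hν.norm_eq hy)
      (by positivity)).trans_eq ?_
    ring

variable {A₁ A₂ : EuclideanSpace ℝ (Fin n) → EuclideanSpace ℂ (Fin n)}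
  {q₁ q₂ : EuclideanSpace ℝ (Fin n) → ℂ}

theorem tendsto_pow_smul_integral_wronskianKernel_of_cauchyData_eq (hn : 3 ≤ n)
    (hbdd : Bornology.IsBounded (Ω : Set (EuclideanSpace ℝ (Fin n))))
    (hν : IsInnerNormal (Ω : Set _) x₀ ν) (hx₀ : x₀ ∉ Ω)
    (hA₁ : MemLp A₁ ⊤ (vol Ω)) (hA₂ : MemLp A₂ ⊤ (vol Ω))
    (hq₁ : MemLp q₁ ⊤ (vol Ω)) (hq₂ : MemLp q₂ ⊤ (vol Ω))
    (hC : cauchyData Ω A₁ q₁ = cauchyData Ω A₂ q₂) (τ : EuclideanSpace ℝ (Fin n)) :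
    Tendsto (fun ε : ℝ => ε ^ (n - 2) • ∫ x in Ω, ∑ j,
      wronskianKernel τ (EuclideanSpace.single j 1) (x - (x₀ - ε • ν)) • (A₁ - A₂) x j) (𝓝[>] 0)
      (𝓝 0) := by
  obtain ⟨K, hK⟩ := exists_norm_integral_wronskianKernel_le hn hbdd hA₁ hq₁ hA₂ hq₂ hC hx₀ τ
  have hup := ((tendsto_pow_mul_integral_norm_sq_mul_baseKernel hn hbdd hν).mul
    (tendsto_pow_mul_integral_baseKernel hn hbdd hν)).const_mul K |>.sqrt
  rw [zero_mul, mul_zero, Real.sqrt_zero] at hup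
  refine squeeze_zero_norm' ?_ hup
  filter_upwards [hν.eventually_le_norm_sub, hν.eventually_notMem_closure, self_mem_nhdsWithin]
    with ε hle hy (hε : 0 < ε)
  have hmain := hK _ hy fun x hx => le_trans (by linarith) (hle x hx)
  refine Real.le_sqrt_of_sq_le ?_
  rw [norm_smul, mul_pow, Real.norm_of_nonneg (by positivity)]
  refine (mul_le_mul_of_nonneg_left hmain (by positivity)).trans_eq ?_
  ring

theorem IsInnerNormal.sum_mul_sub_eq_zero (hn : 3 ≤ n)
    (hbdd : Bornology.IsBounded (Ω : Set (EuclideanSpace ℝ (Fin n))))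
    (hν : IsInnerNormal (Ω : Set _) x₀ ν) (hx₀ : x₀ ∉ Ω) (hτ : ‖τ‖ = 1) (hντ : ⟪ν, τ⟫_ℝ = 0)
    (hA₁ : MemLp A₁ ⊤ (vol Ω)) (hA₂ : MemLp A₂ ⊤ (vol Ω))
    (hA₁x₀ : ContinuousWithinAt A₁ Ω x₀) (hA₂x₀ : ContinuousWithinAt A₂ Ω x₀)
    (hq₁ : MemLp q₁ ⊤ (vol Ω)) (hq₂ : MemLp q₂ ⊤ (vol Ω))
    (hC : cauchyData Ω A₁ q₁ = cauchyData Ω A₂ q₂) :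
    ∑ j, (τ j : ℂ) * (A₁ x₀ j - A₂ x₀ j) = 0 := by
  have hlim := tendsto_pow_smul_integral_wronskianKernel hn hbdd hν hτ hντ (hA₁.sub hA₂)
    (hA₁x₀.sub hA₂x₀)
  have hzero :=
    tendsto_pow_smul_integral_wronskianKernel_of_cauchyData_eq hn hbdd hν hx₀ hA₁ hA₂ hq₁ hq₂ hC τ
  exact (smul_eq_zero.1 (tendsto_nhds_unique hlim hzero)).resolve_left
    (integral_wronskianKernel_self_pos hn hν.norm_eq hτ hντ).ne'

end BoundaryDetermination

end MagneticSchrodinger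

open MagneticSchrodinger in
theorem proposition4p1_general {n : ℕ} (hn : 3 ≤ n) {Ω : Opens (EuclideanSpace ℝ (Fin n))}
    (hbdd : Bornology.IsBounded (Ω : Set (EuclideanSpace ℝ (Fin n))))
    {A₁ A₂ : EuclideanSpace ℝ (Fin n) → EuclideanSpace ℂ (Fin n)}
    (hA₁ : MemLp A₁ ⊤ (vol Ω)) (hA₂ : MemLp A₂ ⊤ (vol Ω))
    {q₁ q₂ : EuclideanSpace ℝ (Fin n) → ℂ}
    (hq₁ : MemLp q₁ ⊤ (vol Ω)) (hq₂ : MemLp q₂ ⊤ (vol Ω))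
    (hC : cauchyData Ω A₁ q₁ = cauchyData Ω A₂ q₂) {x₀ : EuclideanSpace ℝ (Fin n)}
    (hx₀ : x₀ ∈ frontier (Ω : Set (EuclideanSpace ℝ (Fin n))))
    (hA₁x₀ : ContinuousWithinAt A₁ Ω x₀) (hA₂x₀ : ContinuousWithinAt A₂ Ω x₀)
    {τ : EuclideanSpace ℝ (Fin n)}
    (hτ : IsTangentVector (Ω : Set (EuclideanSpace ℝ (Fin n))) x₀ τ) :
    ∑ j, (τ j : ℂ) * (A₁ x₀ j - A₂ x₀ j) = 0 := by
  obtain ⟨ν, hν, hντ⟩ := hτ.exists_isInnerNormal hx₀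
  rcases eq_or_ne τ 0 with rfl | hτ0
  · simp
  have hx₀Ω : x₀ ∉ Ω := (Ω.isOpen.frontier_eq.subset hx₀).2
  have hunit := hν.sum_mul_sub_eq_zero hn hbdd hx₀Ω (τ := ‖τ‖⁻¹ • τ) (norm_smul_inv_norm hτ0)
    (by rw [real_inner_smul_right, hντ, mul_zero]) hA₁ hA₂ hA₁x₀ hA₂x₀ hq₁ hq₂ hC
  simp only [PiLp.smul_apply, smul_eq_mul, Complex.ofReal_mul, mul_assoc] at hunit
  rw [← Finset.mul_sum] at hunit
  exact (mul_eq_zero.1 hunit).resolve_left (by simpa using hτ0)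

open MagneticSchrodinger in
theorem proposition4p1 {n : ℕ} (hn : 3 ≤ n)
    (Ω : Opens (EuclideanSpace ℝ (Fin n)))
    (hconn : IsConnected (Ω : Set (EuclideanSpace ℝ (Fin n))))
    (hbdd : Bornology.IsBounded (Ω : Set (EuclideanSpace ℝ (Fin n))))
    (hC1 : HasC1Boundary (Ω : Set (EuclideanSpace ℝ (Fin n))))
    (A₁ A₂ : EuclideanSpace ℝ (Fin n) → EuclideanSpace ℂ (Fin n))
    (hA₁ : ContinuousOn A₁ (closure (Ω : Set (EuclideanSpace ℝ (Fin n)))))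
    (hA₂ : ContinuousOn A₂ (closure (Ω : Set (EuclideanSpace ℝ (Fin n)))))
    (q₁ q₂ : EuclideanSpace ℝ (Fin n) → ℂ)
    (hq₁ : MemLp q₁ ⊤ (volume.restrict (Ω : Set (EuclideanSpace ℝ (Fin n)))))
    (hq₂ : MemLp q₂ ⊤ (volume.restrict (Ω : Set (EuclideanSpace ℝ (Fin n)))))
    (hC : cauchyData Ω A₁ q₁ = cauchyData Ω A₂ q₂)
    (x₀ : EuclideanSpace ℝ (Fin n)) (hx₀ : x₀ ∈ frontier (Ω : Set (EuclideanSpace ℝ (Fin n))))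
    (τ : EuclideanSpace ℝ (Fin n))
    (hτ : IsTangentVector (Ω : Set (EuclideanSpace ℝ (Fin n))) x₀ τ) (hτ1 : ‖τ‖ = 1) :
    ∑ j, (τ j : ℂ) * (A₁ x₀ j - A₂ x₀ j) = 0 := by
  exact proposition4p1_general hn hbdd (memLp_of_continuousOn_closure hbdd hA₁ ⊤)
    (memLp_of_continuousOn_closure hbdd hA₂ ⊤) hq₁ hq₂ hC hx₀
    ((hA₁ x₀ (frontier_subset_closure hx₀)).mono subset_closure)
    ((hA₂ x₀ (frontier_subset_closure hx₀)).mono subset_closure) hτ
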